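/- Let $S\subset\mathbb R^3$ be a compact smooth embedded surface (without boundary), with area measure $da$ and intrinsic distance $d_S$ (infimum of lengths of paths in $S$; $+\infty$ between different components). Put $\Phi_\sigma(r)=\exp(-r^2/(2\sigma^2))$. For a finite set of distinct points $X=\{x_1,\dots,x_I\}\subset S$ let $$\Omega_i=\{y\in S : d_S(y,x_i)\le d_S(y,x_{i'})\ \forall i'\},\qquad \omega_i=\mathrm{area}(\Omega_i),$$ and for a continuous $f:S\to\mathbb R^J$, $\sigma>0$ and $x\in\mathbb R^3$ let $$\mathcal E_X\circ\mathcal R_X[f](x)=\frac1{2\pi\sigma^2}\sum_{i=1}^I f(x_i)\,\omega_i\,\Phi_\sigma(|x-x_i|),\qquad \mathcal E_S[f](x)=\frac1{2\pi\sigma^2}\int_S f(y)\,\Phi_\sigma(|x-y|)\,da(y).$$ Call $X$ a $\delta$-net of $S$ if every $y\in S$ satisfies $d_S(y,x_i)\le\delta$ for some $i$. Then: (a) For every continuous $f:S\to\mathbb R^J$, every $\sigma>0$ and every $x\in\mathbb R^3$, $\mathcal E_X\circ\mathcal R_X[f](x)\to\mathcal E_S[f](x)$ as $X$ ranges over the $\delta$-nets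 of $S$ and $\delta\to0$; that is, for each $\varepsilon>0$ there is $\delta_0>0$ such that $|\mathcal E_X\circ\mathcal R_X[f](x)-\mathcal E_S[f](x)|<\varepsilon$ for all $\delta$-nets $X$ of $S$ with $0<\delta<\delta_0$. (b) For every continuous $f:S\to\mathbb R^J$, as $\sigma\to0^+$, $\mathcal E_S[f](x)\to f(x)$ for every $x\in S$ and $\mathcal E_S[f](x)\to0$ for every $x\in\mathbb R^3\setminus S$. In particular, for the constant function $\mathbf 1:S\to\mathbb R$, $\mathcal E_S[\mathbf 1](x)\to\chi_S(x)$ for every $x\in\mathbb R^3$, where $\chi_S$ is the indicator function of $S$. (c) For every $x\in S$ and every continuous unit normal field $n$ of $S$ (possibly defined only near $x$), $\mathcal E_S[\mathbf 1]$ is differentiable at $x$ for each $\sigma>0$ and $\nabla\mathcal E_S[\mathbf 1](x)\to-H(x)\,n(x)$ as $\sigma\to0^+$, where $H=\tfrac12\operatorname{tr}(dn)$ is the mean curvature with respect to $n$ (so that a sphere of radius $R$ with its outward normal has $H=1/R$). -/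

import Mathlib

open MeasureTheory Topology Filter
open scoped ENNReal ContDiff Gradient

noncomputable section

/-- Euclidean three-space. -/
abbrev E3 : Type := EuclideanSpace ℝ (Fin 3)

/-! ### Surfaces -/

/-- `S ⊆ ℝ³` is a smooth (embedded, boundaryless) surface: near each of its points it is a regular
level set of a smooth function. -/
def IsSmoothSurface (S : Set E3) : Prop :=
  ∀ p ∈ S, ∃ U : Set E3, IsOpen U ∧ p ∈ U ∧ ∃ g : E3 → ℝ,
    ContDiffOn ℝ ∞ g U ∧ (∀ y ∈ U, fderiv ℝ g y ≠ 0) ∧ S ∩ U = {y ∈ U | g y = 0}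

/-- The area measure `da` of `S`: the two-dimensional Hausdorff measure on `S`, normalised so that
it is Lebesgue measure on planes. -/
def areaMeasure (S : Set E3) : Measure S :=
  Measure.euclideanHausdorffMeasure 2

/-- The intrinsic distance `d_S`: the infimum of the lengths of the paths in `S` from `y` to `z`
(so it is `∞` between different path components of `S`). -/
def intrinsicDist (S : Set E3) (y z : S) : ℝ≥0∞ :=
  ⨅ γ : Path y z, eVariationOn γ Set.univ

/-- The tangent space `T_x S`: the span of the velocities at `x` of the curves in `S`. -/
def surfaceTangent (S : Set E3) (x : E3) : Submodule ℝ E3 :=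
  Submodule.span ℝ {v | ∃ γ : ℝ → E3, γ 0 = x ∧ (∀ᶠ t in 𝓝 (0 : ℝ), γ t ∈ S) ∧ HasDerivAt γ v 0}

/-- `ν` is a unit normal vector of `S` at `x`. -/
def IsUnitNormal (S : Set E3) (x ν : E3) : Prop :=
  ‖ν‖ = 1 ∧ ∀ v ∈ surfaceTangent S x, inner ℝ ν v = 0

/-- The differential `dn_x : T_x S → T_x S` of a unit normal field `n` of `S`. Only the values of
`n` on `S` near `x` matter: all derivatives of `n` within `S` at `x` agree on `T_x S`. -/
def normalDifferential (S : Set E3) (n : E3 → E3) (x : E3) :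
    surfaceTangent S x →L[ℝ] surfaceTangent S x :=
  (surfaceTangent S x).orthogonalProjectionOnto ∘L fderivWithin ℝ n S x ∘L
    (surfaceTangent S x).subtypeL

/-- The mean curvature of `S` at `x` with respect to the unit normal field `n`, with the sign
convention `H = ½ tr (dn)`: a sphere of radius `R` with its outward normal has `H = 1 / R`. -/
def meanCurvature (S : Set E3) (n : E3 → E3) (x : E3) : ℝ :=
  (1 / 2) * LinearMap.trace ℝ (surfaceTangent S x)
    (normalDifferential S n x : surfaceTangent S x →ₗ[ℝ] surfaceTangent S x)

/-! ### Point clouds -/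

/-- The points `X i` of `S` form a `δ`-net of `S`: each point of `S` has intrinsic distance at most
`δ` from one of them. -/
def IsNet (S : Set E3) (δ : ℝ) {I : ℕ} (X : Fin I → S) : Prop :=
  ∀ y : S, ∃ i, intrinsicDist S y (X i) ≤ ENNReal.ofReal δ

/-- The Voronoi cell `Ω_i` of `X i` in `S`. -/
def voronoiCell (S : Set E3) {I : ℕ} (X : Fin I → S) (i : Fin I) : Set S :=
  {y | ∀ i', intrinsicDist S y (X i) ≤ intrinsicDist S y (X i')}

/-- The weights `ω_i = area (Ω_i)`. -/
def voronoiWeight (S : Set E3) {I : ℕ} (X : Fin I → S) (i : Fin I) : ℝ :=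
  (areaMeasure S).real (voronoiCell S X i)

/-! ### Restriction and extension operators -/

/-- The Gaussian radial basis function `Φ_σ(r) = exp (-r² / (2σ²))`. -/
def gaussianRBF (σ r : ℝ) : ℝ :=
  Real.exp (-r ^ 2 / (2 * σ ^ 2))

/-- The restriction (sampling) operator `R_X`. -/
def restrictTo {F : Type*} [TopologicalSpace F] {S : Set E3} {I : ℕ} (X : Fin I → S)
    (f : C(S, F)) : Fin I → F :=
  fun i => f (X i)

/-- The extension operator `E_X[f](x) = ∑ i, f_i c w_i Φ(|x - X_i|)`. -/
def cloudExtend {F : Type*} [NormedAddCommGroup F] [NormedSpace ℝ F] {I : ℕ}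
    (c : ℝ) (w : Fin I → ℝ) (Φ : ℝ → ℝ) (X : Fin I → E3) (f : Fin I → F) (x : E3) : F :=
  ∑ i, (c * w i * Φ ‖x - X i‖) • f i

/-- The extension operator with Gaussian RBF, `c = 1 / (2πσ²)` and Voronoi area weights, for a point
cloud `X` in `S`. -/
def gaussianCloudExtend {F : Type*} [NormedAddCommGroup F] [NormedSpace ℝ F] {S : Set E3} {I : ℕ}
    (σ : ℝ) (X : Fin I → S) (f : Fin I → F) : E3 → F :=
  cloudExtend (1 / (2 * Real.pi * σ ^ 2)) (voronoiWeight S X) (gaussianRBF σ) (fun i => (X i : E3)) f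

/-- The continuous extension operator
`E_S[f](x) = 1 / (2πσ²) ∫_S f(y) Φ_σ(|x - y|) da(y)`. -/
def surfaceExtend {F : Type*} [NormedAddCommGroup F] [NormedSpace ℝ F] {S : Set E3}
    (σ : ℝ) (f : C(S, F)) (x : E3) : F :=
  (1 / (2 * Real.pi * σ ^ 2)) • ∫ y : S, gaussianRBF σ ‖x - (y : E3)‖ • f y ∂(areaMeasure S)

end

/-!
Near each of its points `x₀` the surface is the graph, over its tangent plane, of a `C³` function
`h` that vanishes to second order (`IsSmoothSurface.nonempty_mongeChart`); every part of the
theorem is read off in such a chart.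

**Discrete to continuous.** The sum over the point cloud is a Riemann sum: as the Voronoi cells of
a `δ`-net have diameter at most `2 δ`, uniform continuity of the integrand bounds the error,
provided that the cells cover `S` without overlaps of positive area
(`IsNet.norm_sum_voronoiWeight_sub_integral_le`). The overlaps lie in bisectors `d_S(y, x) =
d_S(y, x')` with `d_S(y, x)` small, and the main point is that these are null sets. No geodesics
are used: the intrinsic distance in a chart is approximated by the energy of chains with many
short steps. In the Euclidean plane the identity `|y' - x'|² + |y - x|² = |y - x'|² + |y' - x|² +
2 ⟨y' - y, x - x'⟩` holds for any four points. For the squared intrinsic distance it survives as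
an inequality with a small relative error (`HasBoundedDifferences.four_point`), obtained by
displacing an almost minimal chain from `y` to `x'` by `(1 - k / N) (y' - y)` in its `k`-th
vertex, and one from `y'` to `x` by the opposite amount, so that they join `y'` to `x'` and `y` to
`x`. The error is controlled because almost minimal chains with nearby endpoints stay close to
each other (`HasBoundedDifferences.near_minimal_chains`). If both `y` and `y'` are on the bisector
of `x` and `x'`, the inequality and its mirror image show that `y' - y` is almost orthogonal to `x
- x'`; hence the bisector is locally bi-Lipschitz to a subset of a line and has zero area
(`MongeChart.areaMeasure_bisector`).

**Gaussian averages.** The graph parametrisation has Lipschitz constant `√(1 + M² R²)` on the disc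
of radius `R`, and its inverse, the projection, is 1-Lipschitz. So the area measure, projected to
the tangent plane, lies between Lebesgue measure and `1 + 4 M² |p|²` times Lebesgue measure
(`MongeChart.planeMeasure_le`). After the substitution `p = σ q` the Gaussian averages over the
surface therefore have the limits of the averages over the tangent plane
(`MongeChart.tendsto_average_sub_average`). For the Gaussian itself the limit is `1`, and the
Gaussian is an approximate identity (`surfaceExtend_tendsto_of_mem`). For its gradient, the part
along the tangent plane is odd up to terms of higher order, and the normal part is a second moment
of `h`; the limit is half the Laplacian of `h` at `x₀` times the normal
(`MongeChart.tendsto_gradient_surfaceExtend_one`).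

**Mean curvature.** A continuous unit normal field is, up to a constant sign, the normal of the
graph, whose derivative at `x₀` is minus the Hessian of `h`; so `-H n` is also half the Laplacian
of `h` times the normal (`MongeChart.neg_meanCurvature_smul_normal`).
-/

/-! ### Monge charts -/

/-- The Euclidean parameter plane. -/
abbrev Plane : Type := EuclideanSpace ℝ (Fin 2)

/-- A Monge chart of `S` at `x₀`: near `x₀` the set `S` is the graph, over the plane through `x₀`
with orthonormal frame `L` and unit normal `ν`, of a `C³` function `h` that vanishes to second
order at `0`. The function `h` is defined on the whole plane; `M` bounds its second and third
derivatives, and the radius `r`, in which the graph describes `S`, is small compared to `1 / M`. -/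
structure MongeChart (S : Set E3) (x₀ : E3) where
  L : Plane →ₗᵢ[ℝ] E3
  ν : E3
  norm_ν : ‖ν‖ = 1
  inner_ν : ∀ p, inner ℝ ν (L p) = 0
  h : Plane → ℝ
  contDiff_h : ContDiff ℝ 3 h
  h_zero : h 0 = 0
  fderiv_h_zero : fderiv ℝ h 0 = 0
  M : ℝ
  M_nonneg : 0 ≤ M
  fderiv_sub_le : ∀ p q, ‖fderiv ℝ h p - fderiv ℝ h q‖ ≤ M * ‖p - q‖
  fderiv_second_difference_le : ∀ p v e,
    ‖fderiv ℝ h (p + v + e) - fderiv ℝ h (p + v) - fderiv ℝ h (p + e) + fderiv ℝ h p‖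
      ≤ M * ‖v‖ * ‖e‖
  r : ℝ
  r_pos : 0 < r
  r_le : r ≤ 1
  M_mul_r_le : M * r ≤ 1 / 100
  mem_iff : ∀ y, ‖y - x₀‖ < r →
    (y ∈ S ↔ inner ℝ ν (y - x₀) = h (L.toContinuousLinearMap.adjoint (y - x₀)))

/-- A bound for the second difference of a `C²` map by a Lipschitz constant of its derivative. -/
theorem norm_second_difference_le {E F : Type*} [NormedAddCommGroup E] [NormedSpace ℝ E]
    [NormedAddCommGroup F] [NormedSpace ℝ F] {f : E → F} (hf : Differentiable ℝ f) {K : ℝ}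
    (hK : ∀ p q, ‖fderiv ℝ f p - fderiv ℝ f q‖ ≤ K * ‖p - q‖) (p v e : E) :
    ‖f (p + v + e) - f (p + v) - f (p + e) + f p‖ ≤ K * ‖v‖ * ‖e‖ := by
  have hd : ∀ q, HasFDerivAt (fun q => f (q + v) - f q) (fderiv ℝ f (q + v) - fderiv ℝ f q) q := by
    intro q
    have h1 : HasFDerivAt (fun q => f (q + v)) (fderiv ℝ f (q + v)) q := by
      simpa [Function.comp_def] using
        (hf (q + v)).hasFDerivAt.comp q ((hasFDerivAt_id q).add_const v)
    exact h1.sub (hf q).hasFDerivAt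
  have := Convex.norm_image_sub_le_of_norm_hasFDerivWithin_le (C := K * ‖v‖) (s := Set.univ)
    (x := p) (y := p + e) (fun q _ => (hd q).hasFDerivWithinAt)
    (fun q _ => by simpa using hK (q + v) q) convex_univ trivial trivial
  simp only [add_sub_cancel_left] at this
  convert this using 2
  rw [add_right_comm p v e]; abel

/-- Every nonzero vector `ν` of `ℝ³` is completed by an orthonormal frame of its orthogonal plane. -/
theorem exists_linearIsometry_orthogonal (ν : E3) (hν : ν ≠ 0) :
    ∃ L : Plane →ₗᵢ[ℝ] E3, ∀ p, inner ℝ ν (L p) = 0 := by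
  have : Fact (Module.finrank ℝ E3 = 2 + 1) := ⟨by simp⟩
  let b := OrthonormalBasis.fromOrthogonalSpanSingleton (𝕜 := ℝ) 2 hν
  refine ⟨(Submodule.subtypeₗᵢ _).comp b.repr.symm.toLinearIsometry, fun p => ?_⟩
  have := (b.repr.symm p).2
  rw [Submodule.mem_orthogonal_singleton_iff_inner_right] at this
  exact this

theorem inner_linearIsometry_adjoint (L : Plane →ₗᵢ[ℝ] E3) (z : E3) (p : Plane) :
    inner ℝ (L.toContinuousLinearMap.adjoint z) p = inner ℝ z (L p) := by
  rw [ContinuousLinearMap.adjoint_inner_left]; rfl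

theorem adjoint_linearIsometry_self (L : Plane →ₗᵢ[ℝ] E3) (p : Plane) :
    L.toContinuousLinearMap.adjoint (L p) = p := by
  refine ext_inner_right ℝ fun q => ?_
  rw [inner_linearIsometry_adjoint, L.inner_map_map]

theorem adjoint_linearIsometry_normal {L : Plane →ₗᵢ[ℝ] E3} {ν : E3}
    (h : ∀ p, inner ℝ ν (L p) = 0) : L.toContinuousLinearMap.adjoint ν = 0 := by
  refine ext_inner_right ℝ fun q => ?_
  rw [inner_linearIsometry_adjoint, h, inner_zero_left]

/-- The orthogonal decomposition of a vector along the plane `range L` and its unit normal. -/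
theorem linearIsometry_decomposition {L : Plane →ₗᵢ[ℝ] E3} {ν : E3} (hν : ‖ν‖ = 1)
    (h : ∀ p, inner ℝ ν (L p) = 0) (z : E3) :
    L (L.toContinuousLinearMap.adjoint z) + (inner ℝ ν z : ℝ) • ν = z := by
  set w := z - (L (L.toContinuousLinearMap.adjoint z) + (inner ℝ ν z : ℝ) • ν) with hw
  suffices w = 0 by rw [hw, sub_eq_zero] at this; exact this.symm
  have h1 : ∀ p, inner ℝ w (L p) = 0 := by
    intro p
    rw [hw, inner_sub_left, inner_add_left, L.inner_map_map, inner_linearIsometry_adjoint,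
      inner_smul_left, h]
    simp
  have h2 : inner ℝ w ν = 0 := by
    rw [hw, inner_sub_left, inner_add_left, real_inner_comm ν (L _), h, inner_smul_left,
      real_inner_self_eq_norm_sq, hν, real_inner_comm]
    simp
  let K : Submodule ℝ E3 := LinearMap.range L.toLinearMap
  have hKrank : Module.finrank ℝ K = 2 := by
    rw [LinearMap.finrank_range_of_inj L.injective]; simp
  have hK1 : Module.finrank ℝ Kᗮ = 1 := by
    have := K.finrank_add_finrank_orthogonal
    rw [hKrank] at this
    simp at this
    omega
  have hwK : w ∈ Kᗮ := by
    rw [Submodule.mem_orthogonal]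
    rintro _ ⟨p, rfl⟩
    rw [real_inner_comm]; exact h1 p
  have hνK : ν ∈ Kᗮ := by
    rw [Submodule.mem_orthogonal]
    rintro _ ⟨p, rfl⟩
    rw [real_inner_comm]; exact h p
  have hν0 : (⟨ν, hνK⟩ : Kᗮ) ≠ 0 := by
    intro h0
    have : ν = 0 := congrArg Subtype.val h0
    rw [this] at hν; simp at hν
  obtain ⟨t, ht⟩ := exists_smul_eq_of_finrank_eq_one hK1 hν0 ⟨w, hwK⟩
  have ht' : t • ν = w := congrArg Subtype.val ht
  rw [← ht', inner_smul_left, real_inner_self_eq_norm_sq, hν] at h2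
  rw [← ht']
  simp at h2
  simp [h2]

/-- A function that is `C³` near `0` agrees near `0` with a compactly supported `C³` function. -/
theorem exists_contDiff_hasCompactSupport_eventuallyEq {ψ : Plane → ℝ}
    (hψ : ContDiffAt ℝ 3 ψ 0) :
    ∃ h : Plane → ℝ, ContDiff ℝ 3 h ∧ HasCompactSupport h ∧ h =ᶠ[𝓝 0] ψ := by
  have hev := hψ.eventually (by decide)
  obtain ⟨R, hR, hball⟩ := Metric.eventually_nhds_iff_ball.1 hev
  let φ : ContDiffBump (0 : Plane) := ⟨R / 4, R / 2, by positivity, by linarith⟩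
  refine ⟨fun p => φ p * ψ p, ?_, ?_, ?_⟩
  · rw [contDiff_iff_contDiffAt]
    intro p
    by_cases hp : p ∈ Metric.ball (0 : Plane) R
    · exact (φ.contDiff.contDiffAt).mul (hball p hp)
    · have : p ∉ tsupport φ := by
        rw [φ.tsupport_eq]
        simp only [Metric.mem_ball, Metric.mem_closedBall, not_lt, not_le] at hp ⊢
        change R / 2 < _
        linarith
      have h0 : (fun p => φ p * ψ p) =ᶠ[𝓝 p] fun _ => 0 := by
        filter_upwards [notMem_tsupport_iff_eventuallyEq.1 this] with q hq
        rw [hq]; simp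
      exact contDiffAt_const.congr_of_eventuallyEq h0
  · exact φ.hasCompactSupport.mul_right
  · filter_upwards [φ.eventuallyEq_one] with q hq
    rw [hq]; simp

theorem exists_norm_sub_le_of_hasCompactSupport {E F : Type*} [NormedAddCommGroup E]
    [NormedSpace ℝ E] [NormedAddCommGroup F] [NormedSpace ℝ F] {f : E → F}
    (hf : ContDiff ℝ 1 f) (hs : HasCompactSupport f) :
    ∃ K : ℝ, 0 ≤ K ∧ ∀ p q, ‖f p - f q‖ ≤ K * ‖p - q‖ := by
  obtain ⟨K, hK⟩ := ContDiff.lipschitzWith_of_hasCompactSupport hs hf (by norm_num)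
  refine ⟨K, K.2, fun p q => ?_⟩
  simpa [dist_eq_norm] using hK.dist_le_mul p q

theorem MongeChart.nonempty_of_hasCompactSupport {S : Set E3} {x₀ ν : E3} {L : Plane →ₗᵢ[ℝ] E3}
    {h : Plane → ℝ} (hνn : ‖ν‖ = 1) (hL : ∀ p, inner ℝ ν (L p) = 0) (hc : ContDiff ℝ 3 h)
    (hsupp : HasCompactSupport h) (h0 : h 0 = 0) (hd0 : fderiv ℝ h 0 = 0)
    (hnear : ∀ᶠ y in 𝓝 x₀, (y ∈ S ↔ inner ℝ ν (y - x₀) =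
      h (L.toContinuousLinearMap.adjoint (y - x₀)))) : Nonempty (MongeChart S x₀) := by
  have hfc2 : ContDiff ℝ 2 (fderiv ℝ h) := hc.fderiv_right (by norm_num)
  have hfc1 : ContDiff ℝ 1 (fderiv ℝ (fderiv ℝ h)) := hfc2.fderiv_right (by norm_num)
  obtain ⟨K₁, hK₁0, hK₁⟩ := exists_norm_sub_le_of_hasCompactSupport (hfc2.of_le (by norm_num))
    (hsupp.fderiv ℝ)
  obtain ⟨K₂, hK₂0, hK₂⟩ := exists_norm_sub_le_of_hasCompactSupport hfc1
    ((hsupp.fderiv ℝ).fderiv ℝ)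
  obtain ⟨R, hR, hRball⟩ := Metric.eventually_nhds_iff_ball.1 hnear
  obtain ⟨M, hM0, hM1, hM2⟩ : ∃ M : ℝ, 0 ≤ M ∧ K₁ ≤ M ∧ K₂ ≤ M :=
    ⟨K₁ + K₂, by positivity, by linarith, by linarith⟩
  obtain ⟨r, hr, hr1, hrM, hrR⟩ : ∃ r : ℝ, 0 < r ∧ r ≤ 1 ∧ M * r ≤ 1 / 100 ∧ r ≤ R := by
    refine ⟨min R (min 1 (1 / (100 * (M + 1)))), by positivity,
      (min_le_right _ _).trans (min_le_left _ _), ?_, min_le_left _ _⟩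
    calc M * min R (min 1 (1 / (100 * (M + 1)))) ≤ M * (1 / (100 * (M + 1))) := by
          gcongr
          exact (min_le_right _ _).trans (min_le_right _ _)
      _ ≤ 1 / 100 := by
          rw [mul_one_div, div_le_div_iff₀ (by positivity) (by norm_num)]
          linarith
  refine ⟨⟨L, ν, hνn, hL, h, hc, h0, hd0, M, hM0, fun p q => ?_, fun p v e => ?_, r, hr, hr1, hrM,
    fun y hy => hRball y (by rw [Metric.mem_ball, dist_eq_norm]; exact hy.trans_le hrR)⟩⟩
  · exact (hK₁ p q).trans (by gcongr)
  · refine norm_second_difference_le (K := M) (hfc2.differentiable (by norm_num))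
      (fun p q => ?_) p v e
    exact (hK₂ p q).trans (by gcongr)

/-- The implicit function theorem, in the form of a Monge chart at each point of the surface. -/
theorem IsSmoothSurface.nonempty_mongeChart {S : Set E3} (hS : IsSmoothSurface S) {x₀ : E3}
    (hx₀ : x₀ ∈ S) : Nonempty (MongeChart S x₀) := by
  obtain ⟨U, hU, hxU, g, hg, hdg, hSU⟩ := hS x₀ hx₀
  have hg0 : g x₀ = 0 := by
    have : x₀ ∈ {y ∈ U | g y = 0} := hSU ▸ ⟨hx₀, hxU⟩
    exact this.2
  have hgat : ContDiffAt ℝ 3 g x₀ :=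
    (hg.contDiffAt (hU.mem_nhds hxU)).of_le (WithTop.coe_le_coe.2 (le_top : (3 : ℕ∞) ≤ ⊤))
  set D := fderiv ℝ g x₀ with hD
  have hgd : HasFDerivAt g D x₀ := (hgat.differentiableAt (by norm_num)).hasFDerivAt
  set w := (InnerProductSpace.toDual ℝ E3).symm D with hw
  have hwD : ∀ v, inner ℝ w v = D v := fun v => by
    rw [hw, InnerProductSpace.toDual_symm_apply]
  have hw0 : w ≠ 0 := by
    intro h0
    apply hdg x₀ hxU
    ext v
    rw [← hD, ← hwD, h0]; simp
  set ν := (‖w‖⁻¹ : ℝ) • w with hν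
  have hνn : ‖ν‖ = 1 := by
    rw [hν, norm_smul, norm_inv, norm_norm, inv_mul_cancel₀ (norm_ne_zero_iff.2 hw0)]
  have hν0 : ν ≠ 0 := by intro h; rw [h] at hνn; simp at hνn
  obtain ⟨L, hL⟩ := exists_linearIsometry_orthogonal ν hν0
  have hDL : ∀ p, D (L p) = 0 := by
    intro p
    have := hL p
    rw [hν, inner_smul_left, hwD] at this
    simpa [hw0] using this
  have hDν : D ν ≠ 0 := by
    rw [← hwD, hν, inner_smul_right, real_inner_self_eq_norm_sq]
    have := norm_ne_zero_iff.2 hw0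
    positivity
  let A : Plane × ℝ →L[ℝ] E3 := L.toContinuousLinearMap.coprod
    (ContinuousLinearMap.toSpanSingleton ℝ ν)
  have hA : ∀ p t, A (p, t) = L p + t • ν := by intro p t; simp [A]
  let f : Plane × ℝ → ℝ := fun z => g (x₀ + A z)
  have hfd : HasFDerivAt f (D ∘L A) 0 := by
    have h1 : HasFDerivAt (fun z => x₀ + A z) A 0 := A.hasFDerivAt.const_add x₀
    have h2 : HasFDerivAt g D (x₀ + A 0) := by simpa using hgd
    exact h2.comp 0 h1
  have hfc : ContDiffAt ℝ 3 f 0 := by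
    have h1 : ContDiffAt ℝ 3 (fun z => x₀ + A z) 0 := by fun_prop
    have h2 : ContDiffAt ℝ 3 g (x₀ + A 0) := by simpa using hgat
    exact h2.comp 0 h1
  have hinv : (fderiv ℝ f 0 ∘L ContinuousLinearMap.inr ℝ Plane ℝ).IsInvertible := by
    rw [hfd.fderiv]
    refine ⟨ContinuousLinearEquiv.unitsEquivAut ℝ (Units.mk0 (D ν) hDν), ?_⟩
    ext
    simp [hA]
  have h3 : (3 : WithTop ℕ∞) ≠ 0 := by norm_num
  set ψ := hfc.implicitFunction h3 hinv with hψ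
  have hψ0 : ψ 0 = 0 := hfc.implicitFunction_apply_self h3 hinv
  have hψc : ContDiffAt ℝ 3 ψ 0 := hfc.contDiffAt_implicitFunction h3 hinv
  have hψd : fderiv ℝ ψ 0 = 0 := by
    have := (hfc.hasStrictFDerivAt_implicitFunction h3 hinv).hasFDerivAt.fderiv
    rw [Prod.fst_zero] at this
    rw [hψ, this, hfd.fderiv]
    have h0 : (D ∘L A) ∘L ContinuousLinearMap.inl ℝ Plane ℝ = 0 := by
      ext p; simp [hA, hDL]
    rw [h0, ContinuousLinearMap.comp_zero, neg_zero]
  have hψeq : ∀ᶠ z in 𝓝 (0 : Plane × ℝ), g (x₀ + A z) = 0 ↔ ψ z.1 = z.2 := by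
    filter_upwards [hfc.eventually_apply_eq_iff_implicitFunction h3 hinv] with z hz
    rw [← hz]
    simp [f, hg0]
  obtain ⟨h, hc, hsupp, heq⟩ := exists_contDiff_hasCompactSupport_eventuallyEq hψc
  -- the coordinates of a point of `ℝ³` in the frame
  let T : E3 → Plane × ℝ := fun y =>
    (L.toContinuousLinearMap.adjoint (y - x₀), inner ℝ ν (y - x₀))
  have hT : Continuous T := by fun_prop
  have hT0 : T x₀ = 0 := by simp [T]
  have hAT : ∀ y, x₀ + A (T y) = y := by
    intro y
    rw [hA, linearIsometry_decomposition hνn hL]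
    abel
  have hnear : ∀ᶠ y in 𝓝 x₀, (y ∈ S ↔ inner ℝ ν (y - x₀) =
      h (L.toContinuousLinearMap.adjoint (y - x₀))) := by
    have h1 : ∀ᶠ y in 𝓝 x₀, g (x₀ + A (T y)) = 0 ↔ ψ (T y).1 = (T y).2 :=
      (hT.tendsto' x₀ 0 hT0).eventually hψeq
    have h2 : ∀ᶠ y in 𝓝 x₀, h (T y).1 = ψ (T y).1 :=
      ((continuous_fst.comp hT).tendsto' x₀ 0 (by simp [hT0])).eventually heq
    filter_upwards [h1, h2, hU.mem_nhds hxU] with y hy1 hy2 hyU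
    rw [hAT] at hy1
    have : y ∈ S ↔ g y = 0 := by
      constructor
      · intro hy
        have : y ∈ {y ∈ U | g y = 0} := hSU ▸ ⟨hy, hyU⟩
        exact this.2
      · intro hy
        have : y ∈ S ∩ U := hSU ▸ ⟨hyU, hy⟩
        exact this.1
    rw [this, hy1, ← hy2]
    exact eq_comm
  exact MongeChart.nonempty_of_hasCompactSupport hνn hL hc hsupp (by rw [heq.self_of_nhds, hψ0])
    (by rw [heq.fderiv_eq, hψd]) hnear

/-! ### Energies of chains on a graph -/

section Chains

variable {E : Type*} [NormedAddCommGroup E] [InnerProductSpace ℝ E]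

/-- The discrete energy of the `N`-step chain `a`, lifted to the graph of `h`. -/
noncomputable def chainEnergy (h : E → ℝ) (N : ℕ) (a : ℕ → E) : ℝ :=
  N * ∑ k ∈ Finset.range N, (‖a (k + 1) - a k‖ ^ 2 + (h (a (k + 1)) - h (a k)) ^ 2)

theorem norm_add_smul_sub_le {p q : E} {R t : ℝ} (hp : ‖p‖ ≤ R) (hq : ‖q‖ ≤ R)
    (ht : t ∈ Set.Icc (0 : ℝ) 1) : ‖p + t • (q - p)‖ ≤ R := by
  have : p + t • (q - p) ∈ Metric.closedBall (0 : E) R :=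
    (convex_closedBall (0 : E) R).add_smul_sub_mem (by simpa using hp) (by simpa using hq) ht
  simpa using this

/-- The function `h` has bounded second and third derivatives, in the form of bounds for first and
second differences of its derivative, and is stationary at `0`. -/
structure HasBoundedDifferences (h : E → ℝ) (M : ℝ) : Prop where
  nonneg : 0 ≤ M
  differentiable : Differentiable ℝ h
  sub_le : ∀ p q, ‖fderiv ℝ h p - fderiv ℝ h q‖ ≤ M * ‖p - q‖
  second_le : ∀ p v e, ‖fderiv ℝ h (p + v + e) - fderiv ℝ h (p + v) - fderiv ℝ h (p + e)
    + fderiv ℝ h p‖ ≤ M * ‖v‖ * ‖e‖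
  fderiv_zero : fderiv ℝ h 0 = 0

namespace HasBoundedDifferences

variable {h : E → ℝ} {M : ℝ}

theorem norm_fderiv_le (H : HasBoundedDifferences h M) (p : E) : ‖fderiv ℝ h p‖ ≤ M * ‖p‖ := by
  simpa [H.fderiv_zero] using H.sub_le p 0

theorem norm_fderiv_le_of_le (H : HasBoundedDifferences h M) {p : E} {ρ : ℝ} (hp : ‖p‖ ≤ ρ) :
    ‖fderiv ℝ h p‖ ≤ M * ρ :=
  (H.norm_fderiv_le p).trans (by gcongr; exact H.nonneg)

theorem hasDerivAt_comp_line (H : HasBoundedDifferences h M) (p q : E) (t : ℝ) :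
    HasDerivAt (fun t : ℝ => h (p + t • q)) (fderiv ℝ h (p + t • q) q) t := by
  have h1 : HasDerivAt (fun t : ℝ => p + t • q) q t := by
    simpa using ((hasDerivAt_id t).smul_const q).const_add p
  exact (H.differentiable (p + t • q)).hasFDerivAt.comp_hasDerivAt t h1

theorem abs_sub_le (H : HasBoundedDifferences h M) {ρ : ℝ} {p q : E} (hp : ‖p‖ ≤ ρ)
    (hq : ‖q‖ ≤ ρ) : |h q - h p| ≤ M * ρ * ‖q - p‖ := by
  have := norm_image_sub_le_of_norm_deriv_le_segment_01' (C := M * ρ * ‖q - p‖)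
    (fun t _ => (H.hasDerivAt_comp_line p (q - p) t).hasDerivWithinAt) (fun t ht => by
      refine (ContinuousLinearMap.le_opNorm _ _).trans ?_
      gcongr
      exact H.norm_fderiv_le_of_le (norm_add_smul_sub_le hp hq ⟨ht.1, ht.2.le⟩))
  simpa using this

/-- The change along a step of the increment of `h` by a displacement of size at most `V`. -/
theorem abs_increment_sub_le (H : HasBoundedDifferences h M) {ρ V : ℝ} {p p' v v' : E}
    (hv : ‖v‖ ≤ V) (hv' : ‖v'‖ ≤ V) (hp : ‖p + v‖ ≤ ρ) (hp' : ‖p' + v'‖ ≤ ρ) :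
    |(h (p' + v') - h p') - (h (p + v) - h p)|
      ≤ M * V * ‖p' - p‖ + M * ρ * ‖v' - v‖ := by
  have key : ∀ t ∈ Set.Ico (0 : ℝ) 1,
      ‖fderiv ℝ h ((p + v) + t • ((p' + v') - (p + v))) ((p' + v') - (p + v))
        - fderiv ℝ h (p + t • (p' - p)) (p' - p)‖ ≤ M * V * ‖p' - p‖ + M * ρ * ‖v' - v‖ := by
    intro t ht
    have ht' : t ∈ Set.Icc (0 : ℝ) 1 := ⟨ht.1, ht.2.le⟩
    set P := (p + v) + t • ((p' + v') - (p + v)) with hP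
    set Q := p + t • (p' - p) with hQ
    have e1 : fderiv ℝ h P ((p' + v') - (p + v)) - fderiv ℝ h Q (p' - p)
        = (fderiv ℝ h P - fderiv ℝ h Q) (p' - p) + fderiv ℝ h P (v' - v) := by
      rw [_root_.sub_apply, ← sub_eq_zero]
      have : (p' + v') - (p + v) = (p' - p) + (v' - v) := by abel
      rw [this, map_add]; ring
    have e2 : P - Q = v + t • (v' - v) := by rw [hP, hQ]; module
    rw [e1]
    refine (norm_add_le _ _).trans (add_le_add ?_ ?_)
    · refine (ContinuousLinearMap.le_opNorm _ _).trans ?_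
      gcongr
      refine (H.sub_le P Q).trans ?_
      rw [e2]
      have := H.nonneg
      gcongr
      exact norm_add_smul_sub_le hv hv' ht'
    · refine (ContinuousLinearMap.le_opNorm _ _).trans ?_
      gcongr
      exact H.norm_fderiv_le_of_le (norm_add_smul_sub_le hp hp' ht')
  have := norm_image_sub_le_of_norm_deriv_le_segment_01'
    (fun t _ => ((H.hasDerivAt_comp_line (p + v) ((p' + v') - (p + v)) t).sub
      (H.hasDerivAt_comp_line p (p' - p) t)).hasDerivWithinAt) key
  simpa using this

/-- The change along a step of the sum of the increments of `h` by opposite displacements `v`, `-v`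
at two points `a`, `b`: the leading terms cancel. -/
theorem abs_opposite_increments_sub_le (H : HasBoundedDifferences h M) {V C : ℝ}
    {a a' b b' v v' : E} (hv : ‖v‖ ≤ V) (hv' : ‖v'‖ ≤ V) (hc : ‖a - b‖ ≤ C)
    (hc' : ‖a' - b'‖ ≤ C) :
    |(h (a' + v') - h a' + (h (b' - v') - h b')) - (h (a + v) - h a + (h (b - v) - h b))|
      ≤ M * V * (C + V) * ‖a' - a‖ + M * V * ‖(a' - b') - (a - b)‖
        + M * (C + 2 * V) * ‖v' - v‖ := by
  have hM := H.nonneg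
  have hV : 0 ≤ V := (norm_nonneg _).trans hv
  have hC : 0 ≤ C := (norm_nonneg _).trans hc
  have key : ∀ t ∈ Set.Ico (0 : ℝ) 1,
      ‖(fderiv ℝ h ((a + v) + t • ((a' + v') - (a + v))) ((a' + v') - (a + v))
        - fderiv ℝ h (a + t • (a' - a)) (a' - a))
        + (fderiv ℝ h ((b - v) + t • ((b' - v') - (b - v))) ((b' - v') - (b - v))
        - fderiv ℝ h (b + t • (b' - b)) (b' - b))‖ ≤
        M * V * (C + V) * ‖a' - a‖ + M * V * ‖(a' - b') - (a - b)‖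
        + M * (C + 2 * V) * ‖v' - v‖ := by
    intro t ht
    have ht' : t ∈ Set.Icc (0 : ℝ) 1 := ⟨ht.1, ht.2.le⟩
    set w := v + t • (v' - v) with hw
    set c := (a - b) + t • ((a' - b') - (a - b)) with hc
    have hwV : ‖w‖ ≤ V := norm_add_smul_sub_le hv hv' ht'
    have hcC : ‖c‖ ≤ C := norm_add_smul_sub_le (by assumption) hc' ht'
    set R := (b - v) + t • ((b' - v') - (b - v)) with hR
    have e1 : b + t • (b' - b) = R + w := by rw [hR, hw]; module
    have e2 : a + t • (a' - a) = R + (c + w) := by rw [hR, hw, hc]; module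
    have e3 : (a + v) + t • ((a' + v') - (a + v)) = R + w + (c + w) := by
      rw [hR, hw, hc]; module
    rw [e1, e2, e3]
    set D0 := fderiv ℝ h R
    set D1 := fderiv ℝ h (R + w)
    set D2 := fderiv ℝ h (R + (c + w))
    set D3 := fderiv ℝ h (R + w + (c + w))
    have e4 : (D3 ((a' + v') - (a + v)) - D2 (a' - a)) + (D0 ((b' - v') - (b - v)) - D1 (b' - b))
        = (D3 - D1 - D2 + D0) (a' - a) + (D1 - D0) ((a' - b') - (a - b)) + (D3 - D0) (v' - v) := by
      simp only [_root_.sub_apply, _root_.add_apply, map_sub, map_add]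
      ring
    rw [e4]
    refine (norm_add₃_le).trans (add_le_add (add_le_add ?_ ?_) ?_)
    · refine (ContinuousLinearMap.le_opNorm _ _).trans ?_
      gcongr
      refine (H.second_le R w (c + w)).trans ?_
      gcongr
      exact (norm_add_le _ _).trans (add_le_add hcC hwV)
    · refine (ContinuousLinearMap.le_opNorm _ _).trans ?_
      gcongr
      refine (H.sub_le _ _).trans ?_
      gcongr
      simpa [D1] using hwV
    · refine (ContinuousLinearMap.le_opNorm _ _).trans ?_
      gcongr
      refine (H.sub_le _ _).trans ?_
      gcongr
      have : R + w + (c + w) - R = w + c + w := by abel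
      rw [this]
      refine (norm_add₃_le).trans ?_
      linarith
  have := norm_image_sub_le_of_norm_deriv_le_segment_01'
    (fun t _ => (((H.hasDerivAt_comp_line (a + v) ((a' + v') - (a + v)) t).sub
      (H.hasDerivAt_comp_line a (a' - a) t)).add
      ((H.hasDerivAt_comp_line (b - v) ((b' - v') - (b - v)) t).sub
      (H.hasDerivAt_comp_line b (b' - b) t))).hasDerivWithinAt) key
  simpa using this

end HasBoundedDifferences

/-- The Cauchy–Schwarz inequality with the normalisation of the chain energy. -/
theorem card_mul_sum_mul_le {N : ℕ} {x z : ℕ → ℝ} {V C : ℝ} (hV : 0 ≤ V) (hC : 0 ≤ C)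
    (hx : N * ∑ k ∈ Finset.range N, x k ^ 2 ≤ V ^ 2)
    (hz : N * ∑ k ∈ Finset.range N, z k ^ 2 ≤ C ^ 2) :
    N * ∑ k ∈ Finset.range N, x k * z k ≤ V * C := by
  have h1 := Finset.sum_mul_sq_le_sq_mul_sq (Finset.range N) x z
  refine abs_le_of_sq_le_sq' ?_ (by positivity) |>.2
  calc (N * ∑ k ∈ Finset.range N, x k * z k) ^ 2
      = (N : ℝ) ^ 2 * (∑ k ∈ Finset.range N, x k * z k) ^ 2 := by ring
    _ ≤ (N : ℝ) ^ 2 * ((∑ k ∈ Finset.range N, x k ^ 2) * ∑ k ∈ Finset.range N, z k ^ 2) := by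
        gcongr
    _ = (N * ∑ k ∈ Finset.range N, x k ^ 2) * (N * ∑ k ∈ Finset.range N, z k ^ 2) := by ring
    _ ≤ V ^ 2 * C ^ 2 := by
        gcongr
    _ = (V * C) ^ 2 := by ring

theorem sum_le_of_card_mul_sum_sq_le {N : ℕ} {x : ℕ → ℝ} {V : ℝ} (hV : 0 ≤ V)
    (hx : N * ∑ k ∈ Finset.range N, x k ^ 2 ≤ V ^ 2) :
    ∑ k ∈ Finset.range N, x k ≤ V := by
  have h1 := Finset.sum_mul_sq_le_sq_mul_sq (Finset.range N) (fun _ => (1 : ℝ)) x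
  refine abs_le_of_sq_le_sq' ?_ hV |>.2
  simpa using h1.trans (by simpa using hx)

theorem norm_sq_opposite_displacements (p q w : E) :
    ‖p + w‖ ^ 2 + ‖q - w‖ ^ 2
      = ‖p‖ ^ 2 + ‖q‖ ^ 2 + (2 * inner ℝ (p - q) w + 2 * ‖w‖ ^ 2) := by
  rw [norm_add_sq_real, norm_sub_sq_real, inner_sub_left]
  ring

/-- The contribution of one step to the height part of the energy, under opposite displacements
`v`, `-v` of two chains. -/
theorem HasBoundedDifferences.height_sq_add_sub_le {h : E → ℝ} {M : ℝ}
    (H : HasBoundedDifferences h M) {ρ s V C x z : ℝ} (hρ0 : 0 ≤ ρ) {a a' b b' v v' : E}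
    (hs : 0 ≤ s) (has : ‖a' - a‖ ≤ s) (hbs : ‖b' - b‖ ≤ s) (hv : ‖v‖ ≤ V) (hv' : ‖v'‖ ≤ V)
    (hc : ‖a - b‖ ≤ C) (hc' : ‖a' - b'‖ ≤ C) (hx : ‖v' - v‖ = x)
    (hz : ‖(a' - b') - (a - b)‖ = z) (ha : ‖a‖ ≤ ρ) (ha' : ‖a'‖ ≤ ρ) (hb : ‖b‖ ≤ ρ)
    (hb' : ‖b'‖ ≤ ρ) (hav : ‖a + v‖ ≤ ρ) (hav' : ‖a' + v'‖ ≤ ρ) (hbv : ‖b - v‖ ≤ ρ)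
    (hbv' : ‖b' - v'‖ ≤ ρ) :
    (h (a' + v') - h (a + v)) ^ 2 + (h (b' - v') - h (b - v)) ^ 2 ≤
      (h a' - h a) ^ 2 + (h b' - h b) ^ 2 +
      (4 * (M * ρ) ^ 2 * x ^ 2
        + (2 * (M * ρ) * s * M * (C + 2 * V) + 2 * M * C * s * (M * ρ)) * x
        + (4 * (M * ρ) * s * M * V) * z + 2 * (M * ρ) ^ 2 * (x * z)
        + (4 * M ^ 2 * V ^ 2 * s ^ 2 + 2 * (M * ρ) * s ^ 2 * M * V * (C + V)
          + 2 * M ^ 2 * C * V * s ^ 2)) := by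
  have hM := H.nonneg
  have hV0 : 0 ≤ V := (norm_nonneg _).trans hv
  have hC0 : 0 ≤ C := (norm_nonneg _).trans hc
  have hx0 : 0 ≤ x := hx ▸ norm_nonneg _
  have hz0 : 0 ≤ z := hz ▸ norm_nonneg _
  have bX := H.abs_increment_sub_le hv hv' hav hav'
  have bY := H.abs_increment_sub_le (p := b) (p' := b') (v := - v) (v' := - v') (V := V) (ρ := ρ)
    (by simpa using hv) (by simpa using hv')
    (by simpa [← sub_eq_add_neg] using hbv) (by simpa [← sub_eq_add_neg] using hbv')
  simp only [← sub_eq_add_neg] at bY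
  have bBA := H.abs_increment_sub_le (p := a) (p' := a') (v := b - a)
    (v' := b' - a') (V := C) (ρ := ρ)
    (by rw [norm_sub_rev]; exact hc) (by rw [norm_sub_rev]; exact hc')
    (by simpa using hb) (by simpa using hb')
  simp only [add_sub_cancel] at bBA
  have bA := H.abs_sub_le ha ha'
  have bXY := H.abs_opposite_increments_sub_le hv hv' hc hc'
  have n1 : ‖-v' - -v‖ = x := by rw [← hx, ← norm_neg]; congr 1; abel
  have n2 : ‖b' - a' - (b - a)‖ = z := by rw [← hz, ← norm_neg]; congr 1; abel
  rw [n1] at bY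
  rw [n2] at bBA
  rw [hx] at bX bXY
  rw [hz] at bXY
  generalize h (a' + v') = A1 at *
  generalize h (a + v) = A0 at *
  generalize h (b' - v') = B1 at *
  generalize h (b - v) = B0 at *
  generalize h a' = a1 at *
  generalize h a = a0 at *
  generalize h b' = b1 at *
  generalize h b = b0 at *
  -- `A`, `B` are the height increments of the two chains, `X`, `Y` their changes
  obtain ⟨X, hX⟩ : ∃ X, X = (A1 - a1) - (A0 - a0) := ⟨_, rfl⟩
  obtain ⟨Y, hY⟩ : ∃ Y, Y = (B1 - b1) - (B0 - b0) := ⟨_, rfl⟩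
  obtain ⟨A, hA⟩ : ∃ A, A = a1 - a0 := ⟨_, rfl⟩
  obtain ⟨B, hB⟩ : ∃ B, B = b1 - b0 := ⟨_, rfl⟩
  obtain ⟨μ, hμ⟩ : ∃ μ, μ = M * ρ := ⟨_, rfl⟩
  have hμ0 : 0 ≤ μ := by rw [hμ]; positivity
  have bX' : |X| ≤ μ * x + M * V * s := by
    rw [hX, hμ]
    have : M * V * ‖a' - a‖ ≤ M * V * s := by gcongr
    linarith
  have bY' : |Y| ≤ μ * x + M * V * s := by
    rw [hY, hμ]
    have : M * V * ‖b' - b‖ ≤ M * V * s := by gcongr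
    linarith
  have bBA' : |B - A| ≤ μ * z + M * C * s := by
    have e : B - A = (b1 - a1) - (b0 - a0) := by rw [hA, hB]; ring
    rw [e, hμ]
    have : M * C * ‖a' - a‖ ≤ M * C * s := by gcongr
    linarith
  have bA' : |A| ≤ μ * s := by
    rw [hA, hμ]
    exact bA.trans (by gcongr)
  have bXY' : |X + Y| ≤ M * V * (C + V) * s + M * V * z + M * (C + 2 * V) * x := by
    have e : X + Y = (A1 - a1 + (B1 - b1)) - (A0 - a0 + (B0 - b0)) := by rw [hX, hY]; ring
    rw [e]
    have : M * V * (C + V) * ‖a' - a‖ ≤ M * V * (C + V) * s := by gcongr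
    linarith
  have q1 : X ^ 2 ≤ 2 * (μ * x) ^ 2 + 2 * (M * V * s) ^ 2 := by
    have : X ^ 2 ≤ (μ * x + M * V * s) ^ 2 := sq_le_sq' (abs_le.1 bX').1 (abs_le.1 bX').2
    linarith [sq_nonneg (μ * x - M * V * s)]
  have q2 : Y ^ 2 ≤ 2 * (μ * x) ^ 2 + 2 * (M * V * s) ^ 2 := by
    have : Y ^ 2 ≤ (μ * x + M * V * s) ^ 2 := sq_le_sq' (abs_le.1 bY').1 (abs_le.1 bY').2
    linarith [sq_nonneg (μ * x - M * V * s)]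
  have q3 : A * (X + Y) ≤ (μ * s) * (M * V * (C + V) * s + M * V * z
      + M * (C + 2 * V) * x) := by
    refine (le_abs_self _).trans ?_
    rw [abs_mul]
    gcongr
  have q4 : (B - A) * Y ≤ (μ * z + M * C * s) * (μ * x + M * V * s) := by
    refine (le_abs_self _).trans ?_
    rw [abs_mul]
    gcongr
  have hAX : A1 - A0 = A + X := by rw [hA, hX]; ring
  have hBY : B1 - B0 = B + Y := by rw [hB, hY]; ring
  rw [hAX, hBY, ← hA, ← hB, ← hμ]
  have expand : (A + X) ^ 2 + (B + Y) ^ 2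
    = A ^ 2 + B ^ 2 + (X ^ 2 + Y ^ 2 + 2 * (A * (X + Y)) + 2 * ((B - A) * Y)) := by ring
  rw [expand]
  linarith

/-- The effect on the energy of two chains `a`, `b` of opposite displacements `v`, `-v`. -/
theorem HasBoundedDifferences.chainEnergy_add_sub_le {h : E → ℝ} {M : ℝ}
    (H : HasBoundedDifferences h M) {ρ s V C : ℝ} (hρ0 : 0 ≤ ρ) (hρ : ρ ≤ 1) {N : ℕ}
    {a b v : ℕ → E} (hs : 0 ≤ s) (hNs : N * s ≤ ρ)
    (has : ∀ k < N, ‖a (k + 1) - a k‖ ≤ s)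
    (hbs : ∀ k < N, ‖b (k + 1) - b k‖ ≤ s)
    (hV0 : 0 ≤ V) (hC0 : 0 ≤ C)
    (hv : ∀ k ≤ N, ‖v k‖ ≤ V) (hc : ∀ k ≤ N, ‖a k - b k‖ ≤ C)
    (hvE : N * ∑ k ∈ Finset.range N, ‖v (k + 1) - v k‖ ^ 2 ≤ V ^ 2)
    (hcE : N * ∑ k ∈ Finset.range N, ‖(a (k + 1) - b (k + 1)) - (a k - b k)‖ ^ 2 ≤ C ^ 2)
    (ha : ∀ k ≤ N, ‖a k‖ ≤ ρ) (hb : ∀ k ≤ N, ‖b k‖ ≤ ρ) (hav : ∀ k ≤ N, ‖a k + v k‖ ≤ ρ)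
    (hbv : ∀ k ≤ N, ‖b k - v k‖ ≤ ρ) :
    chainEnergy h N (fun k => a k + v k) + chainEnergy h N (fun k => b k - v k)
      ≤ chainEnergy h N a + chainEnergy h N b
        + N * ∑ k ∈ Finset.range N,
          (2 * inner ℝ ((a (k + 1) - b (k + 1)) - (a k - b k)) (v (k + 1) - v k)
            + 2 * ‖v (k + 1) - v k‖ ^ 2)
        + 14 * (M * ρ) ^ 2 * (V * (C + V)) := by
  have hM := H.nonneg
  set μ := M * ρ with hμ
  have hμ0 : 0 ≤ μ := by positivity
  set x : ℕ → ℝ := fun k => ‖v (k + 1) - v k‖ with hx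
  set z : ℕ → ℝ := fun k => ‖(a (k + 1) - b (k + 1)) - (a k - b k)‖ with hz
  have hterm : ∀ k ∈ Finset.range N,
      (‖(a (k + 1) + v (k + 1)) - (a k + v k)‖ ^ 2 +
        (h (a (k + 1) + v (k + 1)) - h (a k + v k)) ^ 2) +
      (‖(b (k + 1) - v (k + 1)) - (b k - v k)‖ ^ 2 +
        (h (b (k + 1) - v (k + 1)) - h (b k - v k)) ^ 2) ≤
      (‖a (k + 1) - a k‖ ^ 2 + (h (a (k + 1)) - h (a k)) ^ 2) +
      (‖b (k + 1) - b k‖ ^ 2 + (h (b (k + 1)) - h (b k)) ^ 2) +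
      (2 * inner ℝ ((a (k + 1) - b (k + 1)) - (a k - b k)) (v (k + 1) - v k)
            + 2 * ‖v (k + 1) - v k‖ ^ 2) +
      (4 * μ ^ 2 * x k ^ 2 + (2 * μ * s * M * (C + 2 * V) + 2 * M * C * s * μ) * x k
        + (4 * μ * s * M * V) * z k + 2 * μ ^ 2 * (x k * z k)
        + (4 * M ^ 2 * V ^ 2 * s ^ 2 + 2 * μ * s ^ 2 * M * V * (C + V)
          + 2 * M ^ 2 * C * V * s ^ 2)) := by
    intro k hk
    have hk1 : k < N := Finset.mem_range.1 hk
    have hk0 : k ≤ N := hk1.le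
    have hk2 : k + 1 ≤ N := hk1
    have eucl := norm_sq_opposite_displacements (a (k + 1) - a k) (b (k + 1) - b k)
      (v (k + 1) - v k)
    have e1 : (a (k + 1) + v (k + 1)) - (a k + v k)
      = (a (k + 1) - a k) + (v (k + 1) - v k) := by abel
    have e2 : (b (k + 1) - v (k + 1)) - (b k - v k)
      = (b (k + 1) - b k) - (v (k + 1) - v k) := by abel
    have e3 : (a (k + 1) - a k) - (b (k + 1) - b k)
      = (a (k + 1) - b (k + 1)) - (a k - b k) := by abel
    rw [e3] at eucl
    rw [e1, e2]
    have hh := H.height_sq_add_sub_le (x := x k) (z := z k) hρ0 hs (has k hk1) (hbs k hk1)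
      (hv k hk0) (hv _ hk2) (hc k hk0) (hc _ hk2) rfl rfl (ha k hk0) (ha _ hk2) (hb k hk0)
      (hb _ hk2) (hav k hk0) (hav _ hk2) (hbv k hk0) (hbv _ hk2)
    rw [← hμ] at hh
    linarith
  have hsum := Finset.sum_le_sum hterm
  simp only [Finset.sum_add_distrib] at hsum
  simp only [← Finset.mul_sum, Finset.sum_const, Finset.card_range, nsmul_eq_mul] at hsum
  have hN0 : (0 : ℝ) ≤ N := Nat.cast_nonneg N
  have hsum' := mul_le_mul_of_nonneg_left hsum hN0
  have s1 : ∑ k ∈ Finset.range N, x k ≤ V := sum_le_of_card_mul_sum_sq_le hV0 hvE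
  have s2 : ∑ k ∈ Finset.range N, z k ≤ C := sum_le_of_card_mul_sum_sq_le hC0 hcE
  have s3 : N * ∑ k ∈ Finset.range N, x k * z k ≤ V * C := card_mul_sum_mul_le hV0 hC0 hvE hcE
  set t := N * s with ht
  have ht0 : 0 ≤ t := by positivity
  have hMt : M * t ≤ μ := by rw [hμ]; gcongr
  have hMt2 : M * t ^ 2 ≤ μ := by
    calc M * t ^ 2 = (M * t) * t := by ring
      _ ≤ μ * 1 := by gcongr; exact hNs.trans hρ
      _ = μ := mul_one _
  have r1 : N * (4 * μ ^ 2 * ∑ k ∈ Finset.range N, x k ^ 2) ≤ 4 * μ ^ 2 * V ^ 2 := by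
    calc _ = 4 * μ ^ 2 * (N * ∑ k ∈ Finset.range N, x k ^ 2) := by ring
      _ ≤ _ := by gcongr
  have r2 : N * ((2 * μ * s * M * (C + 2 * V) + 2 * M * C * s * μ) * ∑ k ∈ Finset.range N, x k)
      ≤ 4 * μ ^ 2 * (C + V) * V := by
    calc _ = (M * t) * (4 * μ * (C + V)) * ∑ k ∈ Finset.range N, x k := by rw [ht]; ring
      _ ≤ μ * (4 * μ * (C + V)) * V := by gcongr
      _ = _ := by ring
  have r3 : N * ((4 * μ * s * M * V) * ∑ k ∈ Finset.range N, z k) ≤ 4 * μ ^ 2 * V * C := by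
    calc _ = (M * t) * (4 * μ * V) * ∑ k ∈ Finset.range N, z k := by rw [ht]; ring
      _ ≤ μ * (4 * μ * V) * C := by gcongr
      _ = _ := by ring
  have r4 : N * (2 * μ ^ 2 * ∑ k ∈ Finset.range N, x k * z k) ≤ 2 * μ ^ 2 * (V * C) := by
    calc _ = 2 * μ ^ 2 * (N * ∑ k ∈ Finset.range N, x k * z k) := by ring
      _ ≤ _ := by gcongr
  have r5 : N * (N * (4 * M ^ 2 * V ^ 2 * s ^ 2 + 2 * μ * s ^ 2 * M * V * (C + V)
          + 2 * M ^ 2 * C * V * s ^ 2)) ≤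
      4 * μ ^ 2 * V ^ 2 + 2 * μ ^ 2 * V * (C + V) + 2 * μ ^ 2 * C * V := by
    calc _ = (M * t) ^ 2 * (4 * V ^ 2) + (M * t ^ 2) * (2 * μ * V * (C + V))
          + (M * t) ^ 2 * (2 * C * V) := by rw [ht]; ring
      _ ≤ μ ^ 2 * (4 * V ^ 2) + μ * (2 * μ * V * (C + V)) + μ ^ 2 * (2 * C * V) := by gcongr
      _ = _ := by ring
  unfold chainEnergy
  simp only [Finset.sum_add_distrib]
  simp only [← Finset.mul_sum] at hsum' ⊢
  linarith

end Chains

/-! ### The four-point inequality for almost minimal chains -/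

section Chains

variable {E : Type*} [NormedAddCommGroup E] [InnerProductSpace ℝ E]

/-- Two almost minimal chains are close, in the energy norm, to each other up to the difference of
their endpoints: the chain energy is uniformly convex on short chains. The hypothesis on `D` says
that `D p q` bounds the energy of all chains from `p` to `q` from below. -/
theorem HasBoundedDifferences.near_minimal_chains {h : E → ℝ} {M : ℝ}
    (H : HasBoundedDifferences h M) {ρ s η : ℝ} (hρ0 : 0 ≤ ρ) (hρ : ρ ≤ 1)
    (hμ : M * ρ ≤ 1 / 100) (hη : 0 ≤ η) {N : ℕ} (hN : 0 < N) {a b : ℕ → E} (hs : 0 ≤ s)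
    (hNs : N * s ≤ ρ / 4)
    (has : ∀ k < N, ‖a (k + 1) - a k‖ ≤ s) (hbs : ∀ k < N, ‖b (k + 1) - b k‖ ≤ s)
    (ha : ∀ k ≤ N, ‖a k‖ ≤ ρ / 4) (hb : ∀ k ≤ N, ‖b k‖ ≤ ρ / 4) {D : E → E → ℝ}
    (hD : ∀ e : ℕ → E, (∀ k ≤ N, ‖e k‖ ≤ ρ) → (∀ k < N, ‖e (k + 1) - e k‖ ≤ ρ / N) →
      D (e 0) (e N) ≤ chainEnergy h N e)
    (hab : chainEnergy h N a + chainEnergy h N b ≤ D (a 0) (a N) + D (b 0) (b N) + η) {C : ℝ}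
    (hC : C = 2 * (‖a 0 - b 0‖ + ‖a N - b N‖) + 2 * √η) :
    (∀ k ≤ N, ‖a k - b k‖ ≤ C) ∧
      N * ∑ k ∈ Finset.range N, ‖(a (k + 1) - b (k + 1)) - (a k - b k)‖ ^ 2 ≤ C ^ 2 := by
  have hM := H.nonneg
  have hNR : (0 : ℝ) < N := Nat.cast_pos.2 hN
  set c0 := a 0 - b 0 with hc0
  set cN := a N - b N with hcN
  set m := ‖c0‖ + ‖cN‖ with hm
  have hm0 : 0 ≤ m := by positivity
  set d := (N : ℝ)⁻¹ • (cN - c0) with hd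
  have hNd : (N : ℝ) • d = cN - c0 := by
    rw [hd, smul_smul, mul_inv_cancel₀ hNR.ne', one_smul]
  clear_value d
  -- the difference of the chains minus its linear interpolation
  set g : ℕ → E := fun k => (a k - b k) - (c0 + (k : ℝ) • d) with hg
  have hg0 : g 0 = 0 := by simp [hg, hc0]
  have hgN : g N = 0 := by simp only [hg]; rw [hNd, hcN]; abel
  have hΔg : ∀ k, g (k + 1) - g k = ((a (k + 1) - b (k + 1)) - (a k - b k)) - d := by
    intro k
    simp only [hg, Nat.cast_add, Nat.cast_one, add_smul, one_smul]
    abel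
  have hsumg : ∑ k ∈ Finset.range N, (g (k + 1) - g k) = 0 := by
    rw [Finset.sum_range_sub, hgN, hg0, sub_zero]
  set T := √(N * ∑ k ∈ Finset.range N, ‖g (k + 1) - g k‖ ^ 2) with hT
  have hT0 : 0 ≤ T := Real.sqrt_nonneg _
  have hT2 : N * ∑ k ∈ Finset.range N, ‖g (k + 1) - g k‖ ^ 2 = T ^ 2 := by
    rw [hT, Real.sq_sqrt]; positivity
  have hgT : ∀ k ≤ N, ‖g k‖ ≤ T := by
    intro k hk
    have e : g k = ∑ j ∈ Finset.range k, (g (j + 1) - g j) := by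
      rw [Finset.sum_range_sub, hg0, sub_zero]
    rw [e]
    refine (norm_sum_le _ _).trans ?_
    refine (Finset.sum_le_sum_of_subset_of_nonneg (Finset.range_mono hk)
      (fun _ _ _ => norm_nonneg _)).trans ?_
    exact sum_le_of_card_mul_sum_sq_le hT0 hT2.le
  have hint : ∀ k ≤ N, ‖c0 + (k : ℝ) • d‖ ≤ max ‖c0‖ ‖cN‖ := by
    intro k hk
    have := norm_add_smul_sub_le (p := c0) (q := cN) (R := max ‖c0‖ ‖cN‖) (t := k / N)
      (le_max_left _ _) (le_max_right _ _) ⟨by positivity, by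
        rw [div_le_one hNR]; exact_mod_cast hk⟩
    rwa [div_eq_mul_inv, mul_smul, ← hd] at this
  have hmaxm : max ‖c0‖ ‖cN‖ ≤ m := by
    refine max_le ?_ ?_ <;> rw [hm] <;> linarith [norm_nonneg c0, norm_nonneg cN]
  have hck : ∀ k ≤ N, ‖a k - b k‖ ≤ T + m := by
    intro k hk
    have e : a k - b k = g k + (c0 + (k : ℝ) • d) := by simp only [hg]; abel
    rw [e]
    exact (norm_add_le _ _).trans (add_le_add (hgT k hk) ((hint k hk).trans hmaxm))
  have hdm : ‖cN - c0‖ ≤ m := (norm_sub_le _ _).trans (by rw [hm, add_comm])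
  have hcE : N * ∑ k ∈ Finset.range N, ‖(a (k + 1) - b (k + 1)) - (a k - b k)‖ ^ 2
      ≤ (T + m) ^ 2 := by
    have e : ∀ k, ‖(a (k + 1) - b (k + 1)) - (a k - b k)‖ ^ 2
        = ‖g (k + 1) - g k‖ ^ 2 + 2 * inner ℝ (g (k + 1) - g k) d + ‖d‖ ^ 2 := by
      intro k
      rw [← norm_add_sq_real, hΔg]
      congr 2; abel
    simp only [e, Finset.sum_add_distrib, ← Finset.mul_sum, ← sum_inner]
    rw [hsumg, inner_zero_left, Finset.sum_const, Finset.card_range, nsmul_eq_mul, mul_add,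
      mul_add, hT2]
    have e2 : (N : ℝ) * (N * ‖d‖ ^ 2) = ‖cN - c0‖ ^ 2 := by
      rw [← hNd, norm_smul, Real.norm_of_nonneg hNR.le]; ring
    rw [e2]
    have : ‖cN - c0‖ ^ 2 ≤ m ^ 2 := by gcongr
    nlinarith [mul_nonneg hT0 hm0]
  -- displace the chains towards each other
  set v : ℕ → E := fun k => -((1 / 2 : ℝ) • g k) with hv
  have hΔv : ∀ k, v (k + 1) - v k = -((1 / 2 : ℝ) • (g (k + 1) - g k)) := by
    intro k; simp only [hv]; module
  have hΔvn : ∀ k, ‖v (k + 1) - v k‖ = 1 / 2 * ‖g (k + 1) - g k‖ := by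
    intro k
    rw [hΔv, norm_neg, norm_smul, Real.norm_of_nonneg (by norm_num)]
  have hvn : ∀ k, ‖v k‖ = 1 / 2 * ‖g k‖ := by
    intro k
    simp only [hv]
    rw [norm_neg, norm_smul, Real.norm_of_nonneg (by norm_num)]
  have hc0n : ‖c0‖ ≤ ρ / 2 := (norm_sub_le _ _).trans (by linarith [ha 0 hN.le, hb 0 hN.le])
  have hcNn : ‖cN‖ ≤ ρ / 2 := (norm_sub_le _ _).trans (by linarith [ha N le_rfl, hb N le_rfl])
  have hvρ : ∀ k ≤ N, ‖v k‖ ≤ ρ / 2 := by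
    intro k hk
    rw [hvn]
    have h1 : ‖g k‖ ≤ ‖a k - b k‖ + ‖c0 + (k : ℝ) • d‖ := norm_sub_le _ _
    have h2 : ‖a k - b k‖ ≤ ‖a k‖ + ‖b k‖ := norm_sub_le _ _
    have h3 := (hint k hk).trans (max_le hc0n hcNn)
    linarith [ha k hk, hb k hk]
  have hNdn : ‖d‖ ≤ ρ / N := by
    rw [le_div_iff₀ hNR, mul_comm]
    calc (N : ℝ) * ‖d‖ = ‖cN - c0‖ := by
          rw [← hNd, norm_smul, Real.norm_of_nonneg hNR.le]
      _ ≤ ρ := (norm_sub_le _ _).trans (by linarith)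
  have hsN : s ≤ (ρ / 4) / N := by rw [le_div_iff₀ hNR, mul_comm]; exact hNs
  have hΔvρ : ∀ k < N, ‖v (k + 1) - v k‖ ≤ 3 / 4 * (ρ / N) := by
    intro k hk
    rw [hΔvn, hΔg]
    have h1 := norm_sub_le ((a (k + 1) - b (k + 1)) - (a k - b k)) d
    have h2 : ‖(a (k + 1) - b (k + 1)) - (a k - b k)‖ ≤ s + s := by
      have : (a (k + 1) - b (k + 1)) - (a k - b k) = (a (k + 1) - a k) - (b (k + 1) - b k) := by
        abel
      rw [this]
      exact (norm_sub_le _ _).trans (add_le_add (has k hk) (hbs k hk))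
    have : ρ / 4 / N = 1 / 4 * (ρ / N) := by ring
    linarith
  have hsN' : s ≤ 1 / 4 * (ρ / N) := hsN.trans_eq (by ring)
  have pav : ∀ k ≤ N, ‖a k + v k‖ ≤ ρ := fun k hk =>
    (norm_add_le _ _).trans (by linarith [ha k hk, hvρ k hk])
  have pbv : ∀ k ≤ N, ‖b k - v k‖ ≤ ρ := fun k hk =>
    (norm_sub_le _ _).trans (by linarith [hb k hk, hvρ k hk])
  have da := hD (fun k => a k + v k) pav (fun k hk => by
    have : a (k + 1) + v (k + 1) - (a k + v k) = (a (k + 1) - a k) + (v (k + 1) - v k) := by abel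
    rw [this]
    exact (norm_add_le _ _).trans (by linarith [has k hk, hΔvρ k hk]))
  have db := hD (fun k => b k - v k) pbv (fun k hk => by
    have : b (k + 1) - v (k + 1) - (b k - v k) = (b (k + 1) - b k) - (v (k + 1) - v k) := by abel
    rw [this]
    exact (norm_sub_le _ _).trans (by linarith [hbs k hk, hΔvρ k hk]))
  have hv0 : v 0 = 0 := by simp [hv, hg0]
  have hvN : v N = 0 := by simp [hv, hgN]
  simp only [hv0, hvN, add_zero, sub_zero] at da db
  have main := H.chainEnergy_add_sub_le (s := s) (V := T) (C := T + m) (N := N) (v := v) hρ0 hρ hs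
    (hNs.trans (by linarith)) has hbs hT0 (by positivity)
    (fun k hk => by rw [hvn]; linarith [hgT k hk, norm_nonneg (g k)]) hck
    (by
      simp only [hΔvn, mul_pow, ← Finset.mul_sum]
      linarith [sq_nonneg T]) hcE
    (fun k hk => (ha k hk).trans (by linarith)) (fun k hk => (hb k hk).trans (by linarith)) pav pbv
  have hquad : N * ∑ k ∈ Finset.range N,
      (2 * inner ℝ ((a (k + 1) - b (k + 1)) - (a k - b k)) (v (k + 1) - v k)
            + 2 * ‖v (k + 1) - v k‖ ^ 2) = - (1 / 2) * T ^ 2 := by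
    have e : ∀ k, 2 * inner ℝ ((a (k + 1) - b (k + 1)) - (a k - b k)) (v (k + 1) - v k)
            + 2 * ‖v (k + 1) - v k‖ ^ 2
            = -(1 / 2) * ‖g (k + 1) - g k‖ ^ 2 - inner ℝ (g (k + 1) - g k) d := by
      intro k
      have e1 : (a (k + 1) - b (k + 1)) - (a k - b k) = (g (k + 1) - g k) + d := by
        rw [hΔg]; abel
      rw [hΔvn, hΔv, e1, inner_neg_right, inner_smul_right, inner_add_left,
        real_inner_self_eq_norm_sq, real_inner_comm d]
      ring
    have e2 : ∑ k ∈ Finset.range N, inner ℝ (g (k + 1) - g k) d = 0 := by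
      rw [← sum_inner, hsumg, inner_zero_left]
    rw [Finset.sum_congr rfl fun k _ => e k, Finset.sum_sub_distrib, e2, ← Finset.mul_sum,
      sub_zero, ← hT2]
    ring
  rw [hquad] at main
  set μ := M * ρ with hμdef
  have hμ0 : 0 ≤ μ := by positivity
  have hμ2 : μ ^ 2 ≤ 1 / 10000 := (pow_le_pow_left₀ hμ0 hμ 2).trans_eq (by norm_num)
  have hTm : T * m ≤ (T ^ 2 + m ^ 2) / 2 := by linarith [sq_nonneg (T - m)]
  have hprod : 14 * μ ^ 2 * (T * (T + m + T)) ≤ 14 * (1 / 10000) * (T * (T + m + T)) := by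
    gcongr
  have hTbound : T ^ 2 ≤ (m + 2 * √η) ^ 2 := by
    have hsq : √η ^ 2 = η := Real.sq_sqrt hη
    have h1 : 0 ≤ m * √η := by positivity
    have h2 : (m + 2 * √η) ^ 2 = m ^ 2 + 4 * (m * √η) + 4 * η := by
      rw [← hsq, Real.sqrt_sq (Real.sqrt_nonneg η)]; ring
    have h3 : 0 ≤ m ^ 2 := sq_nonneg m
    have h4 : 0 ≤ T ^ 2 := sq_nonneg T
    rw [h2]
    linarith
  have hTle : T ≤ m + 2 * √η := abs_le_of_sq_le_sq' hTbound (by positivity) |>.2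
  have hTC : T + m ≤ C := by rw [hC]; linarith
  refine ⟨fun k hk => (hck k hk).trans hTC, hcE.trans ?_⟩
  gcongr

/-- The four-point inequality for almost minimal chains `a` from `y` to `x'` and `b` from `y'` to
`x`. For squared Euclidean distances `D` it is an equality without the error terms. -/
theorem HasBoundedDifferences.four_point {h : E → ℝ} {M : ℝ}
    (H : HasBoundedDifferences h M) {ρ s η : ℝ} (hρ0 : 0 ≤ ρ) (hρ : ρ ≤ 1)
    (hμ : M * ρ ≤ 1 / 100) (hη : 0 ≤ η) {N : ℕ} (hN : 0 < N) {a b : ℕ → E} (hs : 0 ≤ s)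
    (hNs : N * s ≤ ρ / 4)
    (has : ∀ k < N, ‖a (k + 1) - a k‖ ≤ s) (hbs : ∀ k < N, ‖b (k + 1) - b k‖ ≤ s)
    (ha : ∀ k ≤ N, ‖a k‖ ≤ ρ / 4) (hb : ∀ k ≤ N, ‖b k‖ ≤ ρ / 4) {D : E → E → ℝ}
    (hD : ∀ e : ℕ → E, (∀ k ≤ N, ‖e k‖ ≤ ρ) → (∀ k < N, ‖e (k + 1) - e k‖ ≤ ρ / N) →
      D (e 0) (e N) ≤ chainEnergy h N e)
    {x x' y y' : E} (ha0 : a 0 = y) (haN : a N = x') (hb0 : b 0 = y') (hbN : b N = x)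
    (hab : chainEnergy h N a + chainEnergy h N b ≤ D y x' + D y' x + η) :
    D y' x' + D y x ≤ D y x' + D y' x + η + 2 * inner ℝ (y' - y) (x - x')
      + (1 / 700) * (‖y' - y‖ * (3 * ‖y' - y‖ + 2 * ‖x - x'‖ + 2 * √η)) := by
  have hM := H.nonneg
  have hNR : (0 : ℝ) < N := Nat.cast_pos.2 hN
  set C := 2 * (‖a 0 - b 0‖ + ‖a N - b N‖) + 2 * √η with hC
  obtain ⟨hck, hcE⟩ := H.near_minimal_chains hρ0 hρ hμ hη hN hs hNs has hbs ha hb hD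
    (by rw [ha0, haN, hb0, hbN]; exact hab) hC
  have hC0 : 0 ≤ C := by positivity
  set u := y' - y with hu
  set w := x - x' with hw
  have hab0 : ‖a 0 - b 0‖ = ‖u‖ := by rw [ha0, hb0, hu, norm_sub_rev]
  have habN : ‖a N - b N‖ = ‖w‖ := by rw [haN, hbN, hw, norm_sub_rev]
  -- the displacement moves the starting point of `a` to that of `b` and fixes the end points
  set v : ℕ → E := fun k => (1 - (k : ℝ) / N) • u with hv
  have hΔv : ∀ k, v (k + 1) - v k = -((N : ℝ)⁻¹ • u) := by
    intro k
    simp only [hv]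
    rw [← sub_smul, ← neg_smul]
    congr 1
    push_cast
    field_simp
    ring
  have hΔvn : ∀ k, ‖v (k + 1) - v k‖ = (N : ℝ)⁻¹ * ‖u‖ := by
    intro k
    rw [hΔv, norm_neg, norm_smul, Real.norm_of_nonneg (by positivity)]
  have hvn : ∀ k ≤ N, ‖v k‖ ≤ ‖u‖ := by
    intro k hk
    have hkN : (k : ℝ) / N ≤ 1 := by rw [div_le_one hNR]; exact_mod_cast hk
    have hk0 : 0 ≤ (k : ℝ) / N := by positivity
    simp only [hv]
    rw [norm_smul, Real.norm_of_nonneg (by linarith)]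
    nlinarith [norm_nonneg u]
  have huρ : ‖u‖ ≤ ρ / 2 := by
    rw [← hab0]
    exact (norm_sub_le _ _).trans (by linarith [ha 0 hN.le, hb 0 hN.le])
  have pav : ∀ k ≤ N, ‖a k + v k‖ ≤ ρ := fun k hk =>
    (norm_add_le _ _).trans (by linarith [ha k hk, hvn k hk])
  have pbv : ∀ k ≤ N, ‖b k - v k‖ ≤ ρ := fun k hk =>
    (norm_sub_le _ _).trans (by linarith [hb k hk, hvn k hk])
  have hsN : s ≤ (ρ / 4) / N := by rw [le_div_iff₀ hNR, mul_comm]; exact hNs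
  have hsN' : s ≤ 1 / 4 * (ρ / N) := hsN.trans_eq (by ring)
  have hΔvρ : ∀ k, ‖v (k + 1) - v k‖ ≤ 1 / 2 * (ρ / N) := by
    intro k
    rw [hΔvn]
    calc (N : ℝ)⁻¹ * ‖u‖ ≤ (N : ℝ)⁻¹ * (ρ / 2) := by gcongr
      _ = _ := by ring
  have hρN : 0 ≤ ρ / N := by positivity
  have da := hD (fun k => a k + v k) pav (fun k hk => by
    have : a (k + 1) + v (k + 1) - (a k + v k) = (a (k + 1) - a k) + (v (k + 1) - v k) := by abel
    rw [this]
    exact (norm_add_le _ _).trans (by linarith [has k hk, hΔvρ k]))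
  have db := hD (fun k => b k - v k) pbv (fun k hk => by
    have : b (k + 1) - v (k + 1) - (b k - v k) = (b (k + 1) - b k) - (v (k + 1) - v k) := by abel
    rw [this]
    exact (norm_sub_le _ _).trans (by linarith [hbs k hk, hΔvρ k]))
  have hv0 : v 0 = u := by simp [hv]
  have hvN : v N = 0 := by simp [hv, hNR.ne']
  have e1 : y + u = y' := by rw [hu]; abel
  have e2 : y' - u = y := by rw [hu]; abel
  simp only [hv0, hvN, add_zero, sub_zero, ha0, haN, hb0, hbN, e1, e2] at da db
  have hNN : (N : ℝ) * ∑ k ∈ Finset.range N, ‖v (k + 1) - v k‖ ^ 2 = ‖u‖ ^ 2 := by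
    simp only [hΔvn, Finset.sum_const, Finset.card_range, nsmul_eq_mul]
    field_simp
  have main := H.chainEnergy_add_sub_le (s := s) (V := ‖u‖) (C := C) (N := N) (v := v) hρ0 hρ hs
    (hNs.trans (by linarith)) has hbs (norm_nonneg _) hC0 hvn hck hNN.le hcE
    (fun k hk => (ha k hk).trans (by linarith)) (fun k hk => (hb k hk).trans (by linarith)) pav pbv
  have hquad : N * ∑ k ∈ Finset.range N,
      (2 * inner ℝ ((a (k + 1) - b (k + 1)) - (a k - b k)) (v (k + 1) - v k)
            + 2 * ‖v (k + 1) - v k‖ ^ 2) = 2 * inner ℝ u w := by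
    rw [Finset.sum_add_distrib, mul_add, ← Finset.mul_sum, ← Finset.mul_sum]
    have e : ∑ k ∈ Finset.range N, inner ℝ ((a (k + 1) - b (k + 1)) - (a k - b k))
        (v (k + 1) - v k) = -((N : ℝ)⁻¹ * inner ℝ (u - w) u) := by
      simp only [hΔv, inner_neg_right, inner_smul_right, Finset.sum_neg_distrib,
        ← Finset.mul_sum, ← sum_inner]
      rw [Finset.sum_range_sub (fun k => a k - b k), ha0, haN, hb0, hbN]
      have : x' - x - (y - y') = u - w := by rw [hu, hw]; abel
      rw [this]
    rw [e]
    have : (N : ℝ) * (2 * ∑ k ∈ Finset.range N, ‖v (k + 1) - v k‖ ^ 2) = 2 * ‖u‖ ^ 2 := by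
      rw [← hNN]; ring
    rw [this, inner_sub_left, real_inner_self_eq_norm_sq, real_inner_comm u w]
    field_simp
    ring
  rw [hquad] at main
  have hμ0 : 0 ≤ M * ρ := by positivity
  have hμ2 : 14 * (M * ρ) ^ 2 ≤ 1 / 700 := by
    have := pow_le_pow_left₀ hμ0 hμ 2
    linarith
  have hfin : 14 * (M * ρ) ^ 2 * (‖u‖ * (C + ‖u‖)) ≤
      1 / 700 * (‖u‖ * (3 * ‖u‖ + 2 * ‖w‖ + 2 * √η)) := by
    have : C + ‖u‖ = 3 * ‖u‖ + 2 * ‖w‖ + 2 * √η := by rw [hC, hab0, habN]; ring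
    rw [this]
    gcongr
  linarith

end Chains

/-! ### The intrinsic distance -/

section IntrinsicDist

open Set unitInterval

theorem intrinsicDist_triangle (S : Set E3) (a b c : S) :
    intrinsicDist S a c ≤ intrinsicDist S a b + intrinsicDist S b c := by
  refine ENNReal.le_iInf_add_iInf fun γ γ' => (iInf_le _ (γ.trans γ')).trans ?_
  let m : I := ⟨1 / 2, by norm_num, by norm_num⟩
  have hsplit := eVariationOn.Icc_add_Icc (γ.trans γ') (s := univ) (a := 0) (b := m) (c := 1)
    m.2.1 m.2.2 (mem_univ _)
  have h01 : univ ∩ Icc (0 : I) 1 = univ := by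
    ext t; simp [unitInterval.le_one']
  rw [h01] at hsplit
  rw [← hsplit]
  refine add_le_add ?_ ?_
  · have : EqOn (γ.trans γ') (γ ∘ fun t : I => projIcc (0 : ℝ) 1 zero_le_one (2 * (t : ℝ)))
        (univ ∩ Icc 0 m) := by
      rintro t ⟨-, -, ht⟩
      have ht' : (t : ℝ) ≤ 1 / 2 := ht
      rw [Path.trans_apply, dif_pos ht', Function.comp_apply, projIcc_of_mem]
    rw [eVariationOn.congr this]
    refine eVariationOn.comp_le_of_monotoneOn _ _ ?_ (fun _ _ => mem_univ _)
    intro s _ t _ hst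
    refine monotone_projIcc _ ?_
    have : (s : ℝ) ≤ t := hst
    linarith
  · have : EqOn (γ.trans γ') (γ' ∘ fun t : I => projIcc (0 : ℝ) 1 zero_le_one (2 * (t : ℝ) - 1))
        (univ ∩ Icc m 1) := by
      rintro t ⟨-, ht, -⟩
      have ht' : 1 / 2 ≤ (t : ℝ) := ht
      rw [Path.trans_apply]
      split_ifs with h
      · have e : (t : ℝ) = 1 / 2 := le_antisymm h ht'
        have e1 : (⟨2 * (t : ℝ), (unitInterval.mul_pos_mem_iff zero_lt_two).2 ⟨t.2.1, h⟩⟩ : I) = 1 :=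
          Subtype.ext (by simp [e])
        rw [e1, Path.target, Function.comp_apply, projIcc_of_le_left _ (by rw [e]; norm_num)]
        exact γ'.source.symm
      · rw [Function.comp_apply, projIcc_of_mem]
    rw [eVariationOn.congr this]
    refine eVariationOn.comp_le_of_monotoneOn _ _ ?_ (fun _ _ => mem_univ _)
    intro s _ t _ hst
    refine monotone_projIcc _ ?_
    have : (s : ℝ) ≤ t := hst
    linarith

theorem edist_le_intrinsicDist (S : Set E3) (y z : S) : edist y z ≤ intrinsicDist S y z := by
  refine le_iInf fun γ => ?_
  have := eVariationOn.edist_le γ (mem_univ (0 : I)) (mem_univ (1 : I))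
  rwa [γ.source, γ.target] at this

theorem eVariationOn_le_of_lipschitzWith {X : Type*} [PseudoEMetricSpace X] {γ : I → X}
    {C : NNReal} (hγ : LipschitzWith C γ) : eVariationOn γ univ ≤ C := by
  have h1 := (hγ.lipschitzOnWith (s := univ)).comp_eVariationOn_le (g := id) (s := univ)
    (fun _ _ => mem_univ _)
  have h2 : eVariationOn (id : I → I) univ ≤ 1 := by
    change eVariationOn (Subtype.val : I → ℝ) univ ≤ 1
    have := MonotoneOn.eVariationOn_eq (f := (Subtype.val : I → ℝ)) (s := univ) (a := 0) (b := 1)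
      (fun _ _ _ _ h => h) (mem_univ _) (mem_univ _)
    have h01 : univ ∩ Icc (0 : I) 1 = univ := by
      ext t; simp [unitInterval.le_one']
    rw [h01] at this
    simpa using this.le
  calc eVariationOn γ univ ≤ C * eVariationOn (id : I → I) univ := h1
    _ ≤ C * 1 := by gcongr
    _ = C := mul_one _

/-- A path of length at most `N * s` is subdivided into `N` steps with chords at most `s`. -/
theorem exists_chain_of_eVariationOn_le {X : Type*} [MetricSpace X] {γ : I → X}
    (hγ : Continuous γ) {s : ℝ} (hs : 0 ≤ s) (N : ℕ) : ∀ a : I,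
    eVariationOn γ (Icc a 1) ≤ ENNReal.ofReal (N * s) →
    ∃ p : ℕ → X, p 0 = γ a ∧ p N = γ 1 ∧ ∀ k < N, dist (p (k + 1)) (p k) ≤ s := by
  induction N with
  | zero =>
    intro a ha
    have h0 : edist (γ a) (γ 1) ≤ 0 := by
      refine (eVariationOn.edist_le γ (s := Icc a 1) ⟨le_rfl, a.2.2⟩ ⟨a.2.2, le_rfl⟩).trans ?_
      simpa using ha
    exact ⟨fun _ => γ a, rfl, edist_le_zero.1 h0, fun k hk => absurd hk (Nat.not_lt_zero k)⟩
  | succ N ih =>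
    intro a ha
    have cons : ∀ b : I, dist (γ b) (γ a) ≤ s →
        eVariationOn γ (Icc b 1) ≤ ENNReal.ofReal (N * s) →
        ∃ p : ℕ → X, p 0 = γ a ∧ p (N + 1) = γ 1 ∧
          ∀ k < N + 1, dist (p (k + 1)) (p k) ≤ s := by
      intro b hb hvar
      obtain ⟨p, hp0, hpN, hp⟩ := ih b hvar
      refine ⟨fun k => Nat.casesOn k (γ a) p, rfl, hpN, fun k hk => ?_⟩
      cases k with
      | zero => simpa [hp0] using hb
      | succ k => exact hp k (by omega)
    by_cases hfar : ∃ t ∈ Icc a 1, s ≤ dist (γ t) (γ a)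
    · obtain ⟨t, ht, hst⟩ := hfar
      have hcont : ContinuousOn (fun t => dist (γ t) (γ a)) (Icc a t) := by fun_prop
      obtain ⟨b, hb, hbs⟩ := intermediate_value_Icc ht.1 hcont
        (show s ∈ Icc _ _ from ⟨by simpa using hs, hst⟩)
      have hb1 : b ≤ 1 := hb.2.trans ht.2
      refine cons b hbs.le ?_
      have hsplit := eVariationOn.Icc_add_Icc γ (s := univ) hb.1 hb1 (mem_univ _)
      simp only [univ_inter] at hsplit
      have h1 : ENNReal.ofReal s ≤ eVariationOn γ (Icc a b) := by
        have := eVariationOn.edist_le γ (s := Icc a b) ⟨hb.1, le_rfl⟩ ⟨le_rfl, hb.1⟩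
        rwa [edist_dist, show dist (γ b) (γ a) = s from hbs] at this
      have h2 : ENNReal.ofReal s + eVariationOn γ (Icc b 1)
          ≤ ENNReal.ofReal s + ENNReal.ofReal (N * s) := by
        rw [← ENNReal.ofReal_add hs (by positivity)]
        calc _ ≤ eVariationOn γ (Icc a b) + eVariationOn γ (Icc b 1) := by gcongr
          _ ≤ _ := by
            rw [hsplit]
            refine ha.trans (ENNReal.ofReal_le_ofReal ?_)
            push_cast
            linarith
      exact (ENNReal.add_le_add_iff_left ENNReal.ofReal_ne_top).1 h2
    · push Not at hfar
      refine cons 1 (hfar 1 ⟨a.2.2, le_rfl⟩).le ?_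
      rw [Icc_self, eVariationOn.subsingleton γ subsingleton_singleton]
      exact zero_le

theorem exists_chain_of_intrinsicDist_lt {S : Set E3} {y z : S} {ℓ : ℝ}
    (hℓ : 0 ≤ ℓ) (h : intrinsicDist S y z < ENNReal.ofReal ℓ) {N : ℕ} (hN : 0 < N) :
    ∃ p : ℕ → S, p 0 = y ∧ p N = z ∧ ∀ k < N, dist (p (k + 1)) (p k) ≤ ℓ / N := by
  obtain ⟨γ, hγ⟩ := iInf_lt_iff.1 h
  have hNR : (0 : ℝ) < N := Nat.cast_pos.2 hN
  have := exists_chain_of_eVariationOn_le γ.continuous (s := ℓ / N) (by positivity) N 0 (by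
    rw [mul_div_cancel₀ _ hNR.ne']
    exact (eVariationOn.mono _ (subset_univ _)).trans hγ.le)
  simpa using this

theorem intrinsicDist_le_sum {S : Set E3} (p : ℕ → S) {N : ℕ} (hN : 0 < N) :
    intrinsicDist S (p 0) (p N) ≤ ∑ k ∈ Finset.range N, intrinsicDist S (p k) (p (k + 1)) := by
  induction N, hN using Nat.le_induction with
  | base => simp
  | succ N _ ih =>
    rw [Finset.sum_range_succ]
    exact (intrinsicDist_triangle S _ (p N) _).trans (by gcongr)

end IntrinsicDist

namespace MongeChart

variable {S : Set E3} {x₀ : E3} (c : MongeChart S x₀)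

theorem hasBoundedDifferences : HasBoundedDifferences c.h c.M where
  nonneg := c.M_nonneg
  differentiable := c.contDiff_h.differentiable (by norm_num)
  sub_le := c.fderiv_sub_le
  second_le := c.fderiv_second_difference_le
  fderiv_zero := c.fderiv_h_zero

/-- The graph parametrisation of the surface. -/
noncomputable def G (p : Plane) : E3 := x₀ + c.L p + c.h p • c.ν

/-- The orthogonal projection to the tangent plane at `x₀`, in coordinates centred at `x₀`. -/
noncomputable def proj (y : E3) : Plane := c.L.toContinuousLinearMap.adjoint (y - x₀)

theorem proj_G (p : Plane) : c.proj (c.G p) = p := by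
  have : c.G p - x₀ = c.L p + c.h p • c.ν := by rw [G]; abel
  rw [proj, this, map_add, map_smul, adjoint_linearIsometry_self,
    adjoint_linearIsometry_normal c.inner_ν, smul_zero, add_zero]

theorem G_proj {y : E3} (hy : y ∈ S) (hr : ‖y - x₀‖ < c.r) : c.G (c.proj y) = y := by
  have h1 := (c.mem_iff y hr).1 hy
  have h2 := linearIsometry_decomposition c.norm_ν c.inner_ν (y - x₀)
  rw [G, proj, ← h1, add_assoc, h2]
  abel

theorem norm_adjoint_le (z : E3) : ‖c.L.toContinuousLinearMap.adjoint z‖ ≤ ‖z‖ := by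
  refine (ContinuousLinearMap.le_opNorm _ _).trans ?_
  rw [LinearIsometryEquiv.norm_map]
  exact mul_le_of_le_one_left (norm_nonneg _) c.L.norm_toContinuousLinearMap_le

theorem norm_proj_le (y : E3) : ‖c.proj y‖ ≤ ‖y - x₀‖ := c.norm_adjoint_le _

theorem norm_proj_sub_le (y z : E3) : ‖c.proj y - c.proj z‖ ≤ ‖y - z‖ := by
  rw [proj, proj, ← map_sub]
  simpa using c.norm_adjoint_le (y - z)

theorem norm_add_smul_normal_sq (p : Plane) (t : ℝ) :
    ‖c.L p + t • c.ν‖ ^ 2 = ‖p‖ ^ 2 + t ^ 2 := by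
  rw [norm_add_sq_real, inner_smul_right, real_inner_comm, c.inner_ν, c.L.norm_map, norm_smul,
    c.norm_ν]
  simp

theorem norm_G_sub_sq (p q : Plane) :
    ‖c.G p - c.G q‖ ^ 2 = ‖p - q‖ ^ 2 + (c.h p - c.h q) ^ 2 := by
  have : c.G p - c.G q = c.L (p - q) + (c.h p - c.h q) • c.ν := by
    rw [G, G, map_sub, sub_smul]; abel
  rw [this, c.norm_add_smul_normal_sq]

theorem norm_G_sub_base_sq (p : Plane) : ‖c.G p - x₀‖ ^ 2 = ‖p‖ ^ 2 + c.h p ^ 2 := by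
  have : c.G p - x₀ = c.L p + c.h p • c.ν := by rw [G]; abel
  rw [this, c.norm_add_smul_normal_sq]

theorem abs_h_le (p : Plane) : |c.h p| ≤ c.M * ‖p‖ ^ 2 := by
  have := c.hasBoundedDifferences.abs_sub_le (p := 0) (q := p) (ρ := ‖p‖) (by simp) le_rfl
  rw [c.h_zero, sub_zero, sub_zero] at this
  linarith

theorem norm_G_sub_base_lt {p : Plane} (hp : ‖p‖ ≤ c.r / 2) : ‖c.G p - x₀‖ < c.r := by
  have h1 := c.norm_G_sub_base_sq p
  have h2 : |c.h p| ≤ ‖p‖ := by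
    refine (c.abs_h_le p).trans ?_
    have : c.M * ‖p‖ ≤ 1 := by
      have := mul_le_mul_of_nonneg_left hp c.M_nonneg
      linarith [c.M_mul_r_le]
    nlinarith [norm_nonneg p]
  have h3 : c.h p ^ 2 ≤ ‖p‖ ^ 2 := sq_le_sq' (by linarith [abs_le.1 h2]) (abs_le.1 h2).2
  have hr := c.r_pos
  refine lt_of_pow_lt_pow_left₀ 2 hr.le ?_
  nlinarith [norm_nonneg p]

theorem G_mem {p : Plane} (hp : ‖p‖ ≤ c.r / 2) : c.G p ∈ S := by
  rw [c.mem_iff _ (c.norm_G_sub_base_lt hp)]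
  have e1 : c.L.toContinuousLinearMap.adjoint (c.G p - x₀) = p := c.proj_G p
  have e2 : c.G p - x₀ = c.L p + c.h p • c.ν := by rw [G]; abel
  rw [e1, e2, inner_add_right, c.inner_ν, inner_smul_right, real_inner_self_eq_norm_sq, c.norm_ν]
  simp

theorem continuous_G : Continuous c.G := by
  have := c.contDiff_h.continuous
  have h2 := c.L.continuous
  unfold G
  fun_prop

/-- The length of the lift of the segment from `p` to `q` exceeds the chord at most by a term of
third order. -/
theorem intrinsicDist_G_le {p q : Plane} (hp : ‖p‖ ≤ c.r / 2) (hq : ‖q‖ ≤ c.r / 2) :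
    intrinsicDist S ⟨c.G p, c.G_mem hp⟩ ⟨c.G q, c.G_mem hq⟩ ≤ ENNReal.ofReal
      √(‖q - p‖ ^ 2 + (|c.h q - c.h p| + c.M * ‖q - p‖ ^ 2) ^ 2) := by
  set Λ := √(‖q - p‖ ^ 2 + (|c.h q - c.h p| + c.M * ‖q - p‖ ^ 2) ^ 2) with hΛ
  have hM := c.M_nonneg
  have hseg : ∀ t : unitInterval, ‖p + (t : ℝ) • (q - p)‖ ≤ c.r / 2 := fun t =>
    norm_add_smul_sub_le hp hq t.2
  let γ : Path (⟨c.G p, c.G_mem hp⟩ : S) ⟨c.G q, c.G_mem hq⟩ :=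
    { toFun := fun t => ⟨c.G (p + (t : ℝ) • (q - p)), c.G_mem (hseg t)⟩
      continuous_toFun := by
        refine Continuous.subtype_mk ?_ _
        have := c.continuous_G
        fun_prop
      source' := by simp
      target' := by simp }
  refine (iInf_le _ γ).trans ?_
  have hslope : ∀ t ∈ Set.Icc (0 : ℝ) 1, |fderiv ℝ c.h (p + t • (q - p)) (q - p)|
      ≤ |c.h q - c.h p| + c.M * ‖q - p‖ ^ 2 := by
    intro t ht
    set z := p + t • (q - p) with hz
    have h1 : ‖(c.h q - fderiv ℝ c.h z q) - (c.h p - fderiv ℝ c.h z p)‖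
        ≤ (c.M * ‖q - p‖) * ‖q - p‖ := by
      refine Convex.norm_image_sub_le_of_norm_hasFDerivWithin_le (𝕜 := ℝ)
        (f := fun x => c.h x - fderiv ℝ c.h z x) (f' := fun x => fderiv ℝ c.h x - fderiv ℝ c.h z)
        (s := segment ℝ p q) (fun x _ => ?_) (fun x hx => ?_) (convex_segment p q)
        (left_mem_segment ℝ p q) (right_mem_segment ℝ p q)
      · exact (((c.hasBoundedDifferences.differentiable x).hasFDerivAt).sub
          (fderiv ℝ c.h z).hasFDerivAt).hasFDerivWithinAt
      · refine (c.fderiv_sub_le x z).trans ?_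
        gcongr
        rw [segment_eq_image'] at hx
        obtain ⟨s, hs, rfl⟩ := hx
        have : p + s • (q - p) - z = (s - t) • (q - p) := by rw [hz]; module
        rw [this, norm_smul]
        refine mul_le_of_le_one_left (norm_nonneg _) ?_
        rw [Real.norm_eq_abs, abs_le]
        constructor <;> linarith [hs.1, hs.2, ht.1, ht.2]
    have e : (c.h q - fderiv ℝ c.h z q) - (c.h p - fderiv ℝ c.h z p)
        = (c.h q - c.h p) - fderiv ℝ c.h z (q - p) := by rw [map_sub]; ring
    rw [e, Real.norm_eq_abs] at h1
    have h2 := abs_sub_abs_le_abs_sub (fderiv ℝ c.h z (q - p)) (c.h q - c.h p)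
    rw [abs_sub_comm] at h1
    nlinarith
  have hlip : LipschitzWith Λ.toNNReal γ := by
    refine LipschitzWith.of_dist_le_mul fun s t => ?_
    rw [Real.coe_toNNReal _ (Real.sqrt_nonneg _)]
    change dist (c.G (p + (s : ℝ) • (q - p))) (c.G (p + (t : ℝ) • (q - p))) ≤ Λ * dist (s : ℝ) t
    rw [dist_eq_norm, Real.dist_eq]
    refine abs_le_of_sq_le_sq' ?_ (by positivity) |>.2
    rw [c.norm_G_sub_sq]
    have e1 : p + (s : ℝ) • (q - p) - (p + (t : ℝ) • (q - p)) = ((s : ℝ) - t) • (q - p) := by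
      module
    have hh : |c.h (p + (s : ℝ) • (q - p)) - c.h (p + (t : ℝ) • (q - p))| ≤
        (|c.h q - c.h p| + c.M * ‖q - p‖ ^ 2) * |(s : ℝ) - t| := by
      have := Convex.norm_image_sub_le_of_norm_hasDerivWithin_le
        (f := fun t : ℝ => c.h (p + t • (q - p))) (s := Set.Icc (0 : ℝ) 1) (x := t) (y := s)
        (fun t _ => (c.hasBoundedDifferences.hasDerivAt_comp_line p (q - p) t).hasDerivWithinAt)
        (fun t ht => hslope t ht) (convex_Icc 0 1) t.2 s.2
      exact this
    rw [e1, norm_smul, Real.norm_eq_abs, mul_pow Λ, hΛ, Real.sq_sqrt (by positivity)]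
    have h3 := pow_le_pow_left₀ (abs_nonneg _) hh 2
    rw [sq_abs] at h3
    calc _ ≤ (|(s : ℝ) - t| * ‖q - p‖) ^ 2
          + ((|c.h q - c.h p| + c.M * ‖q - p‖ ^ 2) * |(s : ℝ) - t|) ^ 2 := by gcongr
      _ = _ := by ring
  exact eVariationOn_le_of_lipschitzWith hlip

end MongeChart

/-! ### Bisectors of the intrinsic distance -/

namespace MongeChart

variable {S : Set E3} {x₀ : E3} (c : MongeChart S x₀)

theorem M_mul_half_r_le : c.M * (c.r / 2) ≤ 1 / 100 := by
  have := c.M_mul_r_le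
  have := mul_nonneg c.M_nonneg c.r_pos.le
  linarith

theorem abs_h_sub_le {p q : Plane} (hp : ‖p‖ ≤ c.r / 2) (hq : ‖q‖ ≤ c.r / 2) :
    |c.h q - c.h p| ≤ 1 / 100 * ‖q - p‖ :=
  (c.hasBoundedDifferences.abs_sub_le hp hq).trans (by
    have := c.M_mul_half_r_le
    gcongr)

theorem M_mul_norm_sub_le {p q : Plane} (hp : ‖p‖ ≤ c.r / 2) (hq : ‖q‖ ≤ c.r / 2) :
    c.M * ‖q - p‖ ≤ 1 / 50 := by
  have h1 : ‖q - p‖ ≤ c.r := (norm_sub_le _ _).trans (by linarith)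
  have := mul_le_mul_of_nonneg_left h1 c.M_nonneg
  linarith [c.M_mul_r_le, mul_nonneg c.M_nonneg c.r_pos.le]

theorem lifted_length_sq_le {p q : Plane} (hp : ‖p‖ ≤ c.r / 2) (hq : ‖q‖ ≤ c.r / 2) :
    ‖q - p‖ ^ 2 + (|c.h q - c.h p| + c.M * ‖q - p‖ ^ 2) ^ 2
      ≤ ‖q - p‖ ^ 2 + (c.h q - c.h p) ^ 2 + c.M * ‖q - p‖ ^ 3 := by
  have hM := c.M_nonneg
  have h1 := c.abs_h_sub_le hp hq
  have h2 := c.M_mul_norm_sub_le hp hq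
  have h3 : |c.h q - c.h p| * (c.M * ‖q - p‖ ^ 2) ≤ 1 / 100 * ‖q - p‖ * (c.M * ‖q - p‖ ^ 2) := by
    gcongr
  have h4 : (c.M * ‖q - p‖) * (c.M * ‖q - p‖ ^ 3) ≤ 1 / 50 * (c.M * ‖q - p‖ ^ 3) := by
    gcongr
  have h5 : 0 ≤ c.M * ‖q - p‖ ^ 3 := by positivity
  have h6 : (|c.h q - c.h p| + c.M * ‖q - p‖ ^ 2) ^ 2 = (c.h q - c.h p) ^ 2
      + 2 * (|c.h q - c.h p| * (c.M * ‖q - p‖ ^ 2)) + (c.M * ‖q - p‖) * (c.M * ‖q - p‖ ^ 3) := by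
    rw [← sq_abs (c.h q - c.h p)]; ring
  rw [h6]
  linarith

/-- Near the centre of a chart the intrinsic distance is comparable to the distance in `ℝ³`. -/
theorem intrinsicDist_le_of_near {y z : S} (hy : ‖(y : E3) - x₀‖ ≤ c.r / 2)
    (hz : ‖(z : E3) - x₀‖ ≤ c.r / 2) : intrinsicDist S y z ≤ 2 * edist y z := by
  have hr := c.r_pos
  have hp : ‖c.proj y‖ ≤ c.r / 2 := (c.norm_proj_le _).trans hy
  have hq : ‖c.proj z‖ ≤ c.r / 2 := (c.norm_proj_le _).trans hz
  have ey : (⟨c.G (c.proj y), c.G_mem hp⟩ : S) = y := Subtype.ext (c.G_proj y.2 (by linarith))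
  have ez : (⟨c.G (c.proj z), c.G_mem hq⟩ : S) = z := Subtype.ext (c.G_proj z.2 (by linarith))
  have h := c.intrinsicDist_G_le hp hq
  rw [ey, ez] at h
  refine h.trans ?_
  have e : (2 : ℝ≥0∞) * edist y z = ENNReal.ofReal (2 * ‖(y : E3) - z‖) := by
    rw [ENNReal.ofReal_mul (by norm_num), Subtype.edist_eq, edist_dist, dist_eq_norm]
    simp
  rw [e]
  refine ENNReal.ofReal_le_ofReal (Real.sqrt_le_iff.2 ⟨by positivity, ?_⟩)
  refine (c.lifted_length_sq_le hp hq).trans ?_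
  set t := ‖c.proj z - c.proj y‖ with ht
  have ht0 : 0 ≤ t := norm_nonneg _
  have h1 := c.abs_h_sub_le hp hq
  have h2 := c.M_mul_norm_sub_le hp hq
  have h3 : (c.h (c.proj z) - c.h (c.proj y)) ^ 2 ≤ t ^ 2 := by
    rw [← sq_abs]
    exact pow_le_pow_left₀ (abs_nonneg _) (h1.trans (by linarith)) 2
  have h4 : c.M * t ^ 3 ≤ t ^ 2 := by
    have : c.M * t ^ 3 = c.M * t * t ^ 2 := by ring
    rw [this]
    exact mul_le_of_le_one_left (by positivity) (h2.trans (by norm_num))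
  have h5 : t ≤ ‖(y : E3) - z‖ := by rw [ht, norm_sub_rev]; exact c.norm_proj_sub_le _ _
  have h6 : t ^ 2 ≤ ‖(y : E3) - z‖ ^ 2 := by gcongr
  nlinarith

/-- The squared intrinsic distance in the chart, up to an error `O(1/N)`; it bounds the energy of
`N`-step chains from below. -/
noncomputable def chainLowerBound (N : ℕ) (p q : Plane) : ℝ := by
  classical
  exact if h : ‖p‖ ≤ c.r / 2 ∧ ‖q‖ ≤ c.r / 2 then
    (intrinsicDist S ⟨c.G p, c.G_mem h.1⟩ ⟨c.G q, c.G_mem h.2⟩).toReal ^ 2 - c.M / N else 0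

theorem chainLowerBound_proj (N : ℕ) {y z : S} (hy : ‖(y : E3) - x₀‖ ≤ c.r / 2)
    (hz : ‖(z : E3) - x₀‖ ≤ c.r / 2) :
    c.chainLowerBound N (c.proj y) (c.proj z) = (intrinsicDist S y z).toReal ^ 2 - c.M / N := by
  have hr := c.r_pos
  have hp : ‖c.proj y‖ ≤ c.r / 2 := (c.norm_proj_le _).trans hy
  have hq : ‖c.proj z‖ ≤ c.r / 2 := (c.norm_proj_le _).trans hz
  have ey : (⟨c.G (c.proj y), c.G_mem hp⟩ : S) = y := Subtype.ext (c.G_proj y.2 (by linarith))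
  have ez : (⟨c.G (c.proj z), c.G_mem hq⟩ : S) = z := Subtype.ext (c.G_proj z.2 (by linarith))
  rw [chainLowerBound, dif_pos ⟨hp, hq⟩, ey, ez]

theorem chainLowerBound_le {N : ℕ} (hN : 0 < N) (e : ℕ → Plane) (he : ∀ k ≤ N, ‖e k‖ ≤ c.r / 2)
    (hs : ∀ k < N, ‖e (k + 1) - e k‖ ≤ c.r / 2 / N) :
    c.chainLowerBound N (e 0) (e N) ≤ chainEnergy c.h N e := by
  have hM := c.M_nonneg
  have hNR : (0 : ℝ) < N := Nat.cast_pos.2 hN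
  have hr := c.r_pos
  rw [chainLowerBound, dif_pos ⟨he 0 hN.le, he N le_rfl⟩]
  let p : ℕ → S := fun k => if hk : k ≤ N then ⟨c.G (e k), c.G_mem (he k hk)⟩ else
    ⟨c.G (e 0), c.G_mem (he 0 hN.le)⟩
  have hpk : ∀ k (hk : k ≤ N), p k = ⟨c.G (e k), c.G_mem (he k hk)⟩ := fun k hk => dif_pos hk
  set l : ℕ → ℝ := fun k =>
    √(‖e (k + 1) - e k‖ ^ 2 + (|c.h (e (k + 1)) - c.h (e k)| + c.M * ‖e (k + 1) - e k‖ ^ 2) ^ 2)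
    with hl
  have hl0 : ∀ k, 0 ≤ l k := fun k => Real.sqrt_nonneg _
  have h1 : intrinsicDist S (p 0) (p N) ≤ ENNReal.ofReal (∑ k ∈ Finset.range N, l k) := by
    rw [ENNReal.ofReal_sum_of_nonneg (fun k _ => hl0 k)]
    refine (intrinsicDist_le_sum p hN).trans (Finset.sum_le_sum fun k hk => ?_)
    have hk' := Finset.mem_range.1 hk
    rw [hpk k hk'.le, hpk (k + 1) hk']
    exact c.intrinsicDist_G_le (he k hk'.le) (he (k + 1) hk')
  rw [hpk 0 hN.le, hpk N le_rfl] at h1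
  have h2 := ENNReal.toReal_le_of_le_ofReal (Finset.sum_nonneg fun k _ => hl0 k) h1
  have h3 : (∑ k ∈ Finset.range N, l k) ^ 2 ≤ N * ∑ k ∈ Finset.range N, l k ^ 2 := by
    simpa using sq_sum_le_card_mul_sum_sq (s := Finset.range N) (f := l)
  have h4 : ∀ k ∈ Finset.range N, l k ^ 2 ≤ (‖e (k + 1) - e k‖ ^ 2
      + (c.h (e (k + 1)) - c.h (e k)) ^ 2) + c.M * (1 / N) ^ 3 := by
    intro k hk
    have hk' := Finset.mem_range.1 hk
    rw [hl, Real.sq_sqrt (by positivity)]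
    refine (c.lifted_length_sq_le (he k hk'.le) (he (k + 1) hk')).trans ?_
    gcongr
    refine (hs k hk').trans ?_
    gcongr
    linarith [c.r_le]
  have h5 := mul_le_mul_of_nonneg_left (Finset.sum_le_sum h4) hNR.le
  rw [Finset.sum_add_distrib, mul_add, Finset.sum_const, Finset.card_range, nsmul_eq_mul] at h5
  have h6 : (N : ℝ) * (N * (c.M * (1 / N) ^ 3)) = c.M / N := by field_simp
  rw [h6] at h5
  have h7 := pow_le_pow_left₀ ENNReal.toReal_nonneg h2 2
  unfold chainEnergy
  linarith

/-- Almost minimal chains in the chart between two points at intrinsic distance less than `ℓ`. -/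
theorem exists_chain {y z : S} {ℓ : ℝ} (hℓ0 : 0 ≤ ℓ) (hℓ : ‖(y : E3) - x₀‖ + ℓ ≤ c.r / 8)
    (h : intrinsicDist S y z < ENNReal.ofReal ℓ) {N : ℕ} (hN : 0 < N) :
    ∃ a : ℕ → Plane, a 0 = c.proj y ∧ a N = c.proj z ∧ (∀ k ≤ N, ‖a k‖ ≤ c.r / 2 / 4) ∧
      (∀ k < N, ‖a (k + 1) - a k‖ ≤ ℓ / N) ∧ chainEnergy c.h N a ≤ ℓ ^ 2 := by
  have hNR : (0 : ℝ) < N := Nat.cast_pos.2 hN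
  have hr := c.r_pos
  obtain ⟨p, hp0, hpN, hp⟩ := exists_chain_of_intrinsicDist_lt hℓ0 h hN
  have hdist : ∀ k ≤ N, dist (p k) y ≤ k * (ℓ / N) := by
    intro k
    induction k with
    | zero => intro _; simp [hp0]
    | succ k ih =>
      intro hk
      push_cast
      linarith [dist_triangle (p (k + 1)) (p k) y, hp k hk, ih (Nat.le_of_succ_le hk)]
  have hnear : ∀ k ≤ N, ‖(p k : E3) - x₀‖ ≤ c.r / 8 := by
    intro k hk
    have h1 : (k : ℝ) * (ℓ / N) ≤ ℓ := by
      have hkN : (k : ℝ) ≤ N := by exact_mod_cast hk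
      calc (k : ℝ) * (ℓ / N) ≤ N * (ℓ / N) := by gcongr
        _ = ℓ := by field_simp
    have h2 : ‖(p k : E3) - y‖ ≤ ℓ := by
      have := (hdist k hk).trans h1
      rwa [Subtype.dist_eq, dist_eq_norm] at this
    have h3 := norm_add_le ((p k : E3) - y) ((y : E3) - x₀)
    rw [sub_add_sub_cancel] at h3
    linarith
  refine ⟨fun k => c.proj (p k), by simp only [hp0], by simp only [hpN],
    fun k hk => (c.norm_proj_le _).trans ((hnear k hk).trans_eq (by ring)), fun k hk => ?_, ?_⟩
  · have := hp k hk
    rw [Subtype.dist_eq, dist_eq_norm] at this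
    exact (c.norm_proj_sub_le _ _).trans this
  · have hterm : ∀ k ∈ Finset.range N, ‖c.proj (p (k + 1)) - c.proj (p k)‖ ^ 2
        + (c.h (c.proj (p (k + 1))) - c.h (c.proj (p k))) ^ 2 ≤ (ℓ / N) ^ 2 := by
      intro k hk
      have hk' := Finset.mem_range.1 hk
      rw [← c.norm_G_sub_sq, c.G_proj (p (k + 1)).2 (by linarith [hnear (k + 1) hk']),
        c.G_proj (p k).2 (by linarith [hnear k hk'.le])]
      have := hp k hk'
      rw [Subtype.dist_eq, dist_eq_norm] at this
      gcongr
    have := mul_le_mul_of_nonneg_left (Finset.sum_le_sum hterm) hNR.le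
    rw [Finset.sum_const, Finset.card_range, nsmul_eq_mul] at this
    refine this.trans_eq ?_
    field_simp

theorem toReal_intrinsicDist_le {y z : S} (hy : ‖(y : E3) - x₀‖ ≤ c.r / 64)
    (hz : ‖(z : E3) - x₀‖ ≤ c.r / 64) :
    intrinsicDist S y z ≠ ⊤ ∧ (intrinsicDist S y z).toReal ≤ c.r / 16 := by
  have hr := c.r_pos
  have h : intrinsicDist S y z ≤ ENNReal.ofReal (c.r / 16) := by
    refine (c.intrinsicDist_le_of_near (by linarith) (by linarith)).trans ?_
    have h1 := norm_sub_le ((y : E3) - x₀) ((z : E3) - x₀)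
    rw [sub_sub_sub_cancel_right] at h1
    have e : (2 : ℝ≥0∞) * edist y z = ENNReal.ofReal (2 * ‖(y : E3) - z‖) := by
      rw [ENNReal.ofReal_mul (by norm_num), Subtype.edist_eq, edist_dist, dist_eq_norm]
      simp
    rw [e]
    exact ENNReal.ofReal_le_ofReal (by linarith)
  exact ⟨ne_top_of_le_ne_top ENNReal.ofReal_ne_top h,
    ENNReal.toReal_le_of_le_ofReal (by positivity) h⟩

/-- The four-point inequality for two points `y`, `y'` equidistant from `x` and `x'`. -/
theorem inner_bisector_nonneg {x x' y y' : S}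
    (hx : ‖(x : E3) - x₀‖ ≤ c.r / 64) (hx' : ‖(x' : E3) - x₀‖ ≤ c.r / 64)
    (hy : ‖(y : E3) - x₀‖ ≤ c.r / 64) (hy' : ‖(y' : E3) - x₀‖ ≤ c.r / 64)
    (hyx : intrinsicDist S y x = intrinsicDist S y x')
    (hyx' : intrinsicDist S y' x = intrinsicDist S y' x')
    (hle : ‖c.proj y' - c.proj y‖ ≤ ‖c.proj x - c.proj x'‖) :
    0 ≤ 2 * inner ℝ (c.proj y' - c.proj y) (c.proj x - c.proj x')
      + 1 / 100 * (‖c.proj y' - c.proj y‖ * ‖c.proj x - c.proj x'‖) := by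
  have hM := c.M_nonneg
  have hr := c.r_pos
  have hr1 := c.r_le
  obtain ⟨ft1, fd1⟩ := c.toReal_intrinsicDist_le hy hx'
  obtain ⟨ft2, fd2⟩ := c.toReal_intrinsicDist_le hy' hx
  set d1 := (intrinsicDist S y x').toReal with hd1
  set d2 := (intrinsicDist S y' x).toReal with hd2
  have hd10 : 0 ≤ d1 := ENNReal.toReal_nonneg
  have hd20 : 0 ≤ d2 := ENNReal.toReal_nonneg
  set u := c.proj y' - c.proj y with hu
  set w := c.proj x - c.proj x' with hw
  have key : ∀ η : ℝ, 0 < η →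
      0 ≤ η + 2 * inner ℝ u w + 1 / 700 * (‖u‖ * (3 * ‖u‖ + 2 * ‖w‖ + 2 * √η)) := by
    intro η hη
    obtain ⟨N, hN⟩ := exists_nat_gt (4 * c.M / η)
    have hNR : (0 : ℝ) < N := lt_of_le_of_lt (by positivity) hN
    have hN0 : 0 < N := Nat.cast_pos.1 hNR
    have hMN : 2 * (c.M / N) ≤ η / 2 := by
      rw [div_lt_iff₀ hη] at hN
      rw [← mul_div_assoc, div_le_div_iff₀ hNR (by norm_num)]
      linarith
    set ε := min (η / 4) (c.r / 64) with hε
    have hε0 : 0 < ε := by positivity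
    have hε1 : ε ≤ η / 4 := min_le_left _ _
    have hε2 : ε ≤ c.r / 64 := min_le_right _ _
    have hlt : ∀ {d : ℝ≥0∞}, d ≠ ⊤ → d < ENNReal.ofReal (d.toReal + ε) := by
      intro d hd
      rw [ENNReal.lt_ofReal_iff_toReal_lt hd]
      linarith
    obtain ⟨a, ha0, haN, haρ, has, haE⟩ := c.exists_chain (z := x') (ℓ := d1 + ε)
      (by positivity) (by linarith) (hlt ft1) hN0
    obtain ⟨b, hb0, hbN, hbρ, hbs, hbE⟩ := c.exists_chain (z := x) (ℓ := d2 + ε)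
      (by positivity) (by linarith) (hlt ft2) hN0
    have hy2 : ‖(y : E3) - x₀‖ ≤ c.r / 2 := by linarith
    have hy2' : ‖(y' : E3) - x₀‖ ≤ c.r / 2 := by linarith
    have hx2 : ‖(x : E3) - x₀‖ ≤ c.r / 2 := by linarith
    have hx2' : ‖(x' : E3) - x₀‖ ≤ c.r / 2 := by linarith
    have D1 := c.chainLowerBound_proj N hy2 hx2'
    have D2 := c.chainLowerBound_proj N hy2' hx2
    have D3 := c.chainLowerBound_proj N hy2' hx2'
    have D4 := c.chainLowerBound_proj N hy2 hx2
    rw [← hyx', ← hd2] at D3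
    rw [hyx, ← hd1] at D4
    rw [← hd1] at D1
    rw [← hd2] at D2
    have hsq : ∀ {d : ℝ}, 0 ≤ d → d ≤ c.r / 16 → (d + ε) ^ 2 ≤ d ^ 2 + ε := by
      intro d h0 h1
      nlinarith
    have := c.hasBoundedDifferences.four_point (ρ := c.r / 2)
      (s := max (d1 + ε) (d2 + ε) / N) (η := η) (by positivity) (by linarith)
      c.M_mul_half_r_le hη.le hN0 (a := a) (b := b) (by positivity)
      (by
        rw [mul_div_cancel₀ _ hNR.ne']
        exact max_le (by linarith) (by linarith))
      (fun k hk => (has k hk).trans (by gcongr; exact le_max_left _ _))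
      (fun k hk => (hbs k hk).trans (by gcongr; exact le_max_right _ _)) haρ hbρ
      (D := c.chainLowerBound N) (fun e he hs => c.chainLowerBound_le hN0 e he hs)
      ha0 haN hb0 hbN (by
        rw [D1, D2]
        linarith [hsq hd10 fd1, hsq hd20 fd2])
    rw [D1, D2, D3, D4] at this
    linarith
  have hlim : Tendsto (fun η : ℝ =>
      η + 2 * inner ℝ u w + 1 / 700 * (‖u‖ * (3 * ‖u‖ + 2 * ‖w‖ + 2 * √η))) (𝓝[>] 0)
      (𝓝 (0 + 2 * inner ℝ u w + 1 / 700 * (‖u‖ * (3 * ‖u‖ + 2 * ‖w‖ + 2 * √0)))) := by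
    refine (Continuous.tendsto ?_ 0).mono_left nhdsWithin_le_nhds
    fun_prop
  have h0 := ge_of_tendsto hlim (eventually_mem_nhdsWithin.mono fun η hη => key η hη)
  rw [Real.sqrt_zero] at h0
  have h1 : ‖u‖ * (3 * ‖u‖ + 2 * ‖w‖ + 2 * 0) ≤ ‖u‖ * (5 * ‖w‖) := by
    gcongr
    linarith
  have h2 : 0 ≤ ‖u‖ * ‖w‖ := by positivity
  linarith

end MongeChart

theorem norm_sq_mul_norm_sq_plane (u w : Plane) :
    ‖u‖ ^ 2 * ‖w‖ ^ 2 = inner ℝ u w ^ 2 + (u 0 * w 1 - u 1 * w 0) ^ 2 := by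
  simp only [EuclideanSpace.norm_sq_eq, Fin.sum_univ_two, Real.norm_eq_abs, sq_abs,
    PiLp.inner_apply, RCLike.inner_apply, conj_trivial]
  ring

namespace MongeChart

variable {S : Set E3} {x₀ : E3} (c : MongeChart S x₀)

/-- On a piece of a bisector, the coordinate along the bisector is an antilipschitz function. -/
theorem norm_sub_le_of_bisector {x x' y y' : S}
    (hx : ‖(x : E3) - x₀‖ ≤ c.r / 64) (hx' : ‖(x' : E3) - x₀‖ ≤ c.r / 64)
    (hy : ‖(y : E3) - x₀‖ ≤ c.r / 64) (hy' : ‖(y' : E3) - x₀‖ ≤ c.r / 64)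
    (hyx : intrinsicDist S y x = intrinsicDist S y x')
    (hyx' : intrinsicDist S y' x = intrinsicDist S y' x')
    (hle : ‖c.proj y' - c.proj y‖ ≤ ‖c.proj x - c.proj x'‖) :
    ‖(y' : E3) - y‖ * ‖c.proj x - c.proj x'‖ ≤
      4 * |(c.proj y' 0 * (c.proj x - c.proj x') 1 - c.proj y' 1 * (c.proj x - c.proj x') 0)
        - (c.proj y 0 * (c.proj x - c.proj x') 1 - c.proj y 1 * (c.proj x - c.proj x') 0)| := by
  have hr := c.r_pos
  have h1 := c.inner_bisector_nonneg hx hx' hy hy' hyx hyx' hle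
  have h2 := c.inner_bisector_nonneg hx hx' hy' hy hyx' hyx (by rwa [norm_sub_rev])
  have hG := c.norm_G_sub_sq (c.proj y') (c.proj y)
  rw [c.G_proj y'.2 (by linarith), c.G_proj y.2 (by linarith)] at hG
  have hp := (c.norm_proj_le y).trans (hy.trans (by linarith : c.r / 64 ≤ c.r / 2))
  have hp' := (c.norm_proj_le y').trans (hy'.trans (by linarith : c.r / 64 ≤ c.r / 2))
  have hh := pow_le_pow_left₀ (abs_nonneg _) (c.abs_h_sub_le hp hp') 2
  rw [sq_abs] at hh
  rw [norm_sub_rev (c.proj y), ← neg_sub (c.proj y'), inner_neg_left] at h2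
  set w := c.proj x - c.proj x' with hw
  set u := c.proj y' - c.proj y with hu
  have e : (c.proj y' 0 * w 1 - c.proj y' 1 * w 0) - (c.proj y 0 * w 1 - c.proj y 1 * w 0)
      = u 0 * w 1 - u 1 * w 0 := by
    have e0 : u 0 = c.proj y' 0 - c.proj y 0 := rfl
    have e1 : u 1 = c.proj y' 1 - c.proj y 1 := rfl
    rw [e0, e1]; ring
  rw [e]
  have hid := norm_sq_mul_norm_sq_plane u w
  have hin : inner ℝ u w ^ 2 ≤ (1 / 200 * (‖u‖ * ‖w‖)) ^ 2 :=
    sq_le_sq' (by linarith) (by linarith)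
  refine abs_le_of_sq_le_sq' ?_ (by positivity) |>.2
  rw [mul_pow, mul_pow, sq_abs, hG]
  have h3 : (c.h (c.proj y') - c.h (c.proj y)) ^ 2 * ‖w‖ ^ 2
      ≤ (1 / 100 * ‖u‖) ^ 2 * ‖w‖ ^ 2 := by gcongr
  have h4 : 0 ≤ ‖u‖ ^ 2 * ‖w‖ ^ 2 := by positivity
  linarith

end MongeChart

/-! ### The area measure in a chart -/

theorem LipschitzOnWith.euclideanHausdorffMeasure_image_le {X Y : Type*} [EMetricSpace X]
    [MeasurableSpace X] [BorelSpace X] [EMetricSpace Y] [MeasurableSpace Y] [BorelSpace Y]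
    {K : NNReal} {f : X → Y} {s : Set X} (hf : LipschitzOnWith K f s) (d : ℕ) :
    μHE[d] (f '' s) ≤ (K : ℝ≥0∞) ^ d * μHE[d] s := by
  simp_rw [Measure.euclideanHausdorffMeasure_def, Measure.smul_apply, ENNReal.smul_def, smul_eq_mul]
  rw [mul_left_comm]
  gcongr
  simpa using hf.hausdorffMeasure_image_le (d := (d : ℝ)) (by positivity)

theorem euclideanHausdorffMeasure_plane : (μHE[2] : Measure Plane) = volume :=
  EuclideanSpace.euclideanHausdorffMeasure_eq_volume 2

theorem areaMeasure_apply (S : Set E3) (A : Set S) :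
    areaMeasure S A = μHE[2] (Subtype.val '' A) :=
  (isometry_subtype_coe.euclideanHausdorffMeasure_image A).symm

/-- A set on which a real function is antilipschitz has zero area. -/
theorem areaMeasure_eq_zero_of_norm_sub_le {S : Set E3} {T : Set S} {f : S → ℝ} {K : ℝ}
    (hK : 0 ≤ K) (h : ∀ y ∈ T, ∀ z ∈ T, ‖(y : E3) - z‖ ≤ K * |f y - f z|) :
    areaMeasure S T = 0 := by
  let g : T → ℝ := fun y => f y
  have hg : AntilipschitzWith K.toNNReal g := by
    refine AntilipschitzWith.of_le_mul_dist fun y z => ?_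
    rw [Real.coe_toNNReal _ hK, Subtype.dist_eq, Subtype.dist_eq, dist_eq_norm, Real.dist_eq]
    exact h y y.2 z z.2
  have h1 := hg.le_hausdorffMeasure_image (d := 2) (by norm_num) Set.univ
  have h2 : μH[2] (g '' Set.univ) = 0 := by
    have : dimH (g '' Set.univ) < ((2 : NNReal) : ℝ≥0∞) := by
      refine (dimH_mono (Set.subset_univ _)).trans_lt ?_
      rw [Real.dimH_univ]
      norm_num
    simpa only [NNReal.coe_ofNat] using hausdorffMeasure_of_dimH_lt this
  rw [h2, mul_zero] at h1
  have h3 : μH[2] T = 0 := by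
    have := (isometry_subtype_coe (s := T)).hausdorffMeasure_image (d := 2) (Or.inl (by norm_num))
      Set.univ
    rw [Set.image_univ, Subtype.range_coe] at this
    rw [this]
    exact le_antisymm h1 zero_le
  simp only [areaMeasure, Measure.euclideanHausdorffMeasure_def, Measure.smul_apply]
  simp [h3]

namespace MongeChart

variable {S : Set E3} {x₀ : E3} (c : MongeChart S x₀)

/-- Bisectors of nearby points have zero area. -/
theorem areaMeasure_bisector {x x' : S} (hxx' : x ≠ x')
    (hx : ‖(x : E3) - x₀‖ ≤ c.r / 64) (hx' : ‖(x' : E3) - x₀‖ ≤ c.r / 64) :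
    areaMeasure S {y | ‖(y : E3) - x₀‖ ≤ c.r / 64 ∧ intrinsicDist S y x = intrinsicDist S y x'}
      = 0 := by
  have hr := c.r_pos
  set w := c.proj x - c.proj x' with hw
  have hw0 : w ≠ 0 := by
    intro h0
    apply hxx'
    rw [hw, sub_eq_zero] at h0
    apply Subtype.ext
    rw [← c.G_proj x.2 (by linarith), ← c.G_proj x'.2 (by linarith), h0]
  have hwn : 0 < ‖w‖ := norm_pos_iff.2 hw0
  refine measure_null_of_locally_null _ fun z _ => ?_
  refine ⟨_ ∩ Metric.ball z (‖w‖ / 2),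
    inter_mem_nhdsWithin _ (Metric.ball_mem_nhds z (by positivity)), ?_⟩
  refine areaMeasure_eq_zero_of_norm_sub_le (K := 4 / ‖w‖)
    (f := fun y => c.proj y 0 * w 1 - c.proj y 1 * w 0) (by positivity) ?_
  rintro y ⟨⟨hy, hyb⟩, hyz⟩ y' ⟨⟨hy', hyb'⟩, hyz'⟩
  have hd : ‖(y : E3) - y'‖ ≤ ‖w‖ := by
    have := dist_triangle_right y y' z
    rw [Subtype.dist_eq, dist_eq_norm] at this
    linarith [Metric.mem_ball.1 hyz, Metric.mem_ball.1 hyz']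
  have := c.norm_sub_le_of_bisector hx hx' hy' hy hyb' hyb
    ((c.norm_proj_sub_le _ _).trans hd)
  rw [div_mul_eq_mul_div, le_div_iff₀ hwn]
  exact this

theorem lipschitzOnWith_G (R : ℝ) :
    LipschitzOnWith (√(1 + (c.M * R) ^ 2)).toNNReal c.G (Metric.closedBall 0 R) := by
  refine LipschitzOnWith.of_dist_le_mul fun p hp q hq => ?_
  rw [mem_closedBall_zero_iff] at hp hq
  rw [Real.coe_toNNReal _ (Real.sqrt_nonneg _), dist_eq_norm, dist_eq_norm]
  refine abs_le_of_sq_le_sq' ?_ (by positivity) |>.2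
  rw [c.norm_G_sub_sq, mul_pow, Real.sq_sqrt (by positivity)]
  have h1 := pow_le_pow_left₀ (abs_nonneg _) (c.hasBoundedDifferences.abs_sub_le hq hp) 2
  rw [sq_abs] at h1
  linarith

/-- The area of a piece of the graph over a disc of radius `R` is at most `1 + (M R)²` times the
area of its projection to the tangent plane. -/
theorem area_image_G_le {R : ℝ} {A : Set Plane} (hA : A ⊆ Metric.closedBall 0 R) :
    μHE[2] (c.G '' A) ≤ ENNReal.ofReal (1 + (c.M * R) ^ 2) * volume A := by
  have h := ((c.lipschitzOnWith_G R).mono hA).euclideanHausdorffMeasure_image_le 2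
  rw [euclideanHausdorffMeasure_plane] at h
  refine h.trans_eq ?_
  congr 1
  change ENNReal.ofReal _ ^ 2 = _
  rw [← ENNReal.ofReal_pow (Real.sqrt_nonneg _), Real.sq_sqrt (by positivity)]

theorem volume_le_area_image_G (A : Set Plane) : volume A ≤ μHE[2] (c.G '' A) := by
  have hl : LipschitzOnWith 1 c.proj (c.G '' A) := by
    refine LipschitzOnWith.of_dist_le_mul fun y _ z _ => ?_
    rw [dist_eq_norm, dist_eq_norm]
    simpa using c.norm_proj_sub_le y z
  have h := hl.euclideanHausdorffMeasure_image_le 2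
  have e : c.proj '' (c.G '' A) = A := by
    rw [Set.image_image]; simp [c.proj_G]
  rw [e, euclideanHausdorffMeasure_plane] at h
  simpa using h

end MongeChart

theorem isFiniteMeasure_areaMeasure {S : Set E3} (hSc : IsCompact S) (hS : IsSmoothSurface S) :
    IsFiniteMeasure (areaMeasure S) := by
  have : CompactSpace S := isCompact_iff_compactSpace.1 hSc
  refine ⟨isCompact_univ.measure_lt_top_of_nhdsWithin fun x _ => ?_⟩
  obtain ⟨c⟩ := hS.nonempty_mongeChart x.2
  have hr := c.r_pos
  refine ⟨Metric.ball x (c.r / 2), mem_nhdsWithin_of_mem_nhds (Metric.ball_mem_nhds x (by positivity)),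
    ?_⟩
  rw [areaMeasure_apply]
  have hsub : Subtype.val '' (Metric.ball x (c.r / 2)) ⊆ c.G '' Metric.closedBall 0 (c.r / 2) := by
    rintro _ ⟨y, hy, rfl⟩
    have hy' : ‖(y : E3) - x‖ < c.r / 2 := by
      rw [Metric.mem_ball, Subtype.dist_eq, dist_eq_norm] at hy
      exact hy
    exact ⟨c.proj y, by simpa using (c.norm_proj_le y).trans hy'.le, c.G_proj y.2 (by linarith)⟩
  refine (measure_mono hsub).trans_lt ((c.area_image_G_le le_rfl).trans_lt ?_)
  exact ENNReal.mul_lt_top ENNReal.ofReal_lt_top measure_closedBall_lt_top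

theorem IsSmoothSurface.continuous_intrinsicDist {S : Set E3} (hS : IsSmoothSurface S) (z : S) :
    Continuous fun y => intrinsicDist S y z := by
  rw [continuous_iff_continuousAt]
  intro x
  obtain ⟨c⟩ := hS.nonempty_mongeChart x.2
  have hr := c.r_pos
  have hU : Metric.ball x (c.r / 2) ∈ 𝓝 x := Metric.ball_mem_nhds x (by positivity)
  refine ContinuousOn.continuousAt (s := Metric.ball x (c.r / 2)) ?_ hU
  rw [continuousOn_iff_continuous_domRestrict]
  have hn : ∀ y ∈ Metric.ball x (c.r / 2), ‖(y : E3) - x‖ ≤ c.r / 2 := by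
    intro y hy
    rw [Metric.mem_ball, Subtype.dist_eq, dist_eq_norm] at hy
    exact hy.le
  refine continuous_of_le_add_edist 2 (by norm_num) fun y y' => ?_
  refine (intrinsicDist_triangle S y y' z).trans ?_
  exact (add_comm _ _).trans_le
    (add_le_add le_rfl (c.intrinsicDist_le_of_near (hn _ y.2) (hn _ y'.2)))

/-! ### Voronoi quadrature -/

/-- On a compact surface, short bisectors have zero area. -/
theorem IsSmoothSurface.exists_areaMeasure_bisector {S : Set E3} (hSc : IsCompact S)
    (hS : IsSmoothSurface S) :
    ∃ δ₁ : ℝ, 0 < δ₁ ∧ ∀ x x' : S, x ≠ x' → areaMeasure S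
      {y | intrinsicDist S y x ≤ ENNReal.ofReal δ₁ ∧ intrinsicDist S y x = intrinsicDist S y x'}
        = 0 := by
  have c : ∀ p : S, MongeChart S p := fun p => (hS.nonempty_mongeChart p.2).some
  obtain ⟨δ, hδ, hleb⟩ := lebesgue_number_lemma_of_metric (s := S)
    (c := fun p : S => Metric.ball (p : E3) ((c p).r / 64)) hSc (fun p => Metric.isOpen_ball)
    (fun y hy => Set.mem_iUnion.2 ⟨⟨y, hy⟩, Metric.mem_ball_self (by
      have := (c ⟨y, hy⟩).r_pos
      positivity)⟩)
  refine ⟨δ / 4, by positivity, fun x x' hxx' => ?_⟩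
  obtain ⟨p, hp⟩ := hleb x x.2
  have hdist : ∀ y z : S, intrinsicDist S y z ≤ ENNReal.ofReal (δ / 4) →
      dist (y : E3) z ≤ δ / 4 := by
    intro y z h
    have := (edist_le_intrinsicDist S y z).trans h
    rwa [Subtype.edist_eq, edist_dist, ENNReal.ofReal_le_ofReal_iff (by positivity)] at this
  have hball : ∀ z : E3, dist z x < δ → ‖z - p‖ ≤ (c p).r / 64 := by
    intro z hz
    have := hp (Metric.mem_ball.2 hz)
    rw [Metric.mem_ball, dist_eq_norm] at this
    exact this.le
  by_cases hne : ∃ y : S, intrinsicDist S y x ≤ ENNReal.ofReal (δ / 4) ∧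
      intrinsicDist S y x = intrinsicDist S y x'
  · obtain ⟨y₀, h1, h2⟩ := hne
    have hx' : dist (x' : E3) x < δ := by
      have := dist_triangle_left (x' : E3) x y₀
      linarith [hdist _ _ h1, hdist _ _ (h2 ▸ h1)]
    refine measure_mono_null ?_ ((c p).areaMeasure_bisector hxx'
      (hball x (by simpa using hδ)) (hball x' hx'))
    rintro y ⟨hy1, hy2⟩
    exact ⟨hball y ((hdist _ _ hy1).trans_lt (by linarith)), hy2⟩
  · have : {y : S | intrinsicDist S y x ≤ ENNReal.ofReal (δ / 4) ∧
        intrinsicDist S y x = intrinsicDist S y x'} = ∅ := by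
      rw [Set.eq_empty_iff_forall_notMem]
      exact fun y hy => hne ⟨y, hy⟩
    rw [this, measure_empty]

section Voronoi

variable {S : Set E3} {I : ℕ} {X : Fin I → S} {δ : ℝ}

theorem IsSmoothSurface.measurableSet_voronoiCell (hS : IsSmoothSurface S) (X : Fin I → S)
    (i : Fin I) : MeasurableSet (voronoiCell S X i) := by
  have : voronoiCell S X i = ⋂ i', {y | intrinsicDist S y (X i) ≤ intrinsicDist S y (X i')} := by
    ext y; simp [voronoiCell]
  rw [this]
  exact MeasurableSet.iInter fun i' =>
    (isClosed_le (hS.continuous_intrinsicDist _) (hS.continuous_intrinsicDist _)).measurableSet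

theorem IsNet.iUnion_voronoiCell (hX : IsNet S δ X) : ⋃ i, voronoiCell S X i = Set.univ := by
  refine Set.eq_univ_of_forall fun y => ?_
  obtain ⟨j, -⟩ := hX y
  have : Nonempty (Fin I) := ⟨j⟩
  obtain ⟨i, hi⟩ := Finite.exists_min fun i => intrinsicDist S y (X i)
  exact Set.mem_iUnion.2 ⟨i, hi⟩

theorem IsNet.intrinsicDist_le_of_mem_voronoiCell (hX : IsNet S δ X) {i : Fin I} {y : S}
    (hy : y ∈ voronoiCell S X i) : intrinsicDist S y (X i) ≤ ENNReal.ofReal δ := by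
  obtain ⟨j, hj⟩ := hX y
  exact (hy j).trans hj

/-- For a fine net, the integral over the surface is the sum of the integrals over the Voronoi
cells, as these overlap in sets of zero area only. -/
theorem IsNet.integral_eq_sum_voronoiCell (hS : IsSmoothSurface S) [IsFiniteMeasure (areaMeasure S)]
    (hX : IsNet S δ X) (hinj : Function.Injective X)
    (hnull : ∀ x x' : S, x ≠ x' → areaMeasure S
      {y | intrinsicDist S y x ≤ ENNReal.ofReal δ ∧ intrinsicDist S y x = intrinsicDist S y x'} = 0)
    {F : Type*} [NormedAddCommGroup F] [NormedSpace ℝ F] {φ : S → F}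
    (hφ : Integrable φ (areaMeasure S)) :
    ∫ y, φ y ∂(areaMeasure S) = ∑ i, ∫ y in voronoiCell S X i, φ y ∂(areaMeasure S) := by
  have h := integral_iUnion_ae (μ := areaMeasure S) (s := voronoiCell S X) (f := φ)
    (fun i => (hS.measurableSet_voronoiCell X i).nullMeasurableSet) (fun i j hij => by
      refine measure_mono_null ?_ (hnull (X i) (X j) (fun h => hij (hinj h)))
      rintro y ⟨hi, hj⟩
      exact ⟨hX.intrinsicDist_le_of_mem_voronoiCell hi, le_antisymm (hi j) (hj i)⟩)
    hφ.integrableOn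
  rw [hX.iUnion_voronoiCell, setIntegral_univ, tsum_fintype] at h
  exact h

/-- The quadrature error of the Voronoi weights. -/
theorem IsNet.norm_sum_voronoiWeight_sub_integral_le (hS : IsSmoothSurface S)
    [IsFiniteMeasure (areaMeasure S)]
    (hX : IsNet S δ X) (hinj : Function.Injective X)
    (hnull : ∀ x x' : S, x ≠ x' → areaMeasure S
      {y | intrinsicDist S y x ≤ ENNReal.ofReal δ ∧ intrinsicDist S y x = intrinsicDist S y x'} = 0)
    {F : Type*} [NormedAddCommGroup F] [NormedSpace ℝ F] [CompleteSpace F] {φ : S → F}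
    (hφ : Integrable φ (areaMeasure S)) {ε : ℝ}
    (hε : ∀ y z : S, intrinsicDist S y z ≤ ENNReal.ofReal δ → ‖φ z - φ y‖ ≤ ε) :
    ‖∑ i, voronoiWeight S X i • φ (X i) - ∫ y, φ y ∂(areaMeasure S)‖
      ≤ ε * (areaMeasure S).real Set.univ := by
  rw [hX.integral_eq_sum_voronoiCell hS hinj hnull hφ, ← Finset.sum_sub_distrib]
  have h1 : (areaMeasure S).real Set.univ = ∑ i, (areaMeasure S).real (voronoiCell S X i) := by
    have := hX.integral_eq_sum_voronoiCell hS hinj hnull (integrable_const (1 : ℝ))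
    simpa using this
  rw [h1, Finset.mul_sum]
  refine (norm_sum_le _ _).trans (Finset.sum_le_sum fun i _ => ?_)
  have h2 : voronoiWeight S X i • φ (X i)
      = ∫ _ in voronoiCell S X i, φ (X i) ∂(areaMeasure S) := by
    rw [setIntegral_const]; rfl
  rw [h2, ← integral_sub (integrable_const _) hφ.integrableOn]
  refine norm_setIntegral_le_of_norm_le_const (measure_lt_top _ _) fun y hy => ?_
  exact hε y (X i) (hX.intrinsicDist_le_of_mem_voronoiCell hy)

end Voronoi

theorem continuous_gaussianRBF (σ : ℝ) : Continuous (gaussianRBF σ) := by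
  unfold gaussianRBF; fun_prop

/-- Convergence of the discrete extensions along finer and finer nets. -/
theorem gaussianCloudExtend_tendsto {S : Set E3} (hSc : IsCompact S) (hS : IsSmoothSurface S)
    {F : Type*} [NormedAddCommGroup F] [NormedSpace ℝ F] [CompleteSpace F] (f : C(S, F)) (σ : ℝ)
    (x : E3) {ε : ℝ} (hε : 0 < ε) :
    ∃ δ₀ > 0, ∀ δ : ℝ, 0 < δ → δ < δ₀ →
        ∀ (I : ℕ) (X : Fin I → S), Function.Injective X → IsNet S δ X →
          ‖gaussianCloudExtend σ X (restrictTo X f) x - surfaceExtend σ f x‖ < ε := by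
  have : CompactSpace S := isCompact_iff_compactSpace.1 hSc
  have : IsFiniteMeasure (areaMeasure S) := isFiniteMeasure_areaMeasure hSc hS
  set k : ℝ := 1 / (2 * Real.pi * σ ^ 2) with hk
  have hk0 : 0 ≤ k := by positivity
  set A := (areaMeasure S).real Set.univ with hA
  have hA0 : 0 ≤ A := measureReal_nonneg
  let φ : S → F := fun y => gaussianRBF σ ‖x - (y : E3)‖ • f y
  have hφc : Continuous φ := by
    have := continuous_gaussianRBF σ
    fun_prop
  have hφi : Integrable φ (areaMeasure S) :=
    hφc.integrable_of_hasCompactSupport (HasCompactSupport.of_compactSpace φ)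
  set ε' := ε / (k * A + 1) / 2 with hε'
  have hε'0 : 0 < ε' := by positivity
  obtain ⟨δ₂, hδ₂, hunif⟩ := Metric.uniformContinuous_iff.1
    (CompactSpace.uniformContinuous_of_continuous hφc) ε' hε'0
  obtain ⟨δ₁, hδ₁, hnull⟩ := hS.exists_areaMeasure_bisector hSc
  refine ⟨min δ₁ δ₂, by positivity, fun δ hδ hlt I X hinj hX => ?_⟩
  have hδ1 : δ ≤ δ₁ := hlt.le.trans (min_le_left _ _)
  have hδ2 : δ < δ₂ := hlt.trans_le (min_le_right _ _)
  have hq := hX.norm_sum_voronoiWeight_sub_integral_le hS hinj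
    (fun x x' hxx' => by
      refine measure_mono_null ?_ (hnull x x' hxx')
      rintro y ⟨h1, h2⟩
      exact ⟨h1.trans (ENNReal.ofReal_le_ofReal hδ1), h2⟩)
    hφi (ε := ε') (fun y z hyz => by
      have h1 := (edist_le_intrinsicDist S y z).trans hyz
      rw [edist_dist, ENNReal.ofReal_le_ofReal_iff hδ.le] at h1
      have h2 := hunif (h1.trans_lt hδ2)
      rw [dist_eq_norm, norm_sub_rev] at h2
      exact h2.le)
  have e : gaussianCloudExtend σ X (restrictTo X f) x - surfaceExtend σ f x
      = k • (∑ i, voronoiWeight S X i • φ (X i) - ∫ y, φ y ∂(areaMeasure S)) := by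
    rw [smul_sub, Finset.smul_sum]
    simp only [gaussianCloudExtend, cloudExtend, surfaceExtend, restrictTo, φ, smul_smul, hk,
      mul_assoc]
  rw [e, norm_smul, Real.norm_of_nonneg hk0]
  calc k * _ ≤ k * (ε' * A) := by gcongr
    _ = ε / 2 * (k * A / (k * A + 1)) := by rw [hε']; field_simp
    _ ≤ ε / 2 * 1 := by
        gcongr
        rw [div_le_one (by positivity)]
        linarith
    _ < ε := by linarith

/-! ### Gaussian moments and comparison of measures -/

section GaussianMoments

theorem integrable_exp_neg_mul_norm_sq {b : ℝ} (hb : 0 < b) :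
    Integrable fun q : Plane => Real.exp (-b * ‖q‖ ^ 2) := by
  have h := (GaussianFourier.integrable_cexp_neg_mul_sq_norm_add (V := Plane) (b := (b : ℂ))
    (by simpa using hb) 0 0).re
  refine h.congr (ae_of_all _ fun q => ?_)
  have : (-(b : ℂ) * (‖q‖ : ℂ) ^ 2 + 0 * ((inner ℝ (0 : Plane) q : ℝ) : ℂ))
    = ((-b * ‖q‖ ^ 2 : ℝ) : ℂ) := by push_cast; ring
  simp only [this]
  exact Complex.exp_ofReal_re _

theorem integrable_norm_pow_mul_exp (k : ℕ) :
    Integrable fun q : Plane => ‖q‖ ^ k * Real.exp (-‖q‖ ^ 2 / 2) := by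
  have h := (integrable_exp_neg_mul_norm_sq (b := 1 / 4) (by norm_num)).const_mul
    ((4 : ℝ) ^ k * k.factorial * Real.exp (1 / 4))
  refine h.mono' (Continuous.aestronglyMeasurable (by fun_prop)) (ae_of_all _ fun q => ?_)
  rw [Real.norm_of_nonneg (by positivity)]
  have h1 : ‖q‖ ^ k ≤ (4 : ℝ) ^ k * ((1 + ‖q‖ ^ 2) / 4) ^ k := by
    rw [← mul_pow]
    gcongr
    nlinarith [sq_nonneg (‖q‖ - 1)]
  have h2 : ((1 + ‖q‖ ^ 2) / 4) ^ k ≤ k.factorial * Real.exp ((1 + ‖q‖ ^ 2) / 4) := by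
    have := Real.pow_div_factorial_le_exp ((1 + ‖q‖ ^ 2) / 4) (by positivity) k
    rwa [div_le_iff₀ (by positivity), mul_comm] at this
  calc ‖q‖ ^ k * Real.exp (-‖q‖ ^ 2 / 2)
      ≤ (4 : ℝ) ^ k * (k.factorial * Real.exp ((1 + ‖q‖ ^ 2) / 4)) * Real.exp (-‖q‖ ^ 2 / 2) := by
        gcongr
        exact h1.trans (by gcongr)
    _ = (4 : ℝ) ^ k * k.factorial * (Real.exp ((1 + ‖q‖ ^ 2) / 4) * Real.exp (-‖q‖ ^ 2 / 2)) := by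
        ring
    _ = (4 : ℝ) ^ k * k.factorial * (Real.exp (1 / 4) * Real.exp (-(1 / 4) * ‖q‖ ^ 2)) := by
        rw [← Real.exp_add, ← Real.exp_add]
        ring_nf
    _ = _ := by ring

theorem integral_exp_neg_norm_sq : ∫ q : Plane, Real.exp (-‖q‖ ^ 2 / 2) = 2 * Real.pi := by
  have h := GaussianFourier.integral_rexp_neg_mul_sq_norm (V := Plane) (b := 1 / 2) (by norm_num)
  have e : ∀ q : Plane, -‖q‖ ^ 2 / 2 = -(1 / 2) * ‖q‖ ^ 2 := fun q => by ring
  simp only [e]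
  rw [h]
  simp
  ring

theorem integral_exp_neg_sq_div_two : ∫ t : ℝ, Real.exp (-t ^ 2 / 2) = √(2 * Real.pi) := by
  have h := integral_gaussian (1 / 2)
  have e : ∀ t : ℝ, -t ^ 2 / 2 = -(1 / 2) * t ^ 2 := fun t => by ring
  simp only [e]
  rw [h]
  congr 1
  ring

theorem integral_mul_exp_neg_sq_div_two : ∫ t : ℝ, t * Real.exp (-t ^ 2 / 2) = 0 := by
  have h := integral_neg_eq_self (fun t : ℝ => t * Real.exp (-t ^ 2 / 2)) volume
  simp only [neg_sq, neg_mul, integral_neg] at h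
  linarith

theorem integral_sq_mul_exp_neg_sq_div_two :
    ∫ t : ℝ, t ^ 2 * Real.exp (-t ^ 2 / 2) = √(2 * Real.pi) := by
  have h := ProbabilityTheory.variance_id_gaussianReal (μ := 0) (v := 1)
  rw [ProbabilityTheory.variance_of_integral_eq_zero (by fun_prop) (by simp)] at h
  rw [ProbabilityTheory.integral_gaussianReal_eq_integral_smul (by norm_num)] at h
  have hpos : 0 < √(2 * Real.pi) := by positivity
  have e : ∀ t : ℝ, ProbabilityTheory.gaussianPDFReal 0 1 t • (id t) ^ 2
      = (√(2 * Real.pi))⁻¹ * (t ^ 2 * Real.exp (-t ^ 2 / 2)) := by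
    intro t
    simp [ProbabilityTheory.gaussianPDFReal]
    ring
  simp only [e, integral_const_mul] at h
  rw [inv_mul_eq_iff_eq_mul₀ hpos.ne'] at h
  simpa using h

theorem integral_plane_mul (f g : ℝ → ℝ) :
    ∫ q : Plane, f (q 0) * g (q 1) = (∫ t, f t) * ∫ t, g t := by
  have h1 := (PiLp.volume_preserving_ofLp (Fin 2)).integral_comp
    (MeasurableEquiv.toLp 2 (Fin 2 → ℝ)).symm.measurableEmbedding
    (fun z : Fin 2 → ℝ => f (z 0) * g (z 1))
  have h2 := integral_fintype_prod_volume_eq_prod (ι := Fin 2) (fun i => ![f, g] i)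
  simp only [Fin.prod_univ_two, Matrix.cons_val_zero, Matrix.cons_val_one] at h2
  rw [← h2, ← h1]

/-- The second moments of the standard Gaussian in the plane. -/
theorem integral_bilinear_mul_exp (B : Plane →L[ℝ] Plane →L[ℝ] ℝ) :
    ∫ q : Plane, B q q * Real.exp (-‖q‖ ^ 2 / 2)
      = 2 * Real.pi * (B (EuclideanSpace.single 0 1) (EuclideanSpace.single 0 1)
        + B (EuclideanSpace.single 1 1) (EuclideanSpace.single 1 1)) := by
  set e0 : Plane := EuclideanSpace.single 0 1
  set e1 : Plane := EuclideanSpace.single 1 1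
  have hq : ∀ q : Plane, q = q 0 • e0 + q 1 • e1 := by
    intro q
    ext i
    fin_cases i <;> simp [e0, e1]
  have hexp : ∀ q : Plane, Real.exp (-‖q‖ ^ 2 / 2)
      = Real.exp (-(q 0) ^ 2 / 2) * Real.exp (-(q 1) ^ 2 / 2) := by
    intro q
    rw [← Real.exp_add, EuclideanSpace.norm_sq_eq, Fin.sum_univ_two]
    simp only [Real.norm_eq_abs, sq_abs]
    congr 1
    ring
  have hB : ∀ q : Plane, B q q * Real.exp (-‖q‖ ^ 2 / 2) =
      (B e0 e0 * (((q 0) ^ 2 * Real.exp (-(q 0) ^ 2 / 2)) * Real.exp (-(q 1) ^ 2 / 2))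
      + (B e0 e1 + B e1 e0) *
        ((q 0 * Real.exp (-(q 0) ^ 2 / 2)) * (q 1 * Real.exp (-(q 1) ^ 2 / 2))))
      + B e1 e1 * (Real.exp (-(q 0) ^ 2 / 2) * ((q 1) ^ 2 * Real.exp (-(q 1) ^ 2 / 2))) := by
    intro q
    have : B q q = (q 0) ^ 2 * B e0 e0 + q 0 * q 1 * (B e0 e1 + B e1 e0) + (q 1) ^ 2 * B e1 e1 := by
      conv_lhs => rw [hq q]
      simp only [map_add, map_smul, add_apply, smul_apply, smul_eq_mul]
      ring
    rw [this, hexp]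
    ring
  have hcoord : ∀ (q : Plane) (i : Fin 2), |q i| ≤ ‖q‖ := fun q i => by
    simpa using PiLp.norm_apply_le q i
  have hint : ∀ g : Plane → ℝ, Continuous g → (∀ q, |g q| ≤ ‖q‖ ^ 2) →
      Integrable fun q => g q * Real.exp (-‖q‖ ^ 2 / 2) := by
    intro g hg hle
    refine (integrable_norm_pow_mul_exp 2).mono'
      (Continuous.aestronglyMeasurable (by fun_prop)) (ae_of_all _ fun q => ?_)
    rw [norm_mul, Real.norm_eq_abs, Real.norm_of_nonneg (Real.exp_pos _).le]
    gcongr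
    exact hle q
  have i00 : Integrable fun q : Plane =>
      ((q 0) ^ 2 * Real.exp (-(q 0) ^ 2 / 2)) * Real.exp (-(q 1) ^ 2 / 2) := by
    refine (hint (fun q => (q 0) ^ 2) (by fun_prop) fun q => ?_).congr (ae_of_all _ fun q => ?_)
    · rw [abs_pow]; gcongr; exact hcoord q 0
    · simp only [hexp]; ring
  have i01 : Integrable fun q : Plane =>
      (q 0 * Real.exp (-(q 0) ^ 2 / 2)) * (q 1 * Real.exp (-(q 1) ^ 2 / 2)) := by
    refine (hint (fun q => q 0 * q 1) (by fun_prop) fun q => ?_).congr (ae_of_all _ fun q => ?_)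
    · rw [abs_mul, sq]; gcongr <;> exact hcoord q _
    · simp only [hexp]; ring
  have i11 : Integrable fun q : Plane =>
      Real.exp (-(q 0) ^ 2 / 2) * ((q 1) ^ 2 * Real.exp (-(q 1) ^ 2 / 2)) := by
    refine (hint (fun q => (q 1) ^ 2) (by fun_prop) fun q => ?_).congr (ae_of_all _ fun q => ?_)
    · rw [abs_pow]; gcongr; exact hcoord q 1
    · simp only [hexp]; ring
  have s : √(2 * Real.pi) * √(2 * Real.pi) = 2 * Real.pi := Real.mul_self_sqrt (by positivity)
  simp only [hB]
  have hi := (i00.const_mul (B e0 e0)).add (i01.const_mul (B e0 e1 + B e1 e0))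
  simp only [Pi.add_def] at hi
  rw [integral_add hi (i11.const_mul _),
    integral_add (i00.const_mul _) (i01.const_mul _), integral_const_mul, integral_const_mul,
    integral_const_mul,
    integral_plane_mul (fun t => t ^ 2 * Real.exp (-t ^ 2 / 2)) (fun t => Real.exp (-t ^ 2 / 2)),
    integral_plane_mul (fun t => t * Real.exp (-t ^ 2 / 2)) (fun t => t * Real.exp (-t ^ 2 / 2)),
    integral_plane_mul (fun t => Real.exp (-t ^ 2 / 2)) (fun t => t ^ 2 * Real.exp (-t ^ 2 / 2)),
    integral_exp_neg_sq_div_two, integral_sq_mul_exp_neg_sq_div_two,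
    integral_mul_exp_neg_sq_div_two, s]
  ring

end GaussianMoments

section Scaling

variable {F : Type*} [NormedAddCommGroup F] [NormedSpace ℝ F]

/-- The substitution `p = σ q` in a Gaussian average over a disc. -/
theorem integral_ball_scaling {σ ρ : ℝ} (hσ : 0 < σ) (g : Plane → F) :
    (1 / (2 * Real.pi * σ ^ 2)) • ∫ p in Metric.ball (0 : Plane) ρ, g p
      = (1 / (2 * Real.pi)) •
        ∫ q : Plane, (Metric.ball (0 : Plane) ρ).indicator g (σ • q) := by
  rw [← integral_indicator measurableSet_ball, Measure.integral_comp_smul_of_nonneg _ _ σ (hR := hσ.le)]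
  simp only [finrank_euclideanSpace, Fintype.card_fin, smul_smul]
  congr 1
  field_simp

end Scaling

/-- If `μ` lies between a finite measure `l` and `(1 + k) l`, then integrals for `μ` and `l` differ
by at most the integral of `k` times the norm. -/
theorem norm_integral_sub_integral_le_of_le_withDensity {α F : Type*} [MeasurableSpace α]
    [NormedAddCommGroup F] [NormedSpace ℝ F] {l μ : Measure α} [IsFiniteMeasure l] (h1 : l ≤ μ)
    {k : α → ℝ} (hk0 : ∀ a, 0 ≤ k a) (hk : Measurable k)
    (h2 : μ ≤ l.withDensity fun a => ENNReal.ofReal (1 + k a)) {f : α → F}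
    (hf : Integrable f μ) (hfk : Integrable (fun a => k a * ‖f a‖) l) :
    ‖∫ a, f a ∂μ - ∫ a, f a ∂l‖ ≤ ∫ a, k a * ‖f a‖ ∂l := by
  set ν := μ - l with hν
  have hμ : μ = ν + l := (Measure.sub_add_cancel_of_le h1).symm
  set κ := l.withDensity fun a => ENNReal.ofReal (k a) with hκ
  have hνμ : ν ≤ μ := by rw [hμ]; exact Measure.le_add_right le_rfl
  have hνκ : ν ≤ κ := by
    refine Measure.le_iff.2 fun s hs => ?_
    have h3 := Measure.le_iff.1 h2 s hs
    have h4 : (l.withDensity fun a => ENNReal.ofReal (1 + k a)) s = κ s + l s := by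
      have : (fun a => ENNReal.ofReal (1 + k a)) = (fun a => ENNReal.ofReal (k a)) + 1 := by
        ext a
        rw [add_comm, ENNReal.ofReal_add (hk0 a) zero_le_one]
        simp
      rw [this, withDensity_add_left hk.ennreal_ofReal, withDensity_one, Measure.add_apply]
    rw [h4, hμ, Measure.add_apply] at h3
    exact (ENNReal.add_le_add_iff_right (measure_ne_top l s)).1 h3
  have hfν : Integrable f ν := hf.mono_measure hνμ
  have hfl : Integrable f l := hf.mono_measure h1
  have hkm : ∀ᵐ a ∂l, ENNReal.ofReal (k a) < ⊤ := ae_of_all _ fun _ => ENNReal.ofReal_lt_top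
  have hfκ : Integrable (fun a => ‖f a‖) κ := by
    rw [hκ, integrable_withDensity_iff_integrable_smul' hk.ennreal_ofReal hkm]
    simpa [ENNReal.toReal_ofReal (hk0 _)] using hfk
  have e : ∫ a, f a ∂μ - ∫ a, f a ∂l = ∫ a, f a ∂ν := by
    conv_lhs => rw [hμ]
    rw [integral_add_measure hfν hfl, add_sub_cancel_right]
  rw [e]
  calc ‖∫ a, f a ∂ν‖ ≤ ∫ a, ‖f a‖ ∂ν := norm_integral_le_integral_norm _
    _ ≤ ∫ a, ‖f a‖ ∂κ := integral_mono_measure hνκ (ae_of_all _ fun _ => norm_nonneg _) hfκ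
    _ = ∫ a, k a * ‖f a‖ ∂l := by
      rw [hκ, integral_withDensity_eq_integral_toReal_smul hk.ennreal_ofReal hkm]
      simp [ENNReal.toReal_ofReal (hk0 _)]

/-! ### The area element over the tangent plane -/

namespace MongeChart

variable {S : Set E3} {x₀ : E3} (c : MongeChart S x₀)

theorem continuous_proj : Continuous c.proj := by
  unfold proj
  fun_prop

/-- The part of `S` that is the graph over the disc of radius `r / 2`. -/
def patch : Set S := {y | ‖(y : E3) - x₀‖ < c.r ∧ ‖c.proj y‖ < c.r / 2}

theorem isOpen_patch : IsOpen c.patch := by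
  have := c.continuous_proj
  have h1 : IsOpen {y : S | ‖(y : E3) - x₀‖ < c.r} := isOpen_lt (by fun_prop) continuous_const
  have h2 : IsOpen {y : S | ‖c.proj y‖ < c.r / 2} := isOpen_lt (by fun_prop) continuous_const
  exact h1.inter h2

theorem le_norm_of_notMem_patch {y : S} (hy : y ∉ c.patch) : c.r / 2 ≤ ‖(y : E3) - x₀‖ := by
  by_contra! h
  exact hy ⟨by linarith [c.r_pos], (c.norm_proj_le y).trans_lt h⟩

/-- The area measure of the surface near `x₀`, pushed to the tangent plane. -/
noncomputable def planeMeasure : Measure Plane :=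
  ((areaMeasure S).restrict c.patch).map fun y : S => c.proj y

theorem measurable_proj_coe : Measurable fun y : S => c.proj y :=
  (c.continuous_proj.comp continuous_subtype_val).measurable

theorem planeMeasure_apply {A : Set Plane} (hA : MeasurableSet A) :
    c.planeMeasure A = μHE[2] (c.G '' (A ∩ Metric.ball 0 (c.r / 2))) := by
  rw [planeMeasure, Measure.map_apply c.measurable_proj_coe hA,
    Measure.restrict_apply (c.measurable_proj_coe hA), areaMeasure_apply]
  congr 1
  ext y
  constructor
  · rintro ⟨y, ⟨hyA, hy1, hy2⟩, rfl⟩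
    exact ⟨c.proj y, ⟨hyA, by simpa using hy2⟩, c.G_proj y.2 hy1⟩
  · rintro ⟨p, ⟨hpA, hp⟩, rfl⟩
    rw [mem_ball_zero_iff] at hp
    refine ⟨⟨c.G p, c.G_mem hp.le⟩, ⟨?_, c.norm_G_sub_base_lt hp.le, ?_⟩, rfl⟩
    · simpa [c.proj_G] using hpA
    · simpa [c.proj_G] using hp

theorem volume_restrict_le_planeMeasure :
    volume.restrict (Metric.ball 0 (c.r / 2)) ≤ c.planeMeasure := by
  refine Measure.le_iff.2 fun A hA => ?_
  rw [c.planeMeasure_apply hA, Measure.restrict_apply hA]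
  exact c.volume_le_area_image_G _

/-- The area element at `p` is at most `1 + 4 M² |p|²`. The constant comes from the decomposition
of the disc into dyadic annuli, on each of which the Lipschitz constant of the graph is compared
with the value of the density at the inner radius. -/
theorem planeMeasure_le :
    c.planeMeasure ≤ (volume.restrict (Metric.ball 0 (c.r / 2))).withDensity
      fun p => ENNReal.ofReal (1 + 4 * c.M ^ 2 * ‖p‖ ^ 2) := by
  set ρ := c.r / 2 with hρ
  have hρ0 : 0 < ρ := by have := c.r_pos; positivity
  let E : ℕ → Set Plane := fun k => {p | (1 / 2 : ℝ) ^ (k + 1) * ρ < ‖p‖ ∧ ‖p‖ ≤ (1 / 2) ^ k * ρ}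
  have hE : ∀ k, MeasurableSet (E k) := fun k =>
    (measurableSet_lt measurable_const measurable_norm).inter
      (measurableSet_le measurable_norm measurable_const)
  have hdisj : Pairwise (Function.onFun Disjoint E) := by
    refine (pairwise_disjoint_on E).2 fun j k hjk => Set.disjoint_left.2 ?_
    rintro p ⟨h1, -⟩ ⟨-, h2⟩
    have : (1 / 2 : ℝ) ^ k ≤ (1 / 2) ^ (j + 1) :=
      pow_le_pow_of_le_one (by norm_num) (by norm_num) hjk
    have := mul_le_mul_of_nonneg_right this hρ0.le
    linarith
  refine Measure.le_iff.2 fun A hA => ?_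
  set ν := (volume.restrict (Metric.ball 0 ρ)).withDensity
      fun p : Plane => ENNReal.ofReal (1 + 4 * c.M ^ 2 * ‖p‖ ^ 2) with hν
  have hcover : c.planeMeasure A ≤ c.planeMeasure {0} + c.planeMeasure (⋃ k, A ∩ E k) := by
    have hout : c.planeMeasure (Metric.ball 0 ρ)ᶜ = 0 := by
      rw [c.planeMeasure_apply measurableSet_ball.compl, Set.compl_inter_self]
      simp
    calc c.planeMeasure A
        ≤ c.planeMeasure ((Metric.ball 0 ρ)ᶜ ∪ ({0} ∪ ⋃ k, A ∩ E k)) := by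
          refine measure_mono fun p hp => ?_
          by_cases hpb : p ∈ Metric.ball 0 ρ
          · right
            by_cases hp0 : p = 0
            · exact Or.inl hp0
            · right
              rw [mem_ball_zero_iff] at hpb
              obtain ⟨k, hk1, hk2⟩ := exists_nat_pow_near_of_lt_one (x := ‖p‖ / ρ) (y := 1 / 2)
                (div_pos (norm_pos_iff.2 hp0) hρ0) ((div_le_one hρ0).2 hpb.le)
                (by norm_num) (by norm_num)
              exact Set.mem_iUnion.2 ⟨k, hp, (lt_div_iff₀ hρ0).1 hk1, (div_le_iff₀ hρ0).1 hk2⟩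
          · exact Or.inl hpb
      _ ≤ c.planeMeasure (Metric.ball 0 ρ)ᶜ + c.planeMeasure ({0} ∪ ⋃ k, A ∩ E k) :=
          measure_union_le _ _
      _ ≤ _ := by
          rw [hout, zero_add]
          exact measure_union_le _ _
  have h0 : c.planeMeasure {0} = 0 := by
    rw [c.planeMeasure_apply (measurableSet_singleton _)]
    refine le_antisymm ((c.area_image_G_le (R := ρ)
      (Set.inter_subset_right.trans Metric.ball_subset_closedBall)).trans ?_) zero_le
    rw [measure_mono_null Set.inter_subset_left (measure_singleton _), mul_zero]
  have hk : ∀ k, c.planeMeasure (A ∩ E k) ≤ ν (A ∩ E k) := by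
    intro k
    have hAE := hA.inter (hE k)
    rw [c.planeMeasure_apply hAE, hν, withDensity_apply _ hAE, Measure.restrict_restrict hAE]
    refine (c.area_image_G_le (R := (1 / 2) ^ k * ρ)
      fun p hp => mem_closedBall_zero_iff.2 hp.1.2.2).trans ?_
    rw [← setLIntegral_const]
    refine setLIntegral_mono' (hAE.inter measurableSet_ball) fun p hp => ?_
    refine ENNReal.ofReal_le_ofReal ?_
    have h1 := hp.1.2.1
    have h2 : (1 / 2 : ℝ) ^ k * ρ ≤ 2 * ‖p‖ := by rw [pow_succ] at h1; linarith
    have h3 := pow_le_pow_left₀ (by positivity) h2 2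
    have h4 := mul_le_mul_of_nonneg_left h3 (sq_nonneg c.M)
    rw [mul_pow c.M]
    linarith
  calc c.planeMeasure A ≤ c.planeMeasure (⋃ k, A ∩ E k) := by rw [h0, zero_add] at hcover; exact hcover
    _ ≤ ∑' k, c.planeMeasure (A ∩ E k) := measure_iUnion_le _
    _ ≤ ∑' k, ν (A ∩ E k) := ENNReal.tsum_le_tsum hk
    _ = ν (⋃ k, A ∩ E k) := by
        rw [measure_iUnion (fun i j hij => (hdisj hij).mono Set.inter_subset_right
          Set.inter_subset_right) fun k => hA.inter (hE k)]
    _ ≤ ν A := measure_mono (Set.iUnion_subset fun k => Set.inter_subset_left)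

theorem setIntegral_patch {F : Type*} [NormedAddCommGroup F] [NormedSpace ℝ F] {φ : E3 → F}
    (hφ : Continuous φ) :
    ∫ y in c.patch, φ y ∂(areaMeasure S) = ∫ p, φ (c.G p) ∂c.planeMeasure := by
  have hc : Continuous fun p => φ (c.G p) := hφ.comp c.continuous_G
  rw [planeMeasure, integral_map c.measurable_proj_coe.aemeasurable hc.aestronglyMeasurable]
  refine setIntegral_congr_fun c.isOpen_patch.measurableSet fun y hy => ?_
  simp only [c.G_proj y.2 hy.1]

theorem _root_.Continuous.integrableOn_plane_ball {V : Type*} [NormedAddCommGroup V]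
    {g : Plane → V} (hg : Continuous g) (ρ : ℝ) : IntegrableOn g (Metric.ball 0 ρ) :=
  (hg.continuousOn.integrableOn_compact (isCompact_closedBall 0 ρ)).mono_set
    Metric.ball_subset_closedBall

/-- The integral over the patch is compared with the integral over the disc in the tangent
plane. -/
theorem norm_setIntegral_patch_sub_le {F : Type*} [NormedAddCommGroup F] [NormedSpace ℝ F]
    {φ : E3 → F} (hφ : Continuous φ) :
    ‖∫ y in c.patch, φ y ∂(areaMeasure S) - ∫ p in Metric.ball 0 (c.r / 2), φ (c.G p)‖
      ≤ ∫ p in Metric.ball 0 (c.r / 2), (4 * c.M ^ 2 * ‖p‖ ^ 2) * ‖φ (c.G p)‖ := by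
  set l : Measure Plane := volume.restrict (Metric.ball 0 (c.r / 2)) with hl
  have : IsFiniteMeasure l := ⟨by rw [hl, Measure.restrict_apply_univ]; exact measure_ball_lt_top⟩
  have hcont := c.continuous_G
  rw [c.setIntegral_patch hφ]
  refine norm_integral_sub_integral_le_of_le_withDensity c.volume_restrict_le_planeMeasure
    (k := fun p => 4 * c.M ^ 2 * ‖p‖ ^ 2) (fun p => by positivity) (by fun_prop)
    c.planeMeasure_le ?_ (Continuous.integrableOn_plane_ball (by fun_prop) _)
  refine Integrable.mono_measure ?_ c.planeMeasure_le
  rw [integrable_withDensity_iff_integrable_smul' (by fun_prop)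
    (ae_of_all _ fun _ => ENNReal.ofReal_lt_top)]
  refine Continuous.integrableOn_plane_ball ?_ _
  have : ∀ p : Plane, (ENNReal.ofReal (1 + 4 * c.M ^ 2 * ‖p‖ ^ 2)).toReal
      = 1 + 4 * c.M ^ 2 * ‖p‖ ^ 2 := fun p => ENNReal.toReal_ofReal (by positivity)
  simp only [this]
  fun_prop

end MongeChart

/-! ### Gaussian averages over the surface and the tangent plane -/

theorem tendsto_inv_pow_mul_exp_neg_div_sq {a : ℝ} (ha : 0 < a) (n : ℕ) :
    Tendsto (fun σ : ℝ => ((σ ^ 2)⁻¹) ^ n * Real.exp (-a / σ ^ 2)) (𝓝[>] 0) (𝓝 0) := by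
  have h1 : Tendsto (fun σ : ℝ => a * (σ ^ 2)⁻¹) (𝓝[>] 0) atTop := by
    refine Tendsto.const_mul_atTop ha (Tendsto.comp tendsto_inv_nhdsGT_zero ?_)
    refine tendsto_nhdsWithin_iff.2 ⟨?_, ?_⟩
    · exact ((continuous_pow 2).tendsto' (0 : ℝ) 0 (by norm_num)).mono_left nhdsWithin_le_nhds
    · filter_upwards [self_mem_nhdsWithin] with σ hσ
      exact pow_pos (Set.mem_Ioi.1 hσ) 2
  have h2 := ((Real.tendsto_pow_mul_exp_neg_atTop_nhds_zero n).comp h1).const_mul ((a ^ n)⁻¹)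
  rw [mul_zero] at h2
  refine h2.congr fun σ => ?_
  simp only [Function.comp_apply]
  rw [mul_pow, ← mul_assoc, ← mul_assoc, inv_mul_cancel₀ (by positivity), one_mul, neg_div,
    div_eq_mul_inv]

theorem gaussianRBF_pos (σ r : ℝ) : 0 < gaussianRBF σ r := Real.exp_pos _

theorem gaussianRBF_le_of_le {σ r s : ℝ} (hr : 0 ≤ r) (h : r ≤ s) :
    gaussianRBF σ s ≤ gaussianRBF σ r := by
  unfold gaussianRBF
  refine Real.exp_le_exp.2 ?_
  gcongr

namespace MongeChart

variable {S : Set E3} {x₀ : E3} (c : MongeChart S x₀)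

theorem norm_le_norm_G_sub_base (p : Plane) : ‖p‖ ≤ ‖c.G p - x₀‖ := by
  have := c.norm_G_sub_base_sq p
  exact le_of_pow_le_pow_left₀ two_ne_zero (norm_nonneg _) (by nlinarith)

theorem norm_G_sub_base_le {p : Plane} (hp : ‖p‖ ≤ c.r / 2) : ‖c.G p - x₀‖ ≤ 2 * ‖p‖ := by
  have h1 := c.norm_G_sub_base_sq p
  have h2 : |c.h p| ≤ ‖p‖ := by
    refine (c.abs_h_le p).trans ?_
    have : c.M * ‖p‖ ≤ 1 := by
      have := mul_le_mul_of_nonneg_left hp c.M_nonneg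
      linarith [c.M_mul_r_le]
    nlinarith [norm_nonneg p]
  have h3 : c.h p ^ 2 ≤ ‖p‖ ^ 2 := sq_le_sq' (by linarith [abs_le.1 h2]) (abs_le.1 h2).2
  refine le_of_pow_le_pow_left₀ two_ne_zero (by positivity) ?_
  nlinarith [norm_nonneg p]

/-- For integrands of Gaussian type, the average over the surface is asymptotic to the average over
a disc in the tangent plane: the rest of the surface contributes exponentially little, and the area
element of the graph differs from that of the plane by `O(|p|²)`. -/
theorem tendsto_average_sub_average (hSc : IsCompact S) (hS : IsSmoothSurface S)
    {F : Type*} [NormedAddCommGroup F] [NormedSpace ℝ F] {φ : ℝ → E3 → F} {j : ℕ} (hj : j ≤ 1)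
    (hφ : ∀ σ > 0, Continuous (φ σ))
    (hle : ∀ σ > 0, ∀ y, ‖φ σ y‖ ≤ (‖y - x₀‖ / σ ^ 2) ^ j * gaussianRBF σ ‖x₀ - y‖) :
    Tendsto (fun σ => (1 / (2 * Real.pi * σ ^ 2)) • ∫ y : S, φ σ y ∂(areaMeasure S)
      - (1 / (2 * Real.pi * σ ^ 2)) • ∫ p in Metric.ball 0 (c.r / 2), φ σ (c.G p))
      (𝓝[>] 0) (𝓝 0) := by
  have := isFiniteMeasure_areaMeasure hSc hS
  have : CompactSpace S := isCompact_iff_compactSpace.1 hSc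
  have hr := c.r_pos
  set ρ := c.r / 2 with hρ
  have hρ0 : 0 < ρ := by positivity
  obtain ⟨D, hD⟩ := hSc.isBounded.exists_norm_le
  set D' := D + ‖x₀‖ with hD'
  have hDS : ∀ y : S, ‖(y : E3) - x₀‖ ≤ D' := fun y =>
    (norm_sub_le _ _).trans (by linarith [hD y y.2])
  set area := (areaMeasure S).real c.patchᶜ with harea
  set m : ℝ := ∫ q : Plane, ‖q‖ ^ (j + 2) * Real.exp (-‖q‖ ^ 2 / 2) with hm
  have hbound : Tendsto (fun σ : ℝ => 1 / (2 * Real.pi) * (area * D' ^ j) *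
      (((σ ^ 2)⁻¹) ^ (j + 1) * Real.exp (-(ρ ^ 2 / 2) / σ ^ 2))
      + 1 / (2 * Real.pi) * (4 * c.M ^ 2 * 2 ^ j * m) * σ ^ (2 - j)) (𝓝[>] 0) (𝓝 0) := by
    have h1 := (tendsto_inv_pow_mul_exp_neg_div_sq (a := ρ ^ 2 / 2) (by positivity)
      (j + 1)).const_mul (1 / (2 * Real.pi) * (area * D' ^ j))
    have h2 : Tendsto (fun σ : ℝ => 1 / (2 * Real.pi) * (4 * c.M ^ 2 * 2 ^ j * m) * σ ^ (2 - j))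
        (𝓝[>] 0) (𝓝 0) := by
      refine (Continuous.tendsto' (by fun_prop) (0 : ℝ) 0 ?_).mono_left nhdsWithin_le_nhds
      rw [zero_pow (by omega), mul_zero]
    simpa using h1.add h2
  refine squeeze_zero_norm' ?_ hbound
  filter_upwards [self_mem_nhdsWithin] with σ hσ
  have hσ : 0 < σ := hσ
  have hc := hφ σ hσ
  have hint : Integrable (fun y : S => φ σ y) (areaMeasure S) :=
    Continuous.integrable_of_hasCompactSupport (by fun_prop) (HasCompactSupport.of_compactSpace _)
  rw [← integral_add_compl c.isOpen_patch.measurableSet hint, ← smul_sub, add_sub_right_comm,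
    add_comm, norm_smul, Real.norm_of_nonneg (by positivity)]
  have htail : ‖∫ y in c.patchᶜ, φ σ y ∂(areaMeasure S)‖
      ≤ (D' / σ ^ 2) ^ j * Real.exp (-(ρ ^ 2 / 2) / σ ^ 2) * area := by
    refine norm_setIntegral_le_of_norm_le_const (measure_lt_top _ _) fun y hy => ?_
    refine (hle σ hσ y).trans ?_
    have h1 := c.le_norm_of_notMem_patch hy
    have h2 := hDS y
    have h3 : gaussianRBF σ ‖x₀ - y‖ ≤ Real.exp (-(ρ ^ 2 / 2) / σ ^ 2) := by
      rw [norm_sub_rev]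
      refine (gaussianRBF_le_of_le hρ0.le h1).trans_eq ?_
      rw [gaussianRBF]
      congr 1
      field_simp
    have h4 := (norm_nonneg _).trans h2
    gcongr
    exact (gaussianRBF_pos _ _).le
  have hchart := c.norm_setIntegral_patch_sub_le hc
  have hmain : ∫ p in Metric.ball 0 ρ, (4 * c.M ^ 2 * ‖p‖ ^ 2) * ‖φ σ (c.G p)‖
      ≤ 4 * c.M ^ 2 * 2 ^ j * m * σ ^ (2 - j) * σ ^ 2 := by
    have e : ∀ q : Plane, ((4 * c.M ^ 2 * 2 ^ j) * σ ^ (2 - j)) *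
        (‖σ⁻¹ • q‖ ^ (j + 2) * Real.exp (-‖σ⁻¹ • q‖ ^ 2 / 2))
        = (4 * c.M ^ 2 * ‖q‖ ^ 2) * ((2 * ‖q‖ / σ ^ 2) ^ j * gaussianRBF σ ‖q‖) := by
      intro q
      rw [norm_smul, norm_inv, Real.norm_of_nonneg hσ.le, gaussianRBF]
      have e1 : -(σ⁻¹ * ‖q‖) ^ 2 / 2 = -‖q‖ ^ 2 / (2 * σ ^ 2) := by field_simp
      rw [e1]
      obtain rfl | rfl : j = 0 ∨ j = 1 := by omega
      · simp; field_simp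
      · simp; field_simp
    have hs := Measure.integral_comp_inv_smul_of_nonneg (volume : Measure Plane)
      (fun q => ((4 * c.M ^ 2 * 2 ^ j) * σ ^ (2 - j)) *
        (‖q‖ ^ (j + 2) * Real.exp (-‖q‖ ^ 2 / 2))) hσ.le
    have hi : Integrable fun q : Plane => ((4 * c.M ^ 2 * 2 ^ j) * σ ^ (2 - j)) *
        (‖σ⁻¹ • q‖ ^ (j + 2) * Real.exp (-‖σ⁻¹ • q‖ ^ 2 / 2)) :=
      (((integrable_norm_pow_mul_exp (j + 2)).comp_smul (inv_ne_zero hσ.ne')).const_mul _)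
    rw [integral_const_mul _ fun q : Plane => ‖q‖ ^ (j + 2) * Real.exp (-‖q‖ ^ 2 / 2)] at hs
    simp only [e] at hs hi
    rw [finrank_euclideanSpace, Fintype.card_fin, smul_eq_mul] at hs
    calc _ ≤ ∫ p in Metric.ball (0 : Plane) ρ,
          (4 * c.M ^ 2 * ‖p‖ ^ 2) * ((2 * ‖p‖ / σ ^ 2) ^ j * gaussianRBF σ ‖p‖) := by
          refine setIntegral_mono_on ?_ hi.integrableOn measurableSet_ball fun p hp => ?_
          · have := c.continuous_G
            exact Continuous.integrableOn_plane_ball (by fun_prop) _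
          · rw [mem_ball_zero_iff] at hp
            refine mul_le_mul_of_nonneg_left ((hle σ hσ _).trans ?_) (by positivity)
            have h1 := c.norm_G_sub_base_le hp.le
            have h2 : gaussianRBF σ ‖x₀ - c.G p‖ ≤ gaussianRBF σ ‖p‖ := by
              rw [norm_sub_rev]
              exact gaussianRBF_le_of_le (norm_nonneg _) (c.norm_le_norm_G_sub_base p)
            gcongr
            exact (gaussianRBF_pos _ _).le
      _ ≤ ∫ p : Plane, (4 * c.M ^ 2 * ‖p‖ ^ 2) * ((2 * ‖p‖ / σ ^ 2) ^ j * gaussianRBF σ ‖p‖) := by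
          refine setIntegral_le_integral hi (ae_of_all _ fun p => ?_)
          have := (gaussianRBF_pos σ ‖p‖).le
          positivity
      _ = _ := by rw [hs]; ring
  calc 1 / (2 * Real.pi * σ ^ 2) * _
      ≤ 1 / (2 * Real.pi * σ ^ 2) * ((D' / σ ^ 2) ^ j * Real.exp (-(ρ ^ 2 / 2) / σ ^ 2) * area
        + 4 * c.M ^ 2 * 2 ^ j * m * σ ^ (2 - j) * σ ^ 2) := by
        gcongr
        exact (norm_add_le _ _).trans (add_le_add htail (hchart.trans hmain))
    _ = _ := by
        rw [div_pow, pow_succ ((σ ^ 2)⁻¹), inv_pow]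
        field_simp

end MongeChart

/-! ### Approximation on the surface and decay off it -/

namespace MongeChart

variable {S : Set E3} {x₀ : E3} (c : MongeChart S x₀)

theorem gaussianRBF_G {σ : ℝ} (hσ : 0 < σ) (q : Plane) :
    gaussianRBF σ ‖x₀ - c.G (σ • q)‖
      = Real.exp (-(c.h (σ • q) / σ) ^ 2 / 2) * Real.exp (-‖q‖ ^ 2 / 2) := by
  rw [gaussianRBF, norm_sub_rev, c.norm_G_sub_base_sq, ← Real.exp_add, norm_smul,
    Real.norm_of_nonneg hσ.le]
  congr 1
  field_simp
  ring

/-- The second order Taylor expansion of the height function along a ray. -/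
theorem tendsto_h_div_sq (q : Plane) :
    Tendsto (fun σ : ℝ => c.h (σ • q) / σ ^ 2) (𝓝[>] 0)
      (𝓝 (fderiv ℝ (fderiv ℝ c.h) 0 q q / 2)) := by
  have hd : ∀ t : ℝ, HasDerivAt (fun t : ℝ => c.h (t • q)) (fderiv ℝ c.h (t • q) q) t := by
    intro t
    simpa using c.hasBoundedDifferences.hasDerivAt_comp_line 0 q t
  have hfc2 : ContDiff ℝ 2 (fderiv ℝ c.h) := c.contDiff_h.fderiv_right (by norm_num)
  have hdd : HasDerivAt (fun t : ℝ => fderiv ℝ c.h (t • q) q) (fderiv ℝ (fderiv ℝ c.h) 0 q q) 0 := by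
    have h1 : HasFDerivAt (fderiv ℝ c.h) (fderiv ℝ (fderiv ℝ c.h) 0) ((0 : ℝ) • q) := by
      rw [zero_smul]
      exact (hfc2.differentiable (by norm_num) 0).hasFDerivAt
    have h2 : HasDerivAt (fun t : ℝ => t • q) q 0 := by
      simpa using (hasDerivAt_id (0 : ℝ)).smul_const q
    have h3 : HasDerivAt (fun t : ℝ => fderiv ℝ c.h (t • q)) (fderiv ℝ (fderiv ℝ c.h) 0 q) 0 :=
      h1.comp_hasDerivAt (0 : ℝ) h2
    exact (ContinuousLinearMap.apply ℝ ℝ q).hasFDerivAt.comp_hasDerivAt (0 : ℝ) h3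
  refine HasDerivAt.lhopital_zero_nhdsGT (f' := fun t => fderiv ℝ c.h (t • q) q)
    (g' := fun t => 2 * t) (Eventually.of_forall hd)
    (Eventually.of_forall fun t => by simpa using hasDerivAt_pow 2 t) ?_ ?_ ?_ ?_
  · filter_upwards [self_mem_nhdsWithin] with t ht
    have := Set.mem_Ioi.1 ht
    positivity
  · refine ((hd 0).continuousAt.tendsto.mono_left nhdsWithin_le_nhds).trans_eq ?_
    simp [c.h_zero]
  · exact (Continuous.tendsto' (by fun_prop) (0 : ℝ) 0 (by norm_num)).mono_left nhdsWithin_le_nhds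
  · have h := (hasDerivAt_iff_tendsto_slope.1 hdd).mono_left
      (nhdsWithin_mono (0 : ℝ) (fun t ht => (ne_of_gt ht : t ≠ 0) : Set.Ioi (0 : ℝ) ⊆ {0}ᶜ))
    refine (h.div_const 2).congr fun t => ?_
    simp only [slope_def_field, zero_smul, c.fderiv_h_zero]
    simp [div_div, mul_comm]

/-- The exponents of the Gaussians on the surface and in the plane are asymptotically equal. -/
theorem tendsto_h_div (q : Plane) :
    Tendsto (fun σ : ℝ => c.h (σ • q) / σ) (𝓝[>] 0) (𝓝 0) := by
  have h1 : Tendsto (fun σ : ℝ => σ) (𝓝[>] 0) (𝓝 0) := tendsto_id.mono_left nhdsWithin_le_nhds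
  have h := (c.tendsto_h_div_sq q).mul h1
  rw [mul_zero] at h
  refine h.congr' ?_
  filter_upwards [self_mem_nhdsWithin] with t ht
  have := (Set.mem_Ioi.1 ht).ne'
  field_simp

theorem eventually_smul_mem_ball (q : Plane) :
    ∀ᶠ σ : ℝ in 𝓝[>] 0, σ • q ∈ Metric.ball (0 : Plane) (c.r / 2) := by
  have hr := c.r_pos
  have : Tendsto (fun σ : ℝ => σ • q) (𝓝[>] 0) (𝓝 0) :=
    (Continuous.tendsto' (by fun_prop) (0 : ℝ) 0 (by simp)).mono_left nhdsWithin_le_nhds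
  exact this.eventually (Metric.ball_mem_nhds 0 (by positivity))

theorem tendsto_exp_h_div (q : Plane) :
    Tendsto (fun σ : ℝ => Real.exp (-(c.h (σ • q) / σ) ^ 2 / 2)) (𝓝[>] 0) (𝓝 1) := by
  have h := ((c.tendsto_h_div q).pow 2).neg.div_const 2
  simpa [Function.comp_def] using (Real.continuous_exp.tendsto _).comp h

/-- The Gaussian average over a disc of the graph, for the area of the plane, tends to `1`. -/
theorem tendsto_disc_average :
    Tendsto (fun σ => (1 / (2 * Real.pi * σ ^ 2)) •
      ∫ p in Metric.ball 0 (c.r / 2), gaussianRBF σ ‖x₀ - c.G p‖) (𝓝[>] 0) (𝓝 1) := by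
  have hG := c.continuous_G
  have key : Tendsto (fun σ => ∫ q : Plane, (Metric.ball (0 : Plane) (c.r / 2)).indicator
      (fun p => gaussianRBF σ ‖x₀ - c.G p‖) (σ • q)) (𝓝[>] 0)
      (𝓝 (∫ q : Plane, Real.exp (-‖q‖ ^ 2 / 2))) := by
    refine tendsto_integral_filter_of_dominated_convergence
      (fun q => Real.exp (-‖q‖ ^ 2 / 2)) ?_ ?_ (by simpa using integrable_norm_pow_mul_exp 0) ?_
    · filter_upwards with σ
      have h1 : Measurable fun p => gaussianRBF σ ‖x₀ - c.G p‖ :=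
        ((continuous_gaussianRBF σ).comp (by fun_prop)).measurable
      exact ((h1.indicator measurableSet_ball).comp (measurable_const_smul σ)).aestronglyMeasurable
    · filter_upwards [self_mem_nhdsWithin] with σ hσ
      filter_upwards with q
      refine (norm_indicator_le_norm_self _ _).trans ?_
      rw [Real.norm_of_nonneg (gaussianRBF_pos _ _).le, c.gaussianRBF_G hσ]
      refine mul_le_of_le_one_left (Real.exp_pos _).le (Real.exp_le_one_iff.2 ?_)
      have := sq_nonneg (c.h (σ • q) / σ)
      linarith
    · filter_upwards with q
      have h := (c.tendsto_exp_h_div q).mul_const (Real.exp (-‖q‖ ^ 2 / 2))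
      rw [one_mul] at h
      refine h.congr' ?_
      filter_upwards [self_mem_nhdsWithin, c.eventually_smul_mem_ball q] with σ hσ hq
      rw [Set.indicator_of_mem hq, c.gaussianRBF_G hσ]
  have h := key.const_mul (1 / (2 * Real.pi))
  rw [integral_exp_neg_norm_sq, one_div_mul_cancel (by positivity)] at h
  refine h.congr' ?_
  filter_upwards [self_mem_nhdsWithin] with σ hσ
  rw [integral_ball_scaling hσ, smul_eq_mul]

end MongeChart

section Approximation

variable {S : Set E3}

/-- The Gaussian average over the surface, at a point of the surface, tends to `1`. -/
theorem tendsto_gaussian_average (hSc : IsCompact S) (hS : IsSmoothSurface S) {x₀ : E3}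
    (hx₀ : x₀ ∈ S) :
    Tendsto (fun σ => (1 / (2 * Real.pi * σ ^ 2)) •
      ∫ y : S, gaussianRBF σ ‖x₀ - y‖ ∂(areaMeasure S)) (𝓝[>] 0) (𝓝 1) := by
  obtain ⟨c⟩ := hS.nonempty_mongeChart hx₀
  have h := c.tendsto_average_sub_average hSc hS (j := 0) zero_le_one
    (φ := fun σ y => gaussianRBF σ ‖x₀ - y‖)
    (fun σ _ => (continuous_gaussianRBF σ).comp (by fun_prop))
    (fun σ _ y => by simp [abs_of_pos (gaussianRBF_pos _ _)])
  simpa using h.add c.tendsto_disc_average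

/-- A bound for the normalised Gaussian that is uniform at distances at least `d`. -/
theorem inv_mul_gaussianRBF_le {d σ t : ℝ} (hd : 0 ≤ d) (h : d ≤ t) :
    1 / (2 * Real.pi * σ ^ 2) * gaussianRBF σ t
      ≤ 1 / (2 * Real.pi) * (((σ ^ 2)⁻¹) ^ 1 * Real.exp (-(d ^ 2 / 2) / σ ^ 2)) := by
  have h1 : gaussianRBF σ t ≤ Real.exp (-(d ^ 2 / 2) / σ ^ 2) := by
    refine (gaussianRBF_le_of_le hd h).trans_eq ?_
    rw [gaussianRBF]
    congr 1
    rw [neg_div, neg_div, div_div]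
  calc _ ≤ 1 / (2 * Real.pi * σ ^ 2) * Real.exp (-(d ^ 2 / 2) / σ ^ 2) := by gcongr
    _ = _ := by rw [pow_one, one_div, mul_inv, one_div]; ring

variable {F : Type*} [NormedAddCommGroup F] [NormedSpace ℝ F]

/-- The Gaussian is an approximate identity on the surface. -/
theorem surfaceExtend_tendsto_of_mem [CompleteSpace F] (hSc : IsCompact S)
    (hS : IsSmoothSurface S) (f : C(S, F)) (x : S) :
    Tendsto (fun σ => surfaceExtend σ f (x : E3)) (𝓝[>] 0) (𝓝 (f x)) := by
  have := isFiniteMeasure_areaMeasure hSc hS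
  have : CompactSpace S := isCompact_iff_compactSpace.1 hSc
  let K : ℝ → S → ℝ := fun σ y => 1 / (2 * Real.pi * σ ^ 2) * gaussianRBF σ ‖(x : E3) - y‖
  have h := tendsto_setIntegral_peak_smul_of_integrableOn_of_tendsto (μ := areaMeasure S)
    (s := Set.univ) (t := Set.univ) (x₀ := x) (l := 𝓝[>] (0 : ℝ)) (φ := K) (g := f) (a := f x)
    MeasurableSet.univ MeasurableSet.univ subset_rfl univ_mem (measure_ne_top _ _)
    (Eventually.of_forall fun σ y _ => by
      have := gaussianRBF_pos σ ‖(x : E3) - y‖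
      positivity)
    (fun u hu hxu => by
      obtain ⟨d, hd, hball⟩ := Metric.isOpen_iff.1 hu x hxu
      have hlim := (tendsto_inv_pow_mul_exp_neg_div_sq (a := d ^ 2 / 2) (by positivity) 1).const_mul
        (1 / (2 * Real.pi))
      rw [mul_zero] at hlim
      rw [Metric.tendstoUniformlyOn_iff]
      intro ε hε
      filter_upwards [hlim.eventually (gt_mem_nhds hε)] with σ hσ y hy
      have hdy : d ≤ ‖(x : E3) - y‖ := by
        by_contra! hlt
        refine hy.2 (hball ?_)
        rwa [Metric.mem_ball, Subtype.dist_eq, dist_comm, dist_eq_norm]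
      have hK := (gaussianRBF_pos σ ‖(x : E3) - y‖).le
      rw [Pi.zero_apply, dist_zero_left, Real.norm_of_nonneg (by positivity)]
      exact (inv_mul_gaussianRBF_le hd.le hdy).trans_lt hσ)
    (by simpa [K, integral_const_mul] using tendsto_gaussian_average hSc hS x.2)
    (Eventually.of_forall fun σ => by
      have h1 : Continuous (K σ) := continuous_const.mul
        ((continuous_gaussianRBF σ).comp (by fun_prop))
      exact h1.aestronglyMeasurable)
    (Continuous.integrable_of_hasCompactSupport f.continuous
      (HasCompactSupport.of_compactSpace _)).integrableOn
    (f.continuous.tendsto x |>.mono_left nhdsWithin_le_nhds)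
  refine h.congr fun σ => ?_
  simp only [K, mul_smul, integral_smul, surfaceExtend, setIntegral_univ]

theorem surfaceExtend_tendsto_of_notMem (hSc : IsCompact S) (hS : IsSmoothSurface S) (f : C(S, F))
    {x : E3} (hx : x ∉ S) : Tendsto (fun σ => surfaceExtend σ f x) (𝓝[>] 0) (𝓝 0) := by
  have := isFiniteMeasure_areaMeasure hSc hS
  have : CompactSpace S := isCompact_iff_compactSpace.1 hSc
  obtain ⟨d, hd, hball⟩ := Metric.isOpen_iff.1 hSc.isClosed.isOpen_compl x hx
  have hlim := ((tendsto_inv_pow_mul_exp_neg_div_sq (a := d ^ 2 / 2) (by positivity) 1).const_mul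
    (1 / (2 * Real.pi))).mul_const (‖f‖ * (areaMeasure S).real Set.univ)
  rw [mul_zero, zero_mul] at hlim
  refine squeeze_zero_norm (fun σ => ?_) hlim
  rw [surfaceExtend, ← integral_smul, ← mul_assoc]
  refine norm_integral_le_of_norm_le_const (ae_of_all _ fun y => ?_)
  have hdy : d ≤ ‖x - y‖ := by
    by_contra! hlt
    refine hball (a := (y : E3)) ?_ y.2
    rwa [Metric.mem_ball, dist_comm, dist_eq_norm]
  have hK := (gaussianRBF_pos σ ‖x - y‖).le
  rw [smul_smul, norm_smul, Real.norm_of_nonneg (by positivity)]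
  exact mul_le_mul (inv_mul_gaussianRBF_le hd.le hdy) (f.norm_coe_le_norm y) (norm_nonneg _)
    (by positivity)

end Approximation

/-! ### The gradient of the Gaussian average -/

section Gradient

variable {S : Set E3}

/-- The gradient in `x` of the Gaussian `Φ_σ(|x - y|)`. -/
noncomputable def gaussianGradient (σ : ℝ) (x y : E3) : E3 :=
  ((σ ^ 2)⁻¹ * gaussianRBF σ ‖x - y‖) • (y - x)

theorem continuous_gaussianGradient (σ : ℝ) (x : E3) : Continuous (gaussianGradient σ x) := by
  have h1 : Continuous fun y : E3 => gaussianRBF σ ‖x - y‖ :=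
    (continuous_gaussianRBF σ).comp (by fun_prop)
  unfold gaussianGradient
  fun_prop

theorem norm_gaussianGradient_le (σ : ℝ) (x y : E3) :
    ‖gaussianGradient σ x y‖ ≤ (‖y - x‖ / σ ^ 2) ^ 1 * gaussianRBF σ ‖x - y‖ := by
  have := (gaussianRBF_pos σ ‖x - y‖).le
  rw [gaussianGradient, norm_smul, Real.norm_of_nonneg (by positivity)]
  apply le_of_eq
  ring

theorem hasGradientAt_gaussianRBF (σ : ℝ) (x y : E3) :
    HasGradientAt (fun x => gaussianRBF σ ‖x - y‖) (gaussianGradient σ x y) x := by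
  rw [hasGradientAt_iff_hasFDerivAt]
  have h1 : HasFDerivAt (fun x : E3 => ‖x - y‖ ^ 2) (2 • innerSL ℝ (x - y)) x :=
    ((hasFDerivAt_id x).sub_const y).norm_sq
  have h2 := ((h1.neg.mul_const ((2 * σ ^ 2)⁻¹))).exp
  refine h2.congr_fderiv ?_
  ext v
  simp only [gaussianGradient, InnerProductSpace.toDual_apply_apply, gaussianRBF, inner_smul_left]
  rw [← neg_sub x y, inner_neg_left]
  simp [div_eq_mul_inv, inner_sub_left]
  ring

/-- Differentiation under the integral sign. -/
theorem hasGradientAt_surfaceExtend_one (hSc : IsCompact S) (hS : IsSmoothSurface S) (σ : ℝ)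
    (x : E3) :
    HasGradientAt (surfaceExtend σ (ContinuousMap.const S (1 : ℝ)))
      ((1 / (2 * Real.pi * σ ^ 2)) • ∫ y : S, gaussianGradient σ x y ∂(areaMeasure S)) x := by
  have := isFiniteMeasure_areaMeasure hSc hS
  have : CompactSpace S := isCompact_iff_compactSpace.1 hSc
  obtain ⟨D, hD⟩ := hSc.isBounded.exists_norm_le
  have hcont : ∀ a : E3, Continuous fun y : S => gaussianRBF σ ‖a - y‖ := fun a =>
    (continuous_gaussianRBF σ).comp (by fun_prop)
  have hgrad : Continuous fun y : S => gaussianGradient σ x y :=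
    (continuous_gaussianGradient σ x).comp continuous_subtype_val
  have h := hasFDerivAt_integral_of_dominated_of_fderiv_le (𝕜 := ℝ) (μ := areaMeasure S)
    (F := fun (a : E3) (y : S) => gaussianRBF σ ‖a - (y : E3)‖)
    (F' := fun (a : E3) (y : S) => InnerProductSpace.toDual ℝ E3 (gaussianGradient σ a y))
    (x₀ := x) (s := Metric.ball x 1) (bound := fun _ => ((D + (‖x‖ + 1)) / σ ^ 2) ^ 1)
    (Metric.ball_mem_nhds x one_pos)
    (Eventually.of_forall fun a => (hcont a).aestronglyMeasurable)
    ((hcont x).integrable_of_hasCompactSupport (HasCompactSupport.of_compactSpace _))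
    ((InnerProductSpace.toDual ℝ E3).continuous.comp hgrad).aestronglyMeasurable
    (ae_of_all _ fun y a ha => by
      rw [LinearIsometryEquiv.norm_map]
      refine (norm_gaussianGradient_le σ a y).trans ?_
      have h1 : ‖(y : E3) - a‖ ≤ D + (‖x‖ + 1) := by
        have h2 : ‖a‖ ≤ ‖x‖ + 1 := by
          have := norm_le_norm_add_norm_sub' a x
          rw [Metric.mem_ball, dist_eq_norm] at ha
          linarith
        exact (norm_sub_le _ _).trans (add_le_add (hD y y.2) h2)
      have h3 : gaussianRBF σ ‖a - y‖ ≤ 1 := by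
        rw [gaussianRBF, Real.exp_le_one_iff]
        exact div_nonpos_of_nonpos_of_nonneg (by simp) (by positivity)
      have h4 := (norm_nonneg _).trans h1
      calc _ ≤ ((D + (‖x‖ + 1)) / σ ^ 2) ^ 1 * 1 :=
            mul_le_mul (by gcongr) h3 (gaussianRBF_pos _ _).le (by positivity)
        _ = _ := mul_one _)
    (integrable_const _)
    (ae_of_all _ fun y a _ => hasGradientAt_iff_hasFDerivAt.1 (hasGradientAt_gaussianRBF σ a y))
  have e : ∫ y : S, InnerProductSpace.toDual ℝ E3 (gaussianGradient σ x y) ∂(areaMeasure S)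
      = InnerProductSpace.toDual ℝ E3 (∫ y : S, gaussianGradient σ x y ∂(areaMeasure S)) :=
    (InnerProductSpace.toDual ℝ E3).toContinuousLinearEquiv.toContinuousLinearMap.integral_comp_comm
      (hgrad.integrable_of_hasCompactSupport (HasCompactSupport.of_compactSpace _))
  rw [e] at h
  rw [hasGradientAt_iff_hasFDerivAt]
  have e' : surfaceExtend σ (ContinuousMap.const S (1 : ℝ)) = fun x : E3 =>
      1 / (2 * Real.pi * σ ^ 2) * ∫ y : S, gaussianRBF σ ‖x - y‖ ∂(areaMeasure S) := by
    ext x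
    simp [surfaceExtend]
  rw [e', map_smulₛₗ]
  exact h.const_mul (1 / (2 * Real.pi * σ ^ 2))

end Gradient

namespace MongeChart

variable {S : Set E3} {x₀ : E3} (c : MongeChart S x₀)

/-- The integrand of the gradient over the tangent plane, without the term that is odd in `p`. -/
noncomputable def evenGradient (σ : ℝ) (p : Plane) : E3 :=
  gaussianGradient σ x₀ (c.G p) - ((σ ^ 2)⁻¹ * gaussianRBF σ ‖p‖) • c.L p

theorem continuous_evenGradient (σ : ℝ) : Continuous (c.evenGradient σ) := by
  have h1 := (continuous_gaussianGradient σ x₀).comp c.continuous_G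
  have h2 : Continuous fun p : Plane => gaussianRBF σ ‖p‖ :=
    (continuous_gaussianRBF σ).comp continuous_norm
  have h3 := c.L.continuous
  unfold evenGradient
  exact h1.sub ((continuous_const.mul h2).smul h3)

theorem setIntegral_evenGradient (σ ρ : ℝ) :
    ∫ p in Metric.ball 0 ρ, c.evenGradient σ p
      = ∫ p in Metric.ball 0 ρ, gaussianGradient σ x₀ (c.G p) := by
  have h2 : Continuous fun p : Plane => gaussianRBF σ ‖p‖ :=
    (continuous_gaussianRBF σ).comp continuous_norm
  have h3 := c.L.continuous
  have hodd : ∫ p in Metric.ball 0 ρ, ((σ ^ 2)⁻¹ * gaussianRBF σ ‖p‖) • c.L p = 0 := by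
    rw [← integral_indicator measurableSet_ball]
    have h := integral_neg_eq_self ((Metric.ball (0 : Plane) ρ).indicator
      fun p => ((σ ^ 2)⁻¹ * gaussianRBF σ ‖p‖) • c.L p) volume
    have e : ∀ p : Plane, (Metric.ball (0 : Plane) ρ).indicator
        (fun p => ((σ ^ 2)⁻¹ * gaussianRBF σ ‖p‖) • c.L p) (-p)
        = -(Metric.ball (0 : Plane) ρ).indicator
        (fun p => ((σ ^ 2)⁻¹ * gaussianRBF σ ‖p‖) • c.L p) p := by
      intro p
      by_cases hp : ‖p‖ < ρ <;> simp [Set.indicator, hp]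
    simp only [e, integral_neg] at h
    rw [neg_eq_iff_add_eq_zero, ← two_smul ℝ] at h
    exact (smul_eq_zero.1 h).resolve_left two_ne_zero
  have h4 : Continuous fun p => gaussianGradient σ x₀ (c.G p) :=
    (continuous_gaussianGradient σ x₀).comp c.continuous_G
  have h5 : Continuous fun p => ((σ ^ 2)⁻¹ * gaussianRBF σ ‖p‖) • c.L p :=
    (continuous_const.mul h2).smul h3
  unfold evenGradient
  rw [integral_sub (h4.integrableOn_plane_ball ρ) (h5.integrableOn_plane_ball ρ), hodd, sub_zero]

/-- In the scale `p = σ q` the tangential and normal components of the integrand are of order `σ`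
and `1`. -/
theorem evenGradient_smul {σ : ℝ} (hσ : 0 < σ) (q : Plane) :
    c.evenGradient σ (σ • q) = Real.exp (-‖q‖ ^ 2 / 2) •
      ((σ⁻¹ * (Real.exp (-(c.h (σ • q) / σ) ^ 2 / 2) - 1)) • c.L q
        + (c.h (σ • q) / σ ^ 2 * Real.exp (-(c.h (σ • q) / σ) ^ 2 / 2)) • c.ν) := by
  have h1 : gaussianRBF σ ‖σ • q‖ = Real.exp (-‖q‖ ^ 2 / 2) := by
    rw [gaussianRBF, norm_smul, Real.norm_of_nonneg hσ.le]
    congr 1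
    field_simp
  have h2 : c.G (σ • q) - x₀ = σ • c.L q + c.h (σ • q) • c.ν := by
    rw [G, map_smul]; abel
  rw [evenGradient, gaussianGradient, c.gaussianRBF_G hσ, h1, h2, map_smul]
  simp only [smul_add, smul_smul]
  rw [add_sub_right_comm, ← sub_smul]
  congr 2 <;> field_simp

theorem abs_exp_sub_one_le (t : ℝ) : |Real.exp (-t ^ 2 / 2) - 1| ≤ t ^ 2 / 2 := by
  have h1 := Real.add_one_le_exp (-t ^ 2 / 2)
  have h2 : Real.exp (-t ^ 2 / 2) ≤ 1 := Real.exp_le_one_iff.2 (by nlinarith [sq_nonneg t])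
  rw [abs_le]
  constructor <;> nlinarith [sq_nonneg t]

theorem norm_evenGradient_smul_le {σ : ℝ} (hσ : 0 < σ) (hσ1 : σ ≤ 1) (q : Plane) :
    ‖c.evenGradient σ (σ • q)‖ ≤
      c.M ^ 2 * (‖q‖ ^ 5 * Real.exp (-‖q‖ ^ 2 / 2)) + c.M * (‖q‖ ^ 2 * Real.exp (-‖q‖ ^ 2 / 2)) := by
  have hM := c.M_nonneg
  have hh : |c.h (σ • q)| ≤ c.M * (σ ^ 2 * ‖q‖ ^ 2) := by
    have := c.abs_h_le (σ • q)
    rwa [norm_smul, Real.norm_of_nonneg hσ.le, mul_pow] at this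
  set E := Real.exp (-(c.h (σ • q) / σ) ^ 2 / 2) with hE
  have h1 : |σ⁻¹ * (E - 1)| ≤ c.M ^ 2 * ‖q‖ ^ 4 := by
    rw [abs_mul, abs_of_pos (inv_pos.2 hσ)]
    have h2 : (c.h (σ • q) / σ) ^ 2 ≤ (c.M * (σ * ‖q‖ ^ 2)) ^ 2 := by
      rw [← sq_abs, abs_div, abs_of_pos hσ]
      gcongr
      rw [div_le_iff₀ hσ]
      linarith
    calc σ⁻¹ * |E - 1| ≤ σ⁻¹ * ((c.M * (σ * ‖q‖ ^ 2)) ^ 2) := by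
          gcongr
          have := abs_exp_sub_one_le (c.h (σ • q) / σ)
          have := sq_nonneg (c.h (σ • q) / σ)
          linarith
      _ = σ * (c.M ^ 2 * ‖q‖ ^ 4) := by field_simp
      _ ≤ 1 * (c.M ^ 2 * ‖q‖ ^ 4) := by gcongr
      _ = _ := one_mul _
  have h2 : |c.h (σ • q) / σ ^ 2 * E| ≤ c.M * ‖q‖ ^ 2 := by
    have hE1 : E ≤ 1 := Real.exp_le_one_iff.2 (by nlinarith [sq_nonneg (c.h (σ • q) / σ)])
    rw [abs_mul, abs_div, abs_of_pos (Real.exp_pos _), abs_of_pos (pow_pos hσ 2)]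
    refine (mul_le_of_le_one_right (by positivity) hE1).trans ?_
    rw [div_le_iff₀ (by positivity)]
    linarith
  rw [c.evenGradient_smul hσ, norm_smul, Real.norm_of_nonneg (Real.exp_pos _).le]
  calc _ ≤ Real.exp (-‖q‖ ^ 2 / 2) * (c.M ^ 2 * ‖q‖ ^ 4 * ‖q‖ + c.M * ‖q‖ ^ 2 * 1) := by
        gcongr
        refine (norm_add_le _ _).trans ?_
        rw [norm_smul, norm_smul, c.L.norm_map, c.norm_ν, Real.norm_eq_abs, Real.norm_eq_abs]
        gcongr
    _ = _ := by ring

theorem tendsto_evenGradient_smul (q : Plane) :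
    Tendsto (fun σ : ℝ => c.evenGradient σ (σ • q)) (𝓝[>] 0)
      (𝓝 ((fderiv ℝ (fderiv ℝ c.h) 0 q q * Real.exp (-‖q‖ ^ 2 / 2)) • ((1 / 2 : ℝ) • c.ν))) := by
  have hσ0 : Tendsto (fun σ : ℝ => σ) (𝓝[>] 0) (𝓝 0) := tendsto_id.mono_left nhdsWithin_le_nhds
  have h1 : Tendsto (fun σ : ℝ => σ⁻¹ * (Real.exp (-(c.h (σ • q) / σ) ^ 2 / 2) - 1)) (𝓝[>] 0)
      (𝓝 0) := by
    have h := ((c.tendsto_h_div_sq q).pow 2).mul hσ0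
    rw [mul_zero] at h
    refine squeeze_zero_norm' ?_ h
    filter_upwards [self_mem_nhdsWithin] with σ hσ
    have hσ : 0 < σ := hσ
    rw [norm_mul, Real.norm_of_nonneg (inv_pos.2 hσ).le, Real.norm_eq_abs]
    have := abs_exp_sub_one_le (c.h (σ • q) / σ)
    have h3 := sq_nonneg (c.h (σ • q) / σ)
    calc _ ≤ σ⁻¹ * (c.h (σ • q) / σ) ^ 2 := by
          gcongr
          linarith
      _ = _ := by field_simp
  have h2 := (c.tendsto_h_div_sq q).mul (c.tendsto_exp_h_div q)
  have h := ((h1.smul_const (c.L q)).add (h2.smul_const c.ν)).const_smul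
    (Real.exp (-‖q‖ ^ 2 / 2))
  rw [zero_smul, zero_add, mul_one] at h
  have e : Real.exp (-‖q‖ ^ 2 / 2) • (fderiv ℝ (fderiv ℝ c.h) 0 q q / 2) • c.ν
      = (fderiv ℝ (fderiv ℝ c.h) 0 q q * Real.exp (-‖q‖ ^ 2 / 2)) • ((1 / 2 : ℝ) • c.ν) := by
    simp only [smul_smul]
    congr 1
    ring
  rw [e] at h
  refine h.congr' ?_
  filter_upwards [self_mem_nhdsWithin] with σ hσ
  rw [c.evenGradient_smul hσ]

/-- The Laplacian of the height function at the base point. -/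
noncomputable def laplacian : ℝ :=
  fderiv ℝ (fderiv ℝ c.h) 0 (EuclideanSpace.single 0 1) (EuclideanSpace.single 0 1)
    + fderiv ℝ (fderiv ℝ c.h) 0 (EuclideanSpace.single 1 1) (EuclideanSpace.single 1 1)

theorem tendsto_disc_average_gradient :
    Tendsto (fun σ => (1 / (2 * Real.pi * σ ^ 2)) •
      ∫ p in Metric.ball 0 (c.r / 2), gaussianGradient σ x₀ (c.G p)) (𝓝[>] 0)
      (𝓝 ((c.laplacian / 2) • c.ν)) := by
  have key : Tendsto (fun σ => ∫ q : Plane, (Metric.ball (0 : Plane) (c.r / 2)).indicator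
      (c.evenGradient σ) (σ • q)) (𝓝[>] 0)
      (𝓝 (∫ q : Plane, (fderiv ℝ (fderiv ℝ c.h) 0 q q * Real.exp (-‖q‖ ^ 2 / 2)) •
        ((1 / 2 : ℝ) • c.ν))) := by
    refine tendsto_integral_filter_of_dominated_convergence
      (fun q => c.M ^ 2 * (‖q‖ ^ 5 * Real.exp (-‖q‖ ^ 2 / 2))
        + c.M * (‖q‖ ^ 2 * Real.exp (-‖q‖ ^ 2 / 2))) ?_ ?_
      (((integrable_norm_pow_mul_exp 5).const_mul _).add
        ((integrable_norm_pow_mul_exp 2).const_mul _)) ?_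
    · filter_upwards with σ
      exact (((c.continuous_evenGradient σ).measurable.indicator measurableSet_ball).comp
        (measurable_const_smul σ)).aestronglyMeasurable
    · filter_upwards [Ioc_mem_nhdsGT zero_lt_one] with σ hσ
      filter_upwards with q
      exact (norm_indicator_le_norm_self _ _).trans (c.norm_evenGradient_smul_le hσ.1 hσ.2 q)
    · filter_upwards with q
      refine (c.tendsto_evenGradient_smul q).congr' ?_
      filter_upwards [c.eventually_smul_mem_ball q] with σ hq
      rw [Set.indicator_of_mem hq]
  have h := key.const_smul (1 / (2 * Real.pi))
  rw [integral_smul_const, integral_bilinear_mul_exp, smul_smul, smul_smul] at h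
  have e : 1 / (2 * Real.pi) * (2 * Real.pi * c.laplacian * (1 / 2)) = c.laplacian / 2 := by
    field_simp
  rw [laplacian] at e
  rw [mul_assoc, mul_assoc] at h
  rw [laplacian]
  rw [mul_assoc, mul_assoc] at e
  rw [mul_assoc, e] at h
  refine h.congr' ?_
  filter_upwards [self_mem_nhdsWithin] with σ hσ
  rw [← integral_ball_scaling hσ, c.setIntegral_evenGradient]

/-- The gradient of the Gaussian average of the surface tends to half the Laplacian of the height
function, in the normal direction: the part of the gradient along the tangent plane is odd to
leading order, and the normal part is a Gaussian second moment of the height. -/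
theorem tendsto_gradient_surfaceExtend_one (hSc : IsCompact S) (hS : IsSmoothSurface S) :
    Tendsto (fun σ => ∇ (surfaceExtend σ (ContinuousMap.const S (1 : ℝ))) x₀) (𝓝[>] 0)
      (𝓝 ((c.laplacian / 2) • c.ν)) := by
  have h := (c.tendsto_average_sub_average hSc hS (j := 1) le_rfl
    (φ := fun σ y => gaussianGradient σ x₀ y) (fun σ _ => continuous_gaussianGradient σ x₀)
    (fun σ _ y => norm_gaussianGradient_le σ x₀ y)).add c.tendsto_disc_average_gradient
  simp only [sub_add_cancel, zero_add] at h
  refine h.congr fun σ => ?_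
  rw [(hasGradientAt_surfaceExtend_one hSc hS σ x₀).gradient]

end MongeChart

/-! ### Mean curvature in a chart -/

/-- The trace of an endomorphism of a plane in `ℝ³` with orthonormal frame `L`. -/
theorem trace_eq_sum_inner_of_eq_range (L : Plane →ₗᵢ[ℝ] E3) {K : Submodule ℝ E3}
    (hK : K = LinearMap.range L.toLinearMap) (T : K →ₗ[ℝ] K) :
    LinearMap.trace ℝ K T = ∑ i : Fin 2, inner ℝ (L (EuclideanSpace.single i 1))
      (T ⟨L (EuclideanSpace.single i 1), by rw [hK]; exact ⟨_, rfl⟩⟩ : E3) := by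
  subst hK
  let b := (EuclideanSpace.basisFun (Fin 2) ℝ).map L.equivRange
  rw [LinearMap.trace_eq_sum_inner T b]
  refine Finset.sum_congr rfl fun i _ => ?_
  have hb : b i = ⟨L (EuclideanSpace.single i 1), ⟨_, rfl⟩⟩ := by
    apply Subtype.ext
    simp [b]
  rw [hb]
  rfl

namespace MongeChart

variable {S : Set E3} {x₀ : E3} (c : MongeChart S x₀)

theorem G_zero : c.G 0 = x₀ := by simp [G, c.h_zero]

theorem hasFDerivAt_G (p : Plane) :
    HasFDerivAt c.G (c.L.toContinuousLinearMap + (fderiv ℝ c.h p).smulRight c.ν) p := by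
  have h1 : HasFDerivAt (fun p => x₀ + c.L p) c.L.toContinuousLinearMap p :=
    c.L.toContinuousLinearMap.hasFDerivAt.const_add x₀
  exact h1.add ((c.hasBoundedDifferences.differentiable p).hasFDerivAt.smul_const c.ν)

theorem hasDerivAt_G_line (p v : Plane) :
    HasDerivAt (fun t : ℝ => c.G (p + t • v)) (c.L v + fderiv ℝ c.h p v • c.ν) 0 := by
  have h1 : HasDerivAt (fun t : ℝ => p + t • v) v 0 := by
    simpa using ((hasDerivAt_id (0 : ℝ)).smul_const v).const_add p
  have h2 : HasFDerivAt c.G (c.L.toContinuousLinearMap + (fderiv ℝ c.h p).smulRight c.ν)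
      (p + (0 : ℝ) • v) := by simpa using c.hasFDerivAt_G p
  exact h2.comp_hasDerivAt (0 : ℝ) h1

theorem eventually_G_line_mem {p : Plane} (hp : ‖p‖ < c.r / 2) (v : Plane) :
    ∀ᶠ t in 𝓝 (0 : ℝ), c.G (p + t • v) ∈ S := by
  have h : Tendsto (fun t : ℝ => ‖p + t • v‖) (𝓝 0) (𝓝 ‖p‖) :=
    Continuous.tendsto' (by fun_prop) _ _ (by simp)
  filter_upwards [h.eventually (gt_mem_nhds hp)] with t ht
  exact c.G_mem (le_of_lt ht)

theorem mem_surfaceTangent {p : Plane} (hp : ‖p‖ < c.r / 2) (v : Plane) :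
    c.L v + fderiv ℝ c.h p v • c.ν ∈ surfaceTangent S (c.G p) :=
  Submodule.subset_span ⟨fun t => c.G (p + t • v), by simp, c.eventually_G_line_mem hp v,
    c.hasDerivAt_G_line p v⟩

/-- The tangent space of the surface at the base point is the tangent plane of the chart. -/
theorem surfaceTangent_eq_range : surfaceTangent S x₀ = LinearMap.range c.L.toLinearMap := by
  have hr := c.r_pos
  refine le_antisymm (Submodule.span_le.2 ?_) ?_
  · rintro v ⟨γ, hγ0, hγS, hγ⟩
    have h1 : HasDerivAt (fun t => inner ℝ c.ν (γ t - x₀)) (inner ℝ c.ν v) 0 :=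
      (innerSL ℝ c.ν).hasFDerivAt.comp_hasDerivAt (0 : ℝ) (hγ.sub_const x₀)
    have h2 : HasDerivAt (fun t => c.h (c.proj (γ t))) 0 0 := by
      have h3 : HasDerivAt (fun t => c.proj (γ t)) (c.L.toContinuousLinearMap.adjoint v) 0 :=
        (c.L.toContinuousLinearMap.adjoint).hasFDerivAt.comp_hasDerivAt (0 : ℝ) (hγ.sub_const x₀)
      have h4 : HasFDerivAt c.h (0 : Plane →L[ℝ] ℝ) (c.proj (γ 0)) := by
        have : c.proj (γ 0) = 0 := by simp [proj, hγ0]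
        rw [this, ← c.fderiv_h_zero]
        exact (c.hasBoundedDifferences.differentiable 0).hasFDerivAt
      simpa [Function.comp_def] using h4.comp_hasDerivAt (0 : ℝ) h3
    have h5 : (fun t => inner ℝ c.ν (γ t - x₀)) =ᶠ[𝓝 0] fun t => c.h (c.proj (γ t)) := by
      have hnear : ∀ᶠ t in 𝓝 (0 : ℝ), γ t ∈ Metric.ball x₀ c.r :=
        hγ.continuousAt.eventually (by rw [hγ0]; exact Metric.ball_mem_nhds _ hr)
      filter_upwards [hγS, hnear] with t ht1 ht2
      rw [Metric.mem_ball, dist_eq_norm] at ht2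
      exact (c.mem_iff _ ht2).1 ht1
    have h6 : inner ℝ c.ν v = 0 := (h1.congr_of_eventuallyEq h5.symm).unique h2
    refine ⟨c.L.toContinuousLinearMap.adjoint v, ?_⟩
    have := linearIsometry_decomposition c.norm_ν c.inner_ν v
    rw [h6, zero_smul, add_zero] at this
    exact this
  · rintro _ ⟨v, rfl⟩
    have := c.mem_surfaceTangent (p := 0) (by simpa using hr) v
    rw [c.G_zero, c.fderiv_h_zero] at this
    simpa using this

/-- The gradient of the height function. -/
noncomputable def gradH (p : Plane) : Plane :=
  (InnerProductSpace.toDual ℝ Plane).symm (fderiv ℝ c.h p)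

theorem inner_gradH (p v : Plane) : inner ℝ (c.gradH p) v = fderiv ℝ c.h p v := by
  rw [gradH, InnerProductSpace.toDual_symm_apply]

theorem gradH_zero : c.gradH 0 = 0 := by rw [gradH, c.fderiv_h_zero, map_zero]

/-- The Hessian of the height function at the base point, as an endomorphism. -/
noncomputable def hessH : Plane →L[ℝ] Plane :=
  (InnerProductSpace.toDual ℝ Plane).symm.toContinuousLinearEquiv.toContinuousLinearMap ∘L
    fderiv ℝ (fderiv ℝ c.h) 0

theorem inner_hessH (v w : Plane) :
    inner ℝ (c.hessH v) w = fderiv ℝ (fderiv ℝ c.h) 0 v w :=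
  InnerProductSpace.toDual_symm_apply

theorem hasFDerivAt_gradH : HasFDerivAt c.gradH c.hessH 0 := by
  have hfc2 : ContDiff ℝ 2 (fderiv ℝ c.h) := c.contDiff_h.fderiv_right (by norm_num)
  have h1 : HasFDerivAt (fderiv ℝ c.h) (fderiv ℝ (fderiv ℝ c.h) 0) 0 :=
    (hfc2.differentiable (by norm_num) 0).hasFDerivAt
  exact ((InnerProductSpace.toDual ℝ Plane).symm.toContinuousLinearEquiv.toContinuousLinearMap
    |>.hasFDerivAt).comp (0 : Plane) h1

/-- A unit normal of the graph is determined by its component along `ν`. -/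
theorem eq_smul_of_isUnitNormal {p : Plane} (hp : ‖p‖ < c.r / 2) {m : E3}
    (hm : IsUnitNormal S (c.G p) m) :
    m = (inner ℝ c.ν m : ℝ) • (c.ν - c.L (c.gradH p)) ∧
      (inner ℝ c.ν m : ℝ) ^ 2 * (1 + ‖c.gradH p‖ ^ 2) = 1 := by
  set a : ℝ := inner ℝ c.ν m with ha
  have h1 : c.L.toContinuousLinearMap.adjoint m = -(a • c.gradH p) := by
    refine ext_inner_right ℝ fun v => ?_
    have h2 := hm.2 _ (c.mem_surfaceTangent hp v)
    rw [inner_add_right, inner_smul_right, real_inner_comm c.ν m, ← ha] at h2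
    rw [inner_linearIsometry_adjoint, inner_neg_left, inner_smul_left, c.inner_gradH]
    simp only [conj_trivial]
    linarith
  have h3 : m = a • (c.ν - c.L (c.gradH p)) := by
    have := linearIsometry_decomposition c.norm_ν c.inner_ν m
    rw [← ha, h1, map_neg, map_smul] at this
    rw [← this, smul_sub]
    abel
  refine ⟨h3, ?_⟩
  have h4 : ‖c.ν - c.L (c.gradH p)‖ ^ 2 = 1 + ‖c.gradH p‖ ^ 2 := by
    have := c.norm_add_smul_normal_sq (-c.gradH p) 1
    rw [map_neg, one_smul, norm_neg] at this
    rw [sub_eq_neg_add, this]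
    ring
  have h5 := congrArg (fun z => ‖z‖ ^ 2) h3
  simp only [norm_smul, mul_pow, h4, hm.1, Real.norm_eq_abs, sq_abs] at h5
  linarith

/-- The unit normal of the graph over `p`, up to the sign `s`. -/
noncomputable def graphNormal (s : ℝ) (p : Plane) : E3 :=
  (s * (√(1 + ‖c.gradH p‖ ^ 2))⁻¹) • (c.ν - c.L (c.gradH p))

theorem hasFDerivAt_graphNormal (s : ℝ) :
    HasFDerivAt (c.graphNormal s) (-(s • (c.L.toContinuousLinearMap ∘L c.hessH))) 0 := by
  have h1 : HasFDerivAt (fun p => ‖c.gradH p‖ ^ 2) (0 : Plane →L[ℝ] ℝ) 0 := by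
    have := c.hasFDerivAt_gradH.norm_sq
    simpa [c.gradH_zero] using this
  have h2 : DifferentiableAt ℝ (fun t : ℝ => s * (√(1 + t))⁻¹) (‖c.gradH 0‖ ^ 2) := by
    have : (1 : ℝ) + ‖c.gradH 0‖ ^ 2 ≠ 0 := by positivity
    have h3 : √(1 + ‖c.gradH 0‖ ^ 2) ≠ 0 := by positivity
    exact DifferentiableAt.const_mul (DifferentiableAt.inv (DifferentiableAt.sqrt
      (differentiableAt_id.const_add 1) this) h3) s
  have h3 : HasFDerivAt (fun p => s * (√(1 + ‖c.gradH p‖ ^ 2))⁻¹) (0 : Plane →L[ℝ] ℝ) 0 := by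
    have := h2.hasDerivAt.comp_hasFDerivAt (0 : Plane) h1
    simpa [Function.comp_def] using this
  have h4 : HasFDerivAt (fun p => c.ν - c.L (c.gradH p))
      (-(c.L.toContinuousLinearMap ∘L c.hessH)) 0 :=
    (c.L.toContinuousLinearMap.hasFDerivAt.comp (0 : Plane) c.hasFDerivAt_gradH).const_sub c.ν
  refine (h3.smul h4).congr_fderiv ?_
  ext v
  simp [c.gradH_zero]

section Normal

variable {U : Set E3} {n : E3 → E3}

theorem normal_base_eq (hx₀ : x₀ ∈ S ∩ U) (hn : ∀ y ∈ S ∩ U, IsUnitNormal S y (n y)) :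
    n x₀ = (inner ℝ c.ν (n x₀) : ℝ) • c.ν ∧ (inner ℝ c.ν (n x₀) : ℝ) ^ 2 = 1 := by
  have hr := c.r_pos
  have h := c.eq_smul_of_isUnitNormal (p := 0) (by simpa using hr) (m := n x₀)
    (by rw [c.G_zero]; exact hn x₀ hx₀)
  simpa [c.gradH_zero] using h

/-- By continuity, a unit normal field is the normal of the graph with a constant sign. -/
theorem eventuallyEq_graphNormal (hU : IsOpen U) (hnc : ContinuousOn n (S ∩ U))
    (hn : ∀ y ∈ S ∩ U, IsUnitNormal S y (n y)) (hx₀ : x₀ ∈ S ∩ U) :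
    n =ᶠ[𝓝[S] x₀] fun y => c.graphNormal (inner ℝ c.ν (n x₀)) (c.proj y) := by
  have hr := c.r_pos
  set s : ℝ := inner ℝ c.ν (n x₀) with hs
  have hs2 : s ^ 2 = 1 := (c.normal_base_eq hx₀ hn).2
  have hSU : S ∩ U ∈ 𝓝[S] x₀ := inter_mem_nhdsWithin S (hU.mem_nhds hx₀.2)
  have hcont : Tendsto (fun y => s * inner ℝ c.ν (n y)) (𝓝[S] x₀) (𝓝 (s * s)) := by
    have h1 : Tendsto n (𝓝[S] x₀) (𝓝 (n x₀)) :=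
      (hnc x₀ hx₀).mono_left (le_inf inf_le_left (le_principal_iff.2 hSU))
    exact ((innerSL ℝ c.ν).continuous.tendsto (n x₀) |>.comp h1).const_mul s
  have hpos : ∀ᶠ y in 𝓝[S] x₀, 0 < s * inner ℝ c.ν (n y) :=
    hcont.eventually (lt_mem_nhds (by rw [← sq, hs2]; exact one_pos))
  have hball : ∀ᶠ y in 𝓝[S] x₀, y ∈ Metric.ball x₀ (c.r / 2) :=
    mem_nhdsWithin_of_mem_nhds (Metric.ball_mem_nhds _ (by positivity))
  filter_upwards [hSU, hpos, hball] with y hy hy1 hy2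
  rw [Metric.mem_ball, dist_eq_norm] at hy2
  have hp : ‖c.proj y‖ < c.r / 2 := (c.norm_proj_le y).trans_lt hy2
  have hG := c.G_proj hy.1 (by linarith)
  obtain ⟨h1, h2⟩ := c.eq_smul_of_isUnitNormal hp (m := n y) (by rw [hG]; exact hn y hy)
  set a : ℝ := inner ℝ c.ν (n y) with ha
  set w := 1 + ‖c.gradH (c.proj y)‖ ^ 2 with hw
  have hw0 : 0 < w := by positivity
  have h3 : s * a = (√w)⁻¹ := by
    refine (pow_left_inj₀ hy1.le (by positivity) two_ne_zero).1 ?_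
    rw [inv_pow, Real.sq_sqrt hw0.le, mul_pow, hs2, one_mul]
    exact eq_inv_of_mul_eq_one_left h2
  have h4 : a = s * (√w)⁻¹ := by
    rw [← h3, ← mul_assoc, ← sq, hs2, one_mul]
  rw [h1, graphNormal, ← hw, ← h4]

theorem hasFDerivAt_proj (y : E3) : HasFDerivAt c.proj (c.L.toContinuousLinearMap.adjoint) y := by
  have h := (c.L.toContinuousLinearMap.adjoint.hasFDerivAt (x := y)).sub_const
    (c.L.toContinuousLinearMap.adjoint x₀)
  refine h.congr_of_eventuallyEq (Eventually.of_forall fun z => ?_)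
  exact map_sub _ _ _

theorem proj_base : c.proj x₀ = 0 := by simp [proj]

theorem hasFDerivWithinAt_normal (hU : IsOpen U) (hnc : ContinuousOn n (S ∩ U))
    (hn : ∀ y ∈ S ∩ U, IsUnitNormal S y (n y)) (hx₀ : x₀ ∈ S ∩ U) :
    HasFDerivWithinAt n
      ((-((inner ℝ c.ν (n x₀) : ℝ) • (c.L.toContinuousLinearMap ∘L c.hessH)))
        ∘L c.L.toContinuousLinearMap.adjoint) S x₀ := by
  have h1 := c.hasFDerivAt_graphNormal (inner ℝ c.ν (n x₀))
  rw [← c.proj_base] at h1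
  have heq := c.eventuallyEq_graphNormal hU hnc hn hx₀
  exact ((h1.comp x₀ (c.hasFDerivAt_proj x₀)).hasFDerivWithinAt (s := S)).congr_of_eventuallyEq heq
    (heq.self_of_nhdsWithin hx₀.1)

/-- A derivative within `S` is determined on tangent vectors by the curves in `S`. -/
theorem eqOn_tangent_of_hasFDerivWithinAt {A B : E3 →L[ℝ] E3} (hA : HasFDerivWithinAt n A S x₀)
    (hB : HasFDerivWithinAt n B S x₀) (v : Plane) : A (c.L v) = B (c.L v) := by
  have hr := c.r_pos
  have hline := c.eventually_G_line_mem (p := 0) (by simpa using hr) v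
  have hd : HasDerivAt (fun t : ℝ => c.G (0 + t • v)) (c.L v) 0 := by
    have := c.hasDerivAt_G_line 0 v
    rw [c.fderiv_h_zero] at this
    simpa using this
  have hbase : c.G (0 + (0 : ℝ) • v) = x₀ := by simp [c.G_zero]
  have along : ∀ A : E3 →L[ℝ] E3, HasFDerivWithinAt n A S x₀ →
      HasDerivAt (n ∘ fun t : ℝ => c.G (0 + t • v)) (A (c.L v)) 0 := by
    intro A hA
    exact (hA.comp_hasDerivWithinAt_of_eq (0 : ℝ)
      (hd.hasDerivWithinAt (s := {t | c.G (0 + t • v) ∈ S}))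
      (fun t ht => ht) hbase.symm).hasDerivAt hline
  exact (along _ hA).unique (along _ hB)

/-- The shape operator of the graph at the base point is the Hessian of the height function, up to
sign. -/
theorem fderivWithin_normal_apply (hU : IsOpen U) (hnc : ContinuousOn n (S ∩ U))
    (hn : ∀ y ∈ S ∩ U, IsUnitNormal S y (n y)) (hx₀ : x₀ ∈ S ∩ U) (v : Plane) :
    fderivWithin ℝ n S x₀ (c.L v) = -((inner ℝ c.ν (n x₀) : ℝ) • c.L (c.hessH v)) := by
  have h := c.hasFDerivWithinAt_normal hU hnc hn hx₀
  rw [c.eqOn_tangent_of_hasFDerivWithinAt h.differentiableWithinAt.hasFDerivWithinAt h,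
    ContinuousLinearMap.comp_apply, adjoint_linearIsometry_self]
  rfl

theorem meanCurvature_eq (hU : IsOpen U) (hnc : ContinuousOn n (S ∩ U))
    (hn : ∀ y ∈ S ∩ U, IsUnitNormal S y (n y)) (hx₀ : x₀ ∈ S ∩ U) :
    meanCurvature S n x₀ = -((inner ℝ c.ν (n x₀) : ℝ) * (c.laplacian / 2)) := by
  have hterm : ∀ v : Plane, ∀ hv : c.L v ∈ surfaceTangent S x₀,
      inner ℝ (c.L v) (normalDifferential S n x₀ ⟨c.L v, hv⟩ : E3)
        = -((inner ℝ c.ν (n x₀) : ℝ) * fderiv ℝ (fderiv ℝ c.h) 0 v v) := by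
    intro v hv
    have h1 : inner ℝ (c.L v) (normalDifferential S n x₀ ⟨c.L v, hv⟩ : E3)
        = inner ℝ (c.L v) (fderivWithin ℝ n S x₀ (c.L v)) :=
      Submodule.inner_orthogonalProjectionOnto_eq_of_mem_left ⟨c.L v, hv⟩ _
    rw [h1, c.fderivWithin_normal_apply hU hnc hn hx₀, inner_neg_right, inner_smul_right,
      c.L.inner_map_map, real_inner_comm (c.hessH v) v, c.inner_hessH]
  rw [meanCurvature, trace_eq_sum_inner_of_eq_range c.L c.surfaceTangent_eq_range, Fin.sum_univ_two]
  simp only [ContinuousLinearMap.coe_coe, hterm, laplacian]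
  ring

/-- The mean curvature vector in a chart; the sign of the normal field cancels. -/
theorem neg_meanCurvature_smul_normal (hU : IsOpen U) (hnc : ContinuousOn n (S ∩ U))
    (hn : ∀ y ∈ S ∩ U, IsUnitNormal S y (n y)) (hx₀ : x₀ ∈ S ∩ U) :
    -(meanCurvature S n x₀ • n x₀) = (c.laplacian / 2) • c.ν := by
  obtain ⟨h1, h2⟩ := c.normal_base_eq hx₀ hn
  rw [c.meanCurvature_eq hU hnc hn hx₀]
  set s : ℝ := inner ℝ c.ν (n x₀)
  rw [h1, smul_smul, ← neg_smul]
  congr 1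
  linear_combination (c.laplacian / 2) * h2

end Normal

end MongeChart

/-! ### The restriction and extension operators of a surface -/

theorem theorem2 (S : Set E3) (hSc : IsCompact S) (hS : IsSmoothSurface S) :
    -- (a) discrete to continuous extension
    (∀ (J : ℕ) (f : C(S, EuclideanSpace ℝ (Fin J))) (σ : ℝ), 0 < σ → ∀ x : E3,
      ∀ ε > 0, ∃ δ₀ > 0, ∀ δ : ℝ, 0 < δ → δ < δ₀ →
        ∀ (I : ℕ) (X : Fin I → S), Function.Injective X → IsNet S δ X →
          ‖gaussianCloudExtend σ X (restrictTo X f) x - surfaceExtend σ f x‖ < ε) ∧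
    -- (b) approximation on the surface, decay off the surface
    (∀ (J : ℕ) (f : C(S, EuclideanSpace ℝ (Fin J))),
      (∀ x : S, Tendsto (fun σ => surfaceExtend σ f (x : E3)) (𝓝[>] 0) (𝓝 (f x))) ∧
      (∀ x : E3, x ∉ S → Tendsto (fun σ => surfaceExtend σ f x) (𝓝[>] 0) (𝓝 0))) ∧
    (∀ x : E3, Tendsto (fun σ => surfaceExtend σ (ContinuousMap.const S (1 : ℝ)) x) (𝓝[>] 0)
      (𝓝 (S.indicator (fun _ => (1 : ℝ)) x))) ∧
    -- (c) mean curvature, for every (possibly only locally defined) unit normal field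
    (∀ (U : Set E3), IsOpen U → ∀ n : E3 → E3, ContinuousOn n (S ∩ U) →
      (∀ y ∈ S ∩ U, IsUnitNormal S y (n y)) → ∀ x ∈ S ∩ U,
        (∀ σ : ℝ, 0 < σ →
          DifferentiableAt ℝ (surfaceExtend σ (ContinuousMap.const S (1 : ℝ))) x) ∧
        Tendsto (fun σ => ∇ (surfaceExtend σ (ContinuousMap.const S (1 : ℝ))) x) (𝓝[>] 0)
          (𝓝 (-(meanCurvature S n x • n x)))) := by
  refine ⟨fun J f σ _ x ε hε => gaussianCloudExtend_tendsto hSc hS f σ x hε,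
    fun J f => ⟨surfaceExtend_tendsto_of_mem hSc hS f,
      fun x hx => surfaceExtend_tendsto_of_notMem hSc hS f hx⟩, fun x => ?_,
    fun U hU n hnc hn x hx => ⟨fun σ _ =>
      (hasGradientAt_surfaceExtend_one hSc hS σ x).hasFDerivAt.differentiableAt, ?_⟩⟩
  · by_cases hx : x ∈ S
    · rw [Set.indicator_of_mem hx]
      exact surfaceExtend_tendsto_of_mem hSc hS (ContinuousMap.const S (1 : ℝ)) ⟨x, hx⟩
    · rw [Set.indicator_of_notMem hx]
      exact surfaceExtend_tendsto_of_notMem hSc hS _ hx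
  · obtain ⟨c⟩ := hS.nonempty_mongeChart hx.1
    rw [c.neg_meanCurvature_smul_normal hU hnc hn hx]
    exact c.tendsto_gradient_surfaceExtend_one hSc hS
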